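/- Let $G$ be a compact Lie group acting smoothly and isometrically on a compact connected Riemannian manifold $M$ of dimension $n$, and suppose that the action has cohomogeneity one, i.e. some $G$-orbit has codimension $1$. Suppose that $K=G_p$ is a singular isotropy group, i.e. $\dim G(p)<n-1$, and that $K$ is normal in $G$. Then: 1. The restriction to $K$ of the $G$-action on $M$ is fixed point homogeneous: the fixed point set $M^K$ is non-empty and has codimension one in the orbit space, $\dim (M/K)=\dim M^K+1$. Here $\dim (M/K)$ is the smallest codimension in $M$ of a $K$-orbit, and $\dim M^K$ is the largest dimension of a component of the submanifold $M^K$. 2. Call an orbit principal if its isotropy groups are, up to conjugation in the acting group, contained in every isotropy group of the action. For every principal $G$-orbit $G(x)\cong G/H$, $H=G_x$, one has $H\subseteq K$, and the principal orbits of the $K$-action on $M$ that lie in $G(x)$ are exactly the fibers of the homogeneous fibration $q\colon G/H\to G/K$, $q(gH)=gK$. These fibers are $q^{-1}(gK)=\{gkH : k\in K\}=gKH\subseteq G/H$, and $G/H$ is identified with $G(x)$ by $gH\mapsto g\cdot x$. -/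

import Mathlib

open scoped Manifold ContDiff Bundle

/-- The subset `A` of the smooth `n`-manifold `M` is, near its point `x`, an embedded submanifold
of dimension `d`: in some smooth chart around `x` it is an affine subspace of dimension `d`. -/
def HasLocalDim (n : ℕ) {M : Type*} [TopologicalSpace M]
    [ChartedSpace (EuclideanSpace ℝ (Fin n)) M] (A : Set M) (x : M) (d : ℕ) : Prop :=
  ∃ e ∈ IsManifold.maximalAtlas (𝓡 n) ∞ M, x ∈ e.source ∧
    ∃ W : Submodule ℝ (EuclideanSpace ℝ (Fin n)), Module.finrank ℝ W = d ∧
      ∀ y ∈ e.source, y ∈ A ↔ e y - e x ∈ W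

/-- `A` is non-empty and locally an embedded submanifold of `M`, where different components of `A`
may have different dimensions, and the largest of these dimensions is `d`. -/
def HasDim (n : ℕ) {M : Type*} [TopologicalSpace M]
    [ChartedSpace (EuclideanSpace ℝ (Fin n)) M] (A : Set M) (d : ℕ) : Prop :=
  (∃ x ∈ A, HasLocalDim n A x d) ∧ ∀ x ∈ A, ∃ d' ≤ d, HasLocalDim n A x d'

/-- The orbit space `M/Γ` has dimension `c`: this is the smallest codimension of an orbit, all
orbits being embedded submanifolds of `M`. -/
def HasOrbitSpaceDim (n : ℕ) (Γ M : Type*) [Group Γ] [TopologicalSpace M]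
    [ChartedSpace (EuclideanSpace ℝ (Fin n)) M] [MulAction Γ M] (c : ℕ) : Prop :=
  ∃ k : ℕ, k + c = n ∧ (∃ x : M, HasDim n (MulAction.orbit Γ x) k) ∧
    ∀ y : M, ∃ k' ≤ k, HasDim n (MulAction.orbit Γ y) k'

/-- The fixed point set `M^Γ`, viewed inside the orbit space `M/Γ`, has codimension one. -/
def IsFixedPointHomogeneous (n : ℕ) (Γ M : Type*) [Group Γ] [TopologicalSpace M]
    [ChartedSpace (EuclideanSpace ℝ (Fin n)) M] [MulAction Γ M] : Prop :=
  ∃ c d : ℕ, HasOrbitSpaceDim n Γ M c ∧ HasDim n (MulAction.fixedPoints Γ M) d ∧ c = d + 1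

/-- Some orbit has codimension one. -/
def IsCohomogeneityOne (n : ℕ) (Γ M : Type*) [Group Γ] [TopologicalSpace M]
    [ChartedSpace (EuclideanSpace ℝ (Fin n)) M] [MulAction Γ M] : Prop :=
  ∃ (x : M) (d : ℕ), HasDim n (MulAction.orbit Γ x) d ∧ d + 1 = n

/-- `K` is a singular isotropy group of a cohomogeneity one action: it is the isotropy group of a
point whose orbit has smaller dimension than the principal orbits, i.e. smaller than `n - 1`. -/
def IsSingularIsotropy (n : ℕ) {G : Type*} (M : Type*) [Group G] [TopologicalSpace M]
    [ChartedSpace (EuclideanSpace ℝ (Fin n)) M] [MulAction G M] (K : Subgroup G) : Prop :=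
  ∃ p : M, K = MulAction.stabilizer G p ∧
    ∃ d : ℕ, HasDim n (MulAction.orbit G p) d ∧ d + 1 < n

/-- The isotropy group of `x` is the smallest possible: up to conjugation it is contained in every
isotropy group (the isotropy group of `g • y` is the conjugate by `g` of that of `y`). -/
def IsPrincipalPoint (Γ : Type*) {M : Type*} [Group Γ] [MulAction Γ M] (x : M) : Prop :=
  ∀ y : M, ∃ g : Γ, MulAction.stabilizer Γ x ≤ MulAction.stabilizer Γ (g • y)

/-- `O` is a principal orbit of the action of `Γ`. -/
def IsPrincipalOrbit (Γ : Type*) {M : Type*} [Group Γ] [MulAction Γ M] (O : Set M) : Prop :=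
  ∃ x : M, IsPrincipalPoint Γ x ∧ O = MulAction.orbit Γ x

/-- Every element of `G` acts by a map whose differentials preserve the Riemannian metric. -/
def IsIsometricAction (n : ℕ) (G M : Type*) [Group G] [TopologicalSpace M]
    [ChartedSpace (EuclideanSpace ℝ (Fin n)) M] [IsManifold (𝓡 n) ∞ M]
    [Bundle.RiemannianBundle (fun x : M => TangentSpace (𝓡 n) x)] [MulAction G M] : Prop :=
  ∀ (g : G) (x : M) (v w : TangentSpace (𝓡 n) x),
    inner ℝ (mfderiv (𝓡 n) (𝓡 n) (fun y : M => g • y) x v)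
      (mfderiv (𝓡 n) (𝓡 n) (fun y : M => g • y) x w) = inner ℝ v w

/-! Let `x` be a fixed point of `K`, let `L ⊇ K` be its isotropy group in `G`, let `R` be the
tangent space of the orbit `G(x)`, and take `Rᗮ` as slice. Normality of `K` has two effects: `K`
fixes all of `G(x)` and so acts trivially on `R`, and the space `W ⊆ Rᗮ` of `K`-fixed vectors is
`L`-invariant. Suppose `W ≠ 0`. If `W = Rᗮ`, then `K` fixes a neighbourhood of `x`, principal
isotropy groups found there contain `K`, and principal orbits have dimension at most `dim G(p) < n -
1`. If `W ≠ Rᗮ`, then near a slice vector with nonzero components in `W` and in its complement, both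
norms are constant along `G`-orbits, so these orbits have codimension at least two on an open set.
Principal points are dense and their orbits have codimension one, so both cases are impossible
(`IsSlice.eq_zero_of_forall_map_eq`). Hence `W = 0`, and near `x` the set `M^K` is `R` in a linear
chart. Its dimension `dim G(x)` is at most `dim G(p)`, with equality at `p`.

A principal isotropy group `H` is conjugate into `K`, hence contained in it by normality, and `dim
K/H = dim G/H - dim G/K = n - 1 - dim G(p)`. Once `H` is known to be minimal also for the `K`-action
(`IsMinimalIsotropy.restrict`, where compactness enters), this gives `dim (M/K) = dim G(p) + 1`. The
fibers of `q` are the `K`-orbits in `G(x)` because `gK = Kg`.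

The transformation group theory rests on the constant rank theorem for orbit maps: orbits are
embedded (`IsLocalParam.hasLocalDim_orbit`) and isotropy groups are again parametrized
(`IsLocalParam.stabilizer`). Bochner averaging linearizes the action of an isotropy group
(`exists_linear_chart`); the metric serves only to make this linear action orthogonal. Then come
slices (`exists_isSlice`) and the principal orbit theorem (`exists_mem_isMinimalIsotropy`). -/

section CohomogeneityOne

open Set Filter Topology Module MeasureTheory

/-! ### Inverse function theorem, Taylor estimate and constant rank theorem. -/

section Analysis

variable {E F : Type*} [NormedAddCommGroup E] [InnerProductSpace ℝ E] [FiniteDimensional ℝ E]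
  [NormedAddCommGroup F] [InnerProductSpace ℝ F]

/-- The inverse must be smooth on the whole target, not only at the image of `a`. Invertible
operators form an open set, so the source can be shrunk until every derivative on it is invertible.
-/
theorem exists_smooth_localInverse {E F : Type*} [NormedAddCommGroup E] [NormedSpace ℝ E]
    [CompleteSpace E] [NormedAddCommGroup F] [NormedSpace ℝ F] {f : E → F} {a : E}
    (hf : ∀ᶠ u in 𝓝 a, ContDiffAt ℝ ∞ f u) (f' : E ≃L[ℝ] F)
    (hf' : HasFDerivAt f (f' : E →L[ℝ] F) a) {S : Set E} (hS : S ∈ 𝓝 a) :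
    ∃ e : OpenPartialHomeomorph E F, a ∈ e.source ∧ e.source ⊆ S ∧ (∀ u, e u = f u) ∧
      (∀ u ∈ e.source, ContDiffAt ℝ ∞ f u) ∧ (∀ v ∈ e.target, ContDiffAt ℝ ∞ e.symm v) := by
  have hfa : ContDiffAt ℝ ∞ f a := hf.self_of_nhds
  have hcont : ContinuousAt (fderiv ℝ f) a :=
    (hfa.fderiv_right (m := 0) (by simp)).continuousAt
  have hequiv : ∀ᶠ u in 𝓝 a, fderiv ℝ f u ∈ range ((↑) : (E ≃L[ℝ] F) → E →L[ℝ] F) := by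
    refine hcont.eventually ?_
    rw [hf'.fderiv]
    exact ContinuousLinearEquiv.nhds f'
  obtain ⟨O, hOsub, hO, haO⟩ := mem_nhds_iff.1 (inter_mem hS (inter_mem hf hequiv))
  let e₀ := hfa.toOpenPartialHomeomorph f hf' (by simp)
  refine ⟨e₀.restrOpen O hO, ⟨hfa.mem_toOpenPartialHomeomorph_source hf' (by simp), haO⟩,
    fun u hu => (hOsub hu.2).1, fun u => rfl, fun u hu => (hOsub hu.2).2.1, fun v hv => ?_⟩
  have hu := (e₀.restrOpen O hO).map_target hv
  obtain ⟨-, h2, f'', h3⟩ := hOsub hu.2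
  replace h2 : ContDiffAt ℝ ∞ f ((e₀.restrOpen O hO).symm v) := h2
  refine (e₀.restrOpen O hO).contDiffAt_symm hv (f₀' := f'') ?_ h2
  rw [h3]
  exact (h2.differentiableAt (by simp)).hasFDerivAt

/-- Second order Taylor estimate. -/
theorem exists_norm_sub_sub_le_sq {E F : Type*} [NormedAddCommGroup E] [NormedSpace ℝ E]
    [NormedAddCommGroup F] [NormedSpace ℝ F] {f : E → F} {a : E}
    (hf : ContDiffAt ℝ ∞ f a) :
    ∃ B : ℝ, 0 ≤ B ∧ ∀ᶠ u in 𝓝 a, ‖f u - f a - fderiv ℝ f a (u - a)‖ ≤ B * ‖u - a‖ ^ 2 := by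
  have h1 : ContDiffAt ℝ 1 (fderiv ℝ f) a := hf.fderiv_right (by norm_cast)
  obtain ⟨K, t, ht, hK⟩ := h1.exists_lipschitzOnWith
  have h2 : ∀ᶠ u in 𝓝 a, DifferentiableAt ℝ f u := by
    have : ∀ᶠ u in 𝓝 a, ContDiffAt ℝ 1 f u :=
      (hf.of_le (m := 1) (by norm_cast)).eventually (by simp)
    exact this.mono fun u hu => hu.differentiableAt (by simp)
  obtain ⟨ε, hε, hball⟩ := Metric.mem_nhds_iff.1 (inter_mem ht h2)
  refine ⟨K, K.2, ?_⟩
  filter_upwards [Metric.ball_mem_nhds a hε] with u hu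
  have hsub : Metric.closedBall a ‖u - a‖ ⊆ Metric.ball a ε := by
    apply Metric.closedBall_subset_ball
    simpa [dist_eq_norm] using hu
  have := (convex_closedBall a ‖u - a‖).norm_image_sub_le_of_norm_hasFDerivWithin_le'
    (f := f) (f' := fderiv ℝ f) (φ := fderiv ℝ f a) (C := K * ‖u - a‖) (x := a) (y := u)
    (fun x hx => ((hball (hsub hx)).2.hasFDerivAt).hasFDerivWithinAt)
    (fun x hx => by
      have := hK.norm_sub_le (hball (hsub hx)).1 (mem_of_mem_nhds ht)
      refine this.trans ?_
      gcongr
      simpa [dist_eq_norm] using hx)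
    (by simp) (by simp [dist_eq_norm])
  calc _ ≤ _ := this
    _ = _ := by ring

/-- The constant rank theorem. -/
theorem constant_rank {f : E → F} (hf : ∀ᶠ u in 𝓝 (0 : E), ContDiffAt ℝ ∞ f u)
    (hrank : ∀ᶠ u in 𝓝 (0 : E), finrank ℝ (LinearMap.range (fderiv ℝ f u : E →ₗ[ℝ] F)) ≤
      finrank ℝ (LinearMap.range (fderiv ℝ f 0 : E →ₗ[ℝ] F)))
    {N : Submodule ℝ E} (hN : N = LinearMap.ker (fderiv ℝ f 0 : E →ₗ[ℝ] F)) :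
    (∀ O ∈ 𝓝 (0 : E), ∀ᶠ u in 𝓝 (0 : E), ∃ c ∈ Nᗮ, c ∈ O ∧ f u = f c) ∧
    ∃ j : N → E, j 0 = 0 ∧ (∀ᶠ b in 𝓝 0, ContDiffAt ℝ ∞ j b) ∧ HasFDerivAt j N.subtypeL 0 ∧
      (∀ᶠ b in 𝓝 0, f (j b) = f 0) ∧
      (∀ᶠ u in 𝓝 (0 : E), f u = f 0 → j (N.orthogonalProjectionOnto u) = u) := by
  classical
  set D := fderiv ℝ f 0 with hD
  set R : Submodule ℝ F := LinearMap.range (D : E →ₗ[ℝ] F) with hR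
  have hf0 : HasFDerivAt f D 0 := (hf.self_of_nhds.differentiableAt (by simp)).hasFDerivAt
  have hDN : ∀ u, D u = 0 ↔ u ∈ N := by intro u; simp [hN]
  have hDR : ∀ u, D u ∈ R := fun u => ⟨u, rfl⟩
  -- New coordinates on `E`: the `R`-part of `f` together with the `N`-part of the point. The
  -- derivative at `0` is injective, and rank-nullity makes it bijective.
  let Φ : E → R × N := fun u => (R.orthogonalProjectionOnto (f u), N.orthogonalProjectionOnto u)
  let Φ' : E →L[ℝ] R × N := (R.orthogonalProjectionOnto ∘L D).prod N.orthogonalProjectionOnto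
  have hΦ' : HasFDerivAt Φ Φ' 0 :=
    ((R.orthogonalProjectionOnto.hasFDerivAt.comp 0 hf0)).prodMk
      N.orthogonalProjectionOnto.hasFDerivAt
  have hproj : ∀ u, R.orthogonalProjectionOnto (D u) = ⟨D u, hDR u⟩ := fun u =>
    R.orthogonalProjectionOnto_mem_subspace_eq_self ⟨D u, hDR u⟩
  have hinj : Function.Injective Φ' := by
    rw [injective_iff_map_eq_zero]
    intro u hu
    have h1 : R.orthogonalProjectionOnto (D u) = 0 := congrArg Prod.fst hu
    have h2 : N.orthogonalProjectionOnto u = 0 := congrArg Prod.snd hu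
    rw [hproj] at h1
    have h3 : u ∈ N := (hDN u).1 (congrArg Subtype.val h1)
    have := N.orthogonalProjectionOnto_mem_subspace_eq_self ⟨u, h3⟩
    rw [h2] at this
    exact (congrArg Subtype.val this).symm
  have hdim : finrank ℝ E = finrank ℝ (R × N) := by
    rw [finrank_prod, hR, hN]
    exact (LinearMap.finrank_range_add_finrank_ker (D : E →ₗ[ℝ] F)).symm
  let Φe : E ≃L[ℝ] R × N :=
    (LinearEquiv.ofInjectiveOfFinrankEq (Φ' : E →ₗ[ℝ] R × N) hinj hdim).toContinuousLinearEquiv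
  have hΦe : (Φe : E →L[ℝ] R × N) = Φ' := by ext u <;> rfl
  have hΦsm : ∀ᶠ u in 𝓝 (0 : E), ContDiffAt ℝ ∞ Φ u := hf.mono fun u hu =>
    (R.orthogonalProjectionOnto.contDiff.contDiffAt.comp u hu).prodMk
      N.orthogonalProjectionOnto.contDiff.contDiffAt
  obtain ⟨e, h0e, hesub, hecoe, hesm, hesymm⟩ :=
    exists_smooth_localInverse hΦsm Φe (hΦe ▸ hΦ') (inter_mem hf hrank)
  set a₀ : R := R.orthogonalProjectionOnto (f 0) with ha₀
  have hΦ0 : Φ 0 = (a₀, 0) := by simp [Φ, ha₀]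
  have he0 : e 0 = (a₀, 0) := by rw [hecoe, hΦ0]
  have htar : e.target ∈ 𝓝 (a₀, (0 : N)) := by
    rw [← he0]; exact e.open_target.mem_nhds (e.map_source h0e)
  have hΦsymm : ∀ y ∈ e.target, Φ (e.symm y) = y := fun y hy => by
    rw [← hecoe]; exact e.right_inv hy
  -- `g a b` does not depend on `b`
  let g : R × N → F := fun y => f (e.symm y)
  have hfd : ∀ u ∈ e.source, DifferentiableAt ℝ f u := fun u hu => by
    have : ContDiffAt ℝ ∞ f u := (hesub hu).1
    exact this.differentiableAt (by simp)
  have hgd : ∀ y ∈ e.target, DifferentiableAt ℝ g y := fun y hy =>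
    DifferentiableAt.comp y (hfd _ (e.map_target hy)) ((hesymm y hy).differentiableAt (by simp))
  have hgfst : ∀ y ∈ e.target, R.orthogonalProjectionOnto (g y) = y.1 := fun y hy =>
    congrArg Prod.fst (hΦsymm y hy)
  have hgder : ∀ y ∈ e.target, ∀ z : R × N, R.orthogonalProjectionOnto (fderiv ℝ g y z) = z.1 := by
    intro y hy z
    have h1 : HasFDerivAt (fun y => R.orthogonalProjectionOnto (g y))
        (R.orthogonalProjectionOnto ∘L fderiv ℝ g y) y :=
      R.orthogonalProjectionOnto.hasFDerivAt.comp y (hgd y hy).hasFDerivAt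
    have h2 : HasFDerivAt (fun y => R.orthogonalProjectionOnto (g y))
        (ContinuousLinearMap.fst ℝ R N) y := by
      refine (ContinuousLinearMap.fst ℝ R N).hasFDerivAt.congr_of_eventuallyEq ?_
      filter_upwards [e.open_target.mem_nhds hy] with y hy using hgfst y hy
    exact DFunLike.congr_fun (h1.unique h2) z
  -- The rank bound enters here. The derivative of `g` along `R` is injective, so its range already
  -- fills the range of `fderiv ℝ f u`. A derivative along `N` therefore equals some `l a`, and
  -- projecting to `R` gives `a = 0`.
  have hgzero : ∀ y ∈ e.target, ∀ b : N, fderiv ℝ g y (0, b) = 0 := by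
    intro y hy b
    have hu := hesub (e.map_target hy)
    set u := e.symm y
    have hcomp : fderiv ℝ g y = fderiv ℝ f u ∘L fderiv ℝ e.symm y :=
      fderiv_comp y (hfd _ (e.map_target hy)) ((hesymm y hy).differentiableAt (by simp))
    let l : R →ₗ[ℝ] F := (fderiv ℝ g y : R × N →ₗ[ℝ] F) ∘ₗ LinearMap.inl ℝ R N
    have hl : Function.Injective l := by
      rw [injective_iff_map_eq_zero]
      intro a ha
      have := hgder y hy (a, 0)
      have h2 : fderiv ℝ g y (a, 0) = 0 := ha
      rw [h2, map_zero] at this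
      exact this.symm
    have hle : LinearMap.range l ≤ LinearMap.range (fderiv ℝ f u : E →ₗ[ℝ] F) := by
      rintro _ ⟨a, rfl⟩
      exact ⟨fderiv ℝ e.symm y (a, 0), by simp [l, hcomp]⟩
    have heq : LinearMap.range l = LinearMap.range (fderiv ℝ f u : E →ₗ[ℝ] F) := by
      apply Submodule.eq_of_le_of_finrank_le hle
      rw [LinearMap.finrank_range_of_inj hl]
      exact hu.2
    have hb : fderiv ℝ g y (0, b) ∈ LinearMap.range l := by
      rw [heq, hcomp]; exact ⟨_, rfl⟩
    obtain ⟨a, ha⟩ := hb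
    have h1 := hgder y hy (0, b)
    rw [← ha] at h1
    have h2 := hgder y hy (a, 0)
    have h3 : a = 0 := by
      have : l a = fderiv ℝ g y (a, 0) := rfl
      rw [this, h2] at h1
      exact h1
    rw [← ha, h3, map_zero]
  obtain ⟨ε, hε, hball⟩ := Metric.mem_nhds_iff.1 htar
  have hconst : ∀ a ∈ Metric.ball a₀ ε, ∀ b ∈ Metric.ball (0 : N) ε, g (a, b) = g (a, 0) := by
    intro a ha b hb
    have hmem : ∀ b ∈ Metric.ball (0 : N) ε, (a, b) ∈ e.target := fun b hb =>
      hball (by rw [← ball_prod_same]; exact ⟨ha, hb⟩)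
    have hder : ∀ b ∈ Metric.ball (0 : N) ε, HasFDerivWithinAt (fun b => g (a, b))
        (0 : N →L[ℝ] F) (Metric.ball (0 : N) ε) b := by
      intro b hb
      have h1 := (hgd _ (hmem b hb)).hasFDerivAt.comp b (hasFDerivAt_prodMk_right a b)
      have h2 : fderiv ℝ g (a, b) ∘L ContinuousLinearMap.inr ℝ R N = 0 := by
        ext b'; simpa using hgzero _ (hmem b hb) b'
      rw [h2] at h1
      exact h1.hasFDerivWithinAt
    exact (convex_ball (0 : N) ε).is_const_of_fderivWithin_eq_zero (𝕜 := ℝ)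
      (fun b hb => (hder b hb).differentiableWithinAt)
      (fun b hb => (hder b hb).fderivWithin (Metric.isOpen_ball.uniqueDiffWithinAt hb)) hb
      (Metric.mem_ball_self hε)
  have hsymm0 : e.symm (a₀, 0) = 0 := by rw [← he0]; exact e.left_inv h0e
  have hballnhds : ∀ᶠ u in 𝓝 (0 : E), u ∈ e.source ∧ (Φ u).1 ∈ Metric.ball a₀ ε ∧
      (Φ u).2 ∈ Metric.ball (0 : N) ε := by
    have hc : ContinuousAt Φ 0 := hΦ'.continuousAt
    have hc1 : Tendsto (fun u => (Φ u).1) (𝓝 0) (𝓝 a₀) := by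
      have := (continuous_fst.continuousAt.tendsto.comp hc)
      rwa [hΦ0] at this
    have hc2 : Tendsto (fun u => (Φ u).2) (𝓝 0) (𝓝 0) := by
      have := (continuous_snd.continuousAt.tendsto.comp hc)
      rwa [hΦ0] at this
    exact (e.open_source.eventually_mem h0e).and ((hc1.eventually (Metric.ball_mem_nhds _ hε)).and
      (hc2.eventually (Metric.ball_mem_nhds _ hε)))
  have hgu : ∀ u ∈ e.source, g (Φ u) = f u := fun u hu => by
    simp only [g]; rw [← hecoe, e.left_inv hu]
  have hsymmc : ContinuousAt e.symm (a₀, 0) := (hesymm _ (mem_of_mem_nhds htar)).continuousAt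
  refine ⟨fun O hO => ?_, fun b => e.symm (a₀, b), hsymm0, ?_, ?_, ?_, ?_⟩
  · have h1 : Tendsto (fun a : R => e.symm (a, 0)) (𝓝 a₀) (𝓝 0) := by
      have h3 : Tendsto (fun a : R => (a, (0 : N))) (𝓝 a₀) (𝓝 (a₀, 0)) :=
        (Continuous.prodMk_left (0 : N)).tendsto a₀
      have := hsymmc.tendsto.comp h3
      rwa [hsymm0] at this
    have hc1 : Tendsto (fun u => (Φ u).1) (𝓝 0) (𝓝 a₀) := by
      have := (continuous_fst.continuousAt.tendsto.comp hΦ'.continuousAt)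
      rwa [hΦ0] at this
    filter_upwards [hballnhds, (h1.comp hc1).eventually hO] with u hu hu2
    have hmem : ((Φ u).1, (0 : N)) ∈ e.target :=
      hball (by rw [← ball_prod_same]; exact ⟨hu.2.1, Metric.mem_ball_self hε⟩)
    -- Sliding the `N`-coordinate to zero does not change `f` and lands in `Nᗮ`.
    refine ⟨e.symm ((Φ u).1, 0), ?_, hu2, ?_⟩
    · have := congrArg Prod.snd (hΦsymm _ hmem)
      exact (Submodule.orthogonalProjectionOnto_eq_zero_iff).1 this
    · rw [← hgu u hu.1]
      exact hconst _ hu.2.1 _ hu.2.2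
  · have h3 : Tendsto (fun b : N => (a₀, b)) (𝓝 0) (𝓝 (a₀, 0)) :=
        (Continuous.prodMk_right a₀).tendsto 0
    filter_upwards [h3.eventually htar] with b hb
    exact (hesymm _ hb).comp b (contDiffAt_const.prodMk contDiffAt_id)
  · have h1 : HasFDerivAt e.symm (Φe.symm : R × N →L[ℝ] E) (a₀, 0) := by
      refine e.hasFDerivAt_symm (mem_of_mem_nhds htar) ?_
      rw [hsymm0, hΦe]
      exact hΦ'.congr_of_eventuallyEq (Eventually.of_forall hecoe)
    have h2 := h1.comp (0 : N) (hasFDerivAt_prodMk_right a₀ (0 : N))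
    convert! h2 using 1
    ext b
    have : Φe (b : E) = (0, b) := by
      have h4 : Φe (b : E) = Φ' b := DFunLike.congr_fun hΦe (b : E)
      rw [h4]
      have h5 : D b = 0 := (hDN b).2 b.2
      simp [Φ', h5]
    simp [← this]
  · have h3 : Tendsto (fun b : N => (a₀, b)) (𝓝 0) (𝓝 (a₀, 0)) :=
        (Continuous.prodMk_right a₀).tendsto 0
    filter_upwards [Metric.ball_mem_nhds (0 : N) hε] with b hb
    have := hconst a₀ (Metric.mem_ball_self hε) b hb
    simp only [g, hsymm0] at this
    exact this
  · filter_upwards [e.open_source.mem_nhds h0e] with u hu h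
    have : Φ u = (a₀, N.orthogonalProjectionOnto u) := by simp [Φ, ha₀, h]
    rw [← this, ← hecoe, e.left_inv hu]

end Analysis

/-! ### Images of maps of constant rank. -/

section Images

variable {E F : Type*} [NormedAddCommGroup E] [InnerProductSpace ℝ E] [FiniteDimensional ℝ E]
  [NormedAddCommGroup F] [InnerProductSpace ℝ F]

/-- This is the Moore-Penrose inverse: invert `D` between `Nᗮ` and `R`, and extend by zero on `Rᗮ`.
-/
theorem exists_partial_inverse (D : E →L[ℝ] F) {N : Submodule ℝ E}
    (hN : N = LinearMap.ker (D : E →ₗ[ℝ] F)) {R : Submodule ℝ F}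
    (hR : R = LinearMap.range (D : E →ₗ[ℝ] F)) [R.HasOrthogonalProjection] :
    ∃ κ : F →L[ℝ] E, (∀ v, κ v ∈ Nᗮ) ∧ (∀ v ∈ R, D (κ v) = v) ∧ (∀ v ∈ Rᗮ, κ v = 0) ∧
      ∀ c ∈ Nᗮ, κ (D c) = c := by
  have hfd : FiniteDimensional ℝ R := by rw [hR]; infer_instance
  obtain ⟨g, hg⟩ := LinearMap.exists_rightInverse_of_surjective
    (D : E →ₗ[ℝ] F).rangeRestrict (LinearMap.range_rangeRestrict _)
  subst hR
  let κ : F →L[ℝ] E := (Nᗮ.starProjection ∘L LinearMap.toContinuousLinearMap g) ∘L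
    (LinearMap.range (D : E →ₗ[ℝ] F)).orthogonalProjectionOnto
  have hDN : ∀ u, D (Nᗮ.starProjection u) = D u := by
    intro u
    have h : u - Nᗮ.starProjection u ∈ N := by
      have := Nᗮ.sub_starProjection_mem_orthogonal u
      rwa [Submodule.orthogonal_orthogonal] at this
    have h2 : D (u - Nᗮ.starProjection u) = 0 := LinearMap.mem_ker.1 (hN.le h)
    rw [map_sub, sub_eq_zero] at h2
    exact h2.symm
  have h1 : ∀ v, κ v ∈ Nᗮ := fun v => Submodule.starProjection_apply_mem _ _
  have h2 : ∀ v ∈ LinearMap.range (D : E →ₗ[ℝ] F), D (κ v) = v := by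
    intro v hv
    simp only [κ, ContinuousLinearMap.comp_apply, hDN]
    have h3 := (LinearMap.range (D : E →ₗ[ℝ] F)).orthogonalProjectionOnto_mem_subspace_eq_self
      ⟨v, hv⟩
    have h4 := congrArg Subtype.val (LinearMap.congr_fun hg ⟨v, hv⟩)
    rw [h3]
    exact h4
  refine ⟨κ, h1, h2, ?_, fun c hc => ?_⟩
  · intro v hv
    simp only [κ, ContinuousLinearMap.comp_apply]
    rw [Submodule.orthogonalProjectionOnto_eq_zero_iff.2 hv]
    simp
  · have h3 : κ (D c) - c ∈ N := by
      rw [hN, LinearMap.mem_ker]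
      have := h2 (D c) ⟨c, rfl⟩
      simp [this]
    have h4 : κ (D c) - c ∈ Nᗮ := Nᗮ.sub_mem (h1 _) hc
    have := (Submodule.mem_orthogonal N _).1 h4 _ h3
    exact sub_eq_zero.1 (inner_self_eq_zero.1 this)

/-- Every nearby value is attained at some `c ∈ Nᗮ`, where `D` is injective and hence `‖c‖` is
bounded by a multiple of `‖f c - f 0‖`. The linear term is orthogonal to `w`, and the Taylor
remainder is quadratic in `c`. The estimate depends on the displacement within the image and not on
the parameter `u`, as is needed for orbits. -/
theorem constant_rank_tangency {f : E → F} (hf : ∀ᶠ u in 𝓝 (0 : E), ContDiffAt ℝ ∞ f u)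
    (hrank : ∀ᶠ u in 𝓝 (0 : E), finrank ℝ (LinearMap.range (fderiv ℝ f u : E →ₗ[ℝ] F)) ≤
      finrank ℝ (LinearMap.range (fderiv ℝ f 0 : E →ₗ[ℝ] F)))
    {R : Submodule ℝ F} (hR : R = LinearMap.range (fderiv ℝ f 0 : E →ₗ[ℝ] F)) :
    ∃ C : ℝ, 0 ≤ C ∧ ∀ᶠ u in 𝓝 (0 : E), ∀ w ∈ Rᗮ,
      |inner ℝ (f u - f 0) w| ≤ C * ‖w‖ * ‖f u - f 0‖ ^ 2 := by
  set D := fderiv ℝ f 0 with hD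
  have hfd : FiniteDimensional ℝ R := by rw [hR]; infer_instance
  obtain ⟨κ, h1, h2, -, h3⟩ := exists_partial_inverse D (N := LinearMap.ker (D : E →ₗ[ℝ] F)) rfl hR
  obtain ⟨hA, -⟩ := constant_rank hf hrank (N := LinearMap.ker (D : E →ₗ[ℝ] F)) rfl
  obtain ⟨B, hB, hT⟩ := exists_norm_sub_sub_le_sq hf.self_of_nhds
  simp only [sub_zero] at hT
  set k := ‖κ‖ with hk
  have hk0 : 0 ≤ k := norm_nonneg _
  have hsmall : ∀ᶠ u in 𝓝 (0 : E), k * B * ‖u‖ < 1 / 2 := by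
    have : Tendsto (fun u : E => k * B * ‖u‖) (𝓝 0) (𝓝 (k * B * ‖(0 : E)‖)) :=
      (continuous_const.mul continuous_norm).tendsto 0
    refine this.eventually (gt_mem_nhds ?_)
    simp
  refine ⟨B * (2 * k) ^ 2, by positivity, ?_⟩
  filter_upwards [hA _ (hT.and hsmall)] with u hu w hw
  obtain ⟨c, hcN, ⟨hc1, hc2⟩, hfu⟩ := hu
  rw [hfu]
  have e1 : inner ℝ (f c - f 0) w = inner ℝ (f c - f 0 - D c) w := by
    have : inner ℝ (D c) w = 0 := (Submodule.mem_orthogonal R w).1 hw _ (hR ▸ ⟨c, rfl⟩)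
    rw [inner_sub_left (f c - f 0), this, sub_zero]
  have e2 : ‖c‖ ≤ 2 * k * ‖f c - f 0‖ := by
    have a1 : ‖c‖ ≤ k * ‖D c‖ := by
      conv_lhs => rw [← h3 c hcN]
      exact κ.le_opNorm _
    have a2 : ‖D c‖ ≤ ‖f c - f 0‖ + B * ‖c‖ ^ 2 := by
      have := norm_sub_norm_le (D c) (D c - (f c - f 0))
      have h5 : ‖D c - (f c - f 0)‖ = ‖f c - f 0 - D c‖ := norm_sub_rev _ _
      have h6 : D c - (D c - (f c - f 0)) = f c - f 0 := by abel
      rw [h5, h6] at this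
      linarith
    -- For small `c` the quadratic error is absorbed into half of `‖c‖`, which accounts for the
    -- factor `2 * k`.
    have a3 : k * (B * ‖c‖ ^ 2) ≤ 1 / 2 * ‖c‖ := by
      have := mul_le_mul_of_nonneg_right hc2.le (norm_nonneg c)
      nlinarith
    have a4 := mul_le_mul_of_nonneg_left a2 hk0
    linarith
  calc |inner ℝ (f c - f 0) w| ≤ ‖f c - f 0 - D c‖ * ‖w‖ := by
        rw [e1]; exact abs_real_inner_le_norm _ _
    _ ≤ B * ‖c‖ ^ 2 * ‖w‖ := by gcongr
    _ ≤ B * (2 * k * ‖f c - f 0‖) ^ 2 * ‖w‖ := by gcongr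
    _ = _ := by ring

/-- The image of a map of constant rank can be straightened. -/
theorem constant_rank_image [CompleteSpace F] {f : E → F}
    (hf : ∀ᶠ u in 𝓝 (0 : E), ContDiffAt ℝ ∞ f u)
    (hrank : ∀ᶠ u in 𝓝 (0 : E), finrank ℝ (LinearMap.range (fderiv ℝ f u : E →ₗ[ℝ] F)) ≤
      finrank ℝ (LinearMap.range (fderiv ℝ f 0 : E →ₗ[ℝ] F)))
    {A : Set F} (hfA : ∀ᶠ u in 𝓝 0, f u ∈ A) (hA : ∀ O ∈ 𝓝 (0 : E), f '' O ∈ 𝓝[A] (f 0))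
    {R : Submodule ℝ F} (hR : R = LinearMap.range (fderiv ℝ f 0 : E →ₗ[ℝ] F)) :
    ∃ h : OpenPartialHomeomorph F F, f 0 ∈ h.source ∧ h (f 0) = 0 ∧
      (∀ y ∈ h.source, ContDiffAt ℝ ∞ h y) ∧ (∀ y ∈ h.target, ContDiffAt ℝ ∞ h.symm y) ∧
      ∀ y ∈ h.source, y ∈ A ↔ h y ∈ R := by
  set D := fderiv ℝ f 0 with hD
  have hfd : FiniteDimensional ℝ R := by rw [hR]; infer_instance
  obtain ⟨κ, h1, h2, h2', h3⟩ :=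
    exists_partial_inverse D (N := LinearMap.ker (D : E →ₗ[ℝ] F)) rfl hR
  obtain ⟨hB, -⟩ := constant_rank hf hrank (N := LinearMap.ker (D : E →ₗ[ℝ] F)) rfl
  have hκP : ∀ v, κ (R.starProjection v) = κ v := fun v => by
    have := h2' _ (R.sub_starProjection_mem_orthogonal v)
    rw [map_sub, sub_eq_zero] at this
    exact this.symm
  -- `Θ` maps `R` into the image of `f` and moves off it by adding the `Rᗮ`-component. Its
  -- derivative at `0` is the identity, and its local inverse is the straightening chart.
  let Θ : F → F := fun v => f (κ v) + (v - R.starProjection v)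
  have hκ0 : Tendsto κ (𝓝 0) (𝓝 0) := by simpa using κ.continuous.tendsto 0
  have hΘ0 : Θ 0 = f 0 := by simp [Θ]
  have hΘ' : HasFDerivAt Θ ((ContinuousLinearEquiv.refl ℝ F : F ≃L[ℝ] F) : F →L[ℝ] F) 0 := by
    have hf0 : HasFDerivAt f D (κ 0) := by
      rw [map_zero]
      exact (hf.self_of_nhds.differentiableAt (by simp)).hasFDerivAt
    have := (hf0.comp 0 κ.hasFDerivAt).add
      ((hasFDerivAt_id (0 : F)).sub R.starProjection.hasFDerivAt)
    convert! this using 1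
    ext v
    have : D (κ v) = R.starProjection v := by
      rw [← hκP]; exact h2 _ (Submodule.starProjection_apply_mem _ _)
    simp [this]
  have hΘsm : ∀ᶠ v in 𝓝 (0 : F), ContDiffAt ℝ ∞ Θ v := (hκ0.eventually hf).mono fun v hv =>
    (ContDiffAt.comp v hv κ.contDiff.contDiffAt).add
      (contDiffAt_id.sub R.starProjection.contDiff.contDiffAt)
  obtain ⟨e, h0e, hesub, hecoe, hesm, hesymm⟩ :=
    exists_smooth_localInverse hΘsm _ hΘ' (hκ0.eventually hfA)
  have hDs : ∀ᶠ u in 𝓝 (0 : E), D u ∈ e.source := by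
    have : Tendsto D (𝓝 0) (𝓝 0) := by simpa using D.continuous.tendsto 0
    exact this.eventually (e.open_source.mem_nhds h0e)
  have hY := hA _ (hB _ hDs)
  obtain ⟨Y, hY, hfY, hYsub⟩ := mem_nhdsWithin.1 hY
  have he0 : e 0 = f 0 := by rw [hecoe, hΘ0]
  refine ⟨e.symm.restrOpen Y hY, ⟨he0 ▸ e.map_source h0e, hfY⟩, ?_, fun y hy => hesymm _ hy.1,
    fun y hy => ?_, fun y hy => ⟨fun hyA => ?_, fun hyR => ?_⟩⟩
  · change e.symm (f 0) = 0
    rw [← he0, e.left_inv h0e]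
  · have h5 : y ∈ e.source := hy.1
    refine (hesm y h5).congr_of_eventuallyEq (Eventually.of_forall hecoe)
  · obtain ⟨u, ⟨c, hcN, hcs, hfc⟩, rfl⟩ := hYsub ⟨hy.2, hyA⟩
    change e.symm (f u) ∈ R
    have hDR : D c ∈ R := hR ▸ ⟨c, rfl⟩
    have : e (D c) = f u := by
      rw [hecoe, hfc]
      simp [Θ, h3 c hcN, Submodule.starProjection_eq_self_iff.2 hDR]
    rw [← this, e.left_inv hcs]
    exact hDR
  · replace hyR : e.symm y ∈ R := hyR
    have h5 : e.symm y ∈ e.source := e.map_target hy.1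
    have h6 : e (e.symm y) = y := e.right_inv hy.1
    rw [hecoe] at h6
    simp only [Θ, Submodule.starProjection_eq_self_iff.2 hyR, sub_self, add_zero] at h6
    rw [← h6]
    exact hesub h5

end Images

/-! ### Charts and the local dimension of subsets. -/

section Charts

variable {n : ℕ} {M : Type*} [TopologicalSpace M] [ChartedSpace (EuclideanSpace ℝ (Fin n)) M]

theorem trans_mem_maximalAtlas_of_contDiffAt [IsManifold (𝓡 n) ∞ M]
    {e : OpenPartialHomeomorph M (EuclideanSpace ℝ (Fin n))}
    (he : e ∈ IsManifold.maximalAtlas (𝓡 n) ∞ M)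
    {h : OpenPartialHomeomorph (EuclideanSpace ℝ (Fin n)) (EuclideanSpace ℝ (Fin n))}
    (h1 : ∀ y ∈ h.source, ContDiffAt ℝ ∞ h y) (h2 : ∀ y ∈ h.target, ContDiffAt ℝ ∞ h.symm y) :
    e.trans h ∈ IsManifold.maximalAtlas (𝓡 n) ∞ M := by
  rw [IsManifold.mem_maximalAtlas_iff_contMDiffOn] at he ⊢
  constructor
  · have := (show ContMDiffOn (𝓡 n) (𝓡 n) ∞ h h.source from
      fun y hy => (h1 y hy).contMDiffAt.contMDiffWithinAt).comp' he.1
    rw [e.trans_source]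
    exact this
  · have := he.2.comp' (show ContMDiffOn (𝓡 n) (𝓡 n) ∞ h.symm h.target from
      fun y hy => (h2 y hy).contMDiffAt.contMDiffWithinAt)
    rw [e.trans_target]
    exact this

theorem homeomorph_trans_mem_maximalAtlas [IsManifold (𝓡 n) ∞ M] (φ : M ≃ₜ M)
    (h1 : ContMDiff (𝓡 n) (𝓡 n) ∞ φ) (h2 : ContMDiff (𝓡 n) (𝓡 n) ∞ φ.symm)
    {e : OpenPartialHomeomorph M (EuclideanSpace ℝ (Fin n))}
    (he : e ∈ IsManifold.maximalAtlas (𝓡 n) ∞ M) :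
    φ.toOpenPartialHomeomorph.trans e ∈ IsManifold.maximalAtlas (𝓡 n) ∞ M := by
  rw [IsManifold.mem_maximalAtlas_iff_contMDiffOn] at he ⊢
  constructor
  · have := he.1.comp' (h1.contMDiffOn (s := univ))
    rw [OpenPartialHomeomorph.trans_source]
    exact this
  · have := (h2.contMDiffOn (s := univ)).comp' he.2
    rw [OpenPartialHomeomorph.trans_target]
    exact this

theorem HasLocalDim.preimage [IsManifold (𝓡 n) ∞ M] (φ : M ≃ₜ M)
    (h1 : ContMDiff (𝓡 n) (𝓡 n) ∞ φ) (h2 : ContMDiff (𝓡 n) (𝓡 n) ∞ φ.symm)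
    {A : Set M} {x : M} {d : ℕ} (h : HasLocalDim n A (φ x) d) : HasLocalDim n (φ ⁻¹' A) x d := by
  obtain ⟨e, he, hx, W, hW, hA⟩ := h
  refine ⟨_, homeomorph_trans_mem_maximalAtlas φ h1 h2 he, ⟨mem_univ _, hx⟩, W, hW, fun y hy => ?_⟩
  exact hA (φ y) hy.2

theorem contDiffAt_comp_symm_of_mem_maximalAtlas
    {e e' : OpenPartialHomeomorph M (EuclideanSpace ℝ (Fin n))}
    (he : e ∈ IsManifold.maximalAtlas (𝓡 n) ∞ M) (he' : e' ∈ IsManifold.maximalAtlas (𝓡 n) ∞ M)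
    {x : M} (hx : x ∈ e.source) (hx' : x ∈ e'.source) :
    ContDiffAt ℝ ∞ (fun y => e' (e.symm y)) (e x) := by
  rw [← contMDiffAt_iff_contDiffAt]
  have h1 := contMDiffAt_symm_of_mem_maximalAtlas he (e.map_source hx)
  refine ContMDiffAt.comp (e x) ?_ h1
  rw [e.left_inv hx]
  exact contMDiffAt_of_mem_maximalAtlas he' hx'

/-- The derivative of the transition map is injective and maps `W` into `W'`: the difference
quotients along `W` lie in the closed subspace `W'`. By symmetry the local dimension is well
defined. -/
theorem HasLocalDim.le {A : Set M} {x : M} {d d' : ℕ} (h : HasLocalDim n A x d)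
    (h' : HasLocalDim n A x d') : d ≤ d' := by
  obtain ⟨e, he, hx, W, hW, hA⟩ := h
  obtain ⟨e', he', hx', W', hW', hA'⟩ := h'
  have hτ := (contDiffAt_comp_symm_of_mem_maximalAtlas he he' hx hx').differentiableAt (by simp)
  have hσ := (contDiffAt_comp_symm_of_mem_maximalAtlas he' he hx' hx).differentiableAt (by simp)
  set τ : EuclideanSpace ℝ (Fin n) → EuclideanSpace ℝ (Fin n) := fun y => e' (e.symm y)
  set σ : EuclideanSpace ℝ (Fin n) → EuclideanSpace ℝ (Fin n) := fun y => e (e'.symm y)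
  have hτx : τ (e x) = e' x := by simp [τ, e.left_inv hx]
  have hS : ∀ᶠ y in 𝓝 (e x), y ∈ e.target ∧ e.symm y ∈ e'.source := by
    refine (e.open_target.eventually_mem (e.map_source hx)).and ?_
    have : ContinuousAt e.symm (e x) := e.continuousAt_symm (e.map_source hx)
    rw [ContinuousAt, e.left_inv hx] at this
    exact this.eventually (e'.open_source.eventually_mem hx')
  -- the derivative of the transition map is injective
  have hcomp : (fderiv ℝ σ (τ (e x))) ∘L fderiv ℝ τ (e x) = ContinuousLinearMap.id ℝ _ := by
    rw [← fderiv_comp (e x) (by rw [hτx]; exact hσ) hτ]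
    rw [Filter.EventuallyEq.fderiv_eq (f₁ := σ ∘ τ) (f := id) ?_, fderiv_id]
    filter_upwards [hS] with y hy
    simp [σ, τ, e'.left_inv hy.2, e.right_inv hy.1]
  have hmaps : ∀ w ∈ W, fderiv ℝ τ (e x) w ∈ W' := by
    intro w hw
    have hd : HasDerivAt (fun t : ℝ => τ (e x + t • w)) (fderiv ℝ τ (e x) w) 0 := by
      have h1 : HasDerivAt (fun t : ℝ => e x + t • w) w 0 := by
        simpa using ((hasDerivAt_id (0 : ℝ)).smul_const w).const_add (e x)
      have h2 : HasFDerivAt τ (fderiv ℝ τ (e x)) (e x + (0 : ℝ) • w) := by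
        simpa using hτ.hasFDerivAt
      exact h2.comp_hasDerivAt (0 : ℝ) h1
    have hc : Tendsto (fun t : ℝ => e x + t • w) (𝓝 0) (𝓝 (e x)) := by
      have : Continuous (fun t : ℝ => e x + t • w) := by fun_prop
      simpa using this.tendsto 0
    rw [hasDerivAt_iff_tendsto_slope] at hd
    have hcl : IsClosed (W' : Set (EuclideanSpace ℝ (Fin n))) := W'.closed_of_finiteDimensional
    refine hcl.mem_of_tendsto hd ?_
    have := hc.mono_left (nhdsWithin_le_nhds (s := {0}ᶜ))
    filter_upwards [this.eventually hS] with t ht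
    have h3 : e.symm (e x + t • w) ∈ A := by
      rw [hA _ (e.map_target ht.1), e.right_inv ht.1]
      simpa using W.smul_mem t hw
    rw [hA' _ ht.2] at h3
    simp only [slope, vsub_eq_sub, zero_smul, add_zero, hτx, sub_zero]
    exact W'.smul_mem _ h3
  let l : W →ₗ[ℝ] W' := ((fderiv ℝ τ (e x) : _ →ₗ[ℝ] _) ∘ₗ W.subtype).codRestrict W'
    (fun w => hmaps w w.2)
  have hl : Function.Injective l := by
    intro a b hab
    have h1 : fderiv ℝ τ (e x) a = fderiv ℝ τ (e x) b := congrArg Subtype.val hab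
    have h2 := congrArg (fderiv ℝ σ (τ (e x))) h1
    have h3 : ∀ v, fderiv ℝ σ (τ (e x)) (fderiv ℝ τ (e x) v) = v := DFunLike.congr_fun hcomp
    rw [h3, h3] at h2
    exact Subtype.ext h2
  rw [← hW, ← hW']
  exact LinearMap.finrank_le_finrank_of_injective hl

theorem HasLocalDim.unique {A : Set M} {x : M} {d d' : ℕ} (h : HasLocalDim n A x d)
    (h' : HasLocalDim n A x d') : d = d' := le_antisymm (h.le h') (h'.le h)

/-- The hypothesis `hA` says that `p` is open onto `A` at `0`. It excludes other sheets of `A`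
accumulating at `p 0`, so that `A` is embedded and not merely immersed. -/
theorem hasLocalDim_of_constant_rank [IsManifold (𝓡 n) ∞ M]
    {E : Type*} [NormedAddCommGroup E] [InnerProductSpace ℝ E] [FiniteDimensional ℝ E]
    {e : OpenPartialHomeomorph M (EuclideanSpace ℝ (Fin n))}
    (he : e ∈ IsManifold.maximalAtlas (𝓡 n) ∞ M) {p : E → M} {A : Set M}
    (hx : p 0 ∈ e.source) (hpc : ContinuousAt p 0)
    (hf : ∀ᶠ u in 𝓝 (0 : E), ContDiffAt ℝ ∞ (fun u => e (p u)) u)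
    (hrank : ∀ᶠ u in 𝓝 (0 : E),
      finrank ℝ (LinearMap.range
        (fderiv ℝ (fun u => e (p u)) u : E →ₗ[ℝ] EuclideanSpace ℝ (Fin n))) ≤
      finrank ℝ (LinearMap.range
        (fderiv ℝ (fun u => e (p u)) 0 : E →ₗ[ℝ] EuclideanSpace ℝ (Fin n))))
    (hfA : ∀ᶠ u in 𝓝 0, p u ∈ A) (hA : ∀ O ∈ 𝓝 (0 : E), p '' O ∈ 𝓝[A] (p 0)) :
    HasLocalDim n A (p 0)
      (finrank ℝ (LinearMap.range
        (fderiv ℝ (fun u => e (p u)) 0 : E →ₗ[ℝ] EuclideanSpace ℝ (Fin n)))) := by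
  have hpe : ∀ᶠ u in 𝓝 0, p u ∈ e.source := hpc.eventually (e.open_source.eventually_mem hx)
  have hfA' : ∀ᶠ u in 𝓝 0, e (p u) ∈ e.target ∩ e.symm ⁻¹' A := by
    filter_upwards [hpe, hfA] with u hu1 hu2
    exact ⟨e.map_source hu1, by simpa [e.left_inv hu1] using hu2⟩
  have hA' : ∀ O ∈ 𝓝 (0 : E), (fun u => e (p u)) '' O ∈
      𝓝[e.target ∩ e.symm ⁻¹' A] (e (p 0)) := by
    intro O hO
    have h7 : Tendsto e.symm (𝓝[e.target ∩ e.symm ⁻¹' A] (e (p 0))) (𝓝[A] (p 0)) := by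
      rw [tendsto_nhdsWithin_iff]
      have := e.continuousAt_symm (e.map_source hx)
      rw [ContinuousAt, e.left_inv hx] at this
      exact ⟨this.mono_left nhdsWithin_le_nhds,
        eventually_nhdsWithin_of_forall fun y hy => hy.2⟩
    filter_upwards [h7 (hA O hO), self_mem_nhdsWithin] with y hy hy2
    obtain ⟨u, hu, huy⟩ := hy
    exact ⟨u, hu, by simp [huy, e.right_inv hy2.1]⟩
  obtain ⟨h, h1, h2, h3, h4, h5⟩ := constant_rank_image hf hrank hfA' hA' rfl
  refine ⟨_, trans_mem_maximalAtlas_of_contDiffAt he h3 h4, ?_, _, rfl, fun y hy => ?_⟩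
  · rw [e.trans_source]; exact ⟨hx, h1⟩
  · rw [e.trans_source] at hy
    have h6 := h5 (e y) hy.2
    rw [OpenPartialHomeomorph.coe_trans, Function.comp, Function.comp, h2, sub_zero, ← h6]
    simp [e.left_inv hy.1, e.map_source hy.1]

end Charts

/-- `φ` is a smooth parametrization of a neighbourhood of `1` in the subgroup `Γ`, in which left
translations are differentiable. -/
structure IsLocalParam (m : ℕ) {G : Type*} [Group G] [TopologicalSpace G]
    [ChartedSpace (EuclideanSpace ℝ (Fin m)) G] (Γ : Subgroup G)
    {E : Type*} [NormedAddCommGroup E] [NormedSpace ℝ E] (φ : E → G) : Prop where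
  map_zero : φ 0 = 1
  mem : ∀ᶠ u in 𝓝 0, φ u ∈ Γ
  smooth : ∀ᶠ u in 𝓝 0, ContMDiffAt 𝓘(ℝ, E) (𝓡 m) ∞ φ u
  image_mem : ∀ O ∈ 𝓝 (0 : E), φ '' O ∈ 𝓝[(Γ : Set G)] 1
  translate : ∀ᶠ u₀ in 𝓝 0, ∃ τ : E → E, DifferentiableAt ℝ τ u₀ ∧ τ u₀ = 0 ∧
    ∀ᶠ u in 𝓝 u₀, φ u = φ u₀ * φ (τ u)

/-! ### Local parametrizations of subgroups; orbits and isotropy groups. -/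

section Orbits

variable {m n : ℕ} {G M : Type*} [Group G] [TopologicalSpace G]
  [ChartedSpace (EuclideanSpace ℝ (Fin m)) G]
  [TopologicalSpace M] [ChartedSpace (EuclideanSpace ℝ (Fin n)) M] [MulAction G M]
  {Γ : Subgroup G} {E : Type*} [NormedAddCommGroup E]

/-- The elements of `Γ` outside the open set `P` of those that an isotropy element carries into `O`
form a compact set. They move `y` to a closed set avoiding `y`, and its complement is the desired
neighbourhood. Compactness thus makes orbits embedded. -/
theorem smul_mem_nhdsWithin_orbit [IsTopologicalGroup G] [T2Space M] [ContinuousSMul G M]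
    [CompactSpace G]
    (hΓ : IsClosed (Γ : Set G)) {N : Set G} (hN : N ∈ 𝓝[(Γ : Set G)] 1) (y : M) :
    (fun g : G => g • y) '' N ∈ 𝓝[MulAction.orbit Γ y] y := by
  obtain ⟨O, hO, h1O, hON⟩ := mem_nhdsWithin.1 hN
  have hP : IsOpen {g : G | ∃ h : G, h • y = y ∧ h ∈ Γ ∧ g * h ∈ O} := by
    have : {g : G | ∃ h : G, h • y = y ∧ h ∈ Γ ∧ g * h ∈ O} =
        ⋃ h ∈ {h : G | h • y = y ∧ h ∈ Γ}, (fun g => g * h) ⁻¹' O := by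
      ext g; simp [and_assoc]
    rw [this]
    exact isOpen_biUnion fun h _ => hO.preimage (continuous_mul_const h)
  set P := {g : G | ∃ h : G, h • y = y ∧ h ∈ Γ ∧ g * h ∈ O}
  have hcomp : IsCompact ((Γ : Set G) \ P) := (hΓ.isCompact).diff hP
  have himg : IsClosed ((fun g : G => g • y) '' ((Γ : Set G) \ P)) :=
    (hcomp.image (continuous_id.smul continuous_const)).isClosed
  rw [mem_nhdsWithin]
  refine ⟨_, himg.isOpen_compl, ?_, ?_⟩
  · rintro ⟨g, ⟨hgΓ, hgP⟩, hgy⟩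
    refine hgP ⟨g⁻¹, ?_, Γ.inv_mem hgΓ, by simpa using h1O⟩
    exact inv_smul_eq_iff.2 hgy.symm
  · rintro z ⟨hz, ⟨g, rfl⟩⟩
    have hg : (g : G) ∈ P := by
      by_contra hcon
      exact hz ⟨g, ⟨g.2, hcon⟩, rfl⟩
    obtain ⟨h, hhy, hhΓ, hgh⟩ := hg
    exact ⟨g * h, hON ⟨hgh, Γ.mul_mem g.2 hhΓ⟩, by simp [mul_smul, hhy, Subgroup.smul_def]⟩

theorem contMDiff_const_smul' (m : ℕ) [ChartedSpace (EuclideanSpace ℝ (Fin m)) G]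
    [ContMDiffSMul (𝓡 m) (𝓡 n) ∞ G M] (g : G) :
    ContMDiff (𝓡 n) (𝓡 n) ∞ (fun y : M => g • y) :=
  (contMDiff_smul (I := 𝓡 m) (I' := 𝓡 n) (n := ∞) (G := G) (M := M)).comp
    (contMDiff_const.prodMk contMDiff_id)

section Normed
variable [NormedSpace ℝ E] {φ : E → G}

theorem IsLocalParam.smooth_smul (h : IsLocalParam m Γ φ) [ContMDiffSMul (𝓡 m) (𝓡 n) ∞ G M]
    {e : OpenPartialHomeomorph M (EuclideanSpace ℝ (Fin n))}
    (he : e ∈ IsManifold.maximalAtlas (𝓡 n) ∞ M) {x : M} (hx : x ∈ e.source) :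
    ∀ᶠ u in 𝓝 (0 : E), ContDiffAt ℝ ∞ (fun u => e (φ u • x)) u := by
  have h1 : ∀ u, ContMDiffAt 𝓘(ℝ, E) (𝓡 m) ∞ φ u →
      ContMDiffAt 𝓘(ℝ, E) (𝓡 n) ∞ (fun u => φ u • x) u := fun u hu =>
    hu.smul contMDiffAt_const
  have h2 : ∀ᶠ u in 𝓝 (0 : E), φ u • x ∈ e.source := by
    have := (h1 0 h.smooth.self_of_nhds).continuousAt
    refine this.eventually (e.open_source.eventually_mem ?_)
    simpa [h.map_zero] using hx
  filter_upwards [h2, h.smooth] with u hu hu'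
  rw [← contMDiffAt_iff_contDiffAt]
  exact (contMDiffAt_of_mem_maximalAtlas he hu).comp u (h1 u hu')

/-- Near `u₀` the orbit map is the orbit map near `0`, precomposed with `τ` and postcomposed with
the action of `φ u₀`. Neither composition can raise the rank. -/
theorem IsLocalParam.rank_le [FiniteDimensional ℝ E]
    (h : IsLocalParam m Γ φ) [ContMDiffSMul (𝓡 m) (𝓡 n) ∞ G M]
    {e : OpenPartialHomeomorph M (EuclideanSpace ℝ (Fin n))}
    (he : e ∈ IsManifold.maximalAtlas (𝓡 n) ∞ M) {x : M} (hx : x ∈ e.source) :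
    ∀ᶠ u in 𝓝 (0 : E), finrank ℝ (LinearMap.range
      (fderiv ℝ (fun u => e (φ u • x)) u : E →ₗ[ℝ] EuclideanSpace ℝ (Fin n))) ≤
      finrank ℝ (LinearMap.range
      (fderiv ℝ (fun u => e (φ u • x)) 0 : E →ₗ[ℝ] EuclideanSpace ℝ (Fin n))) := by
  set f : E → EuclideanSpace ℝ (Fin n) := fun u => e (φ u • x) with hf
  have hc : ContinuousAt (fun u => φ u • x) 0 :=
    (h.smooth.self_of_nhds.smul (contMDiffAt_const (c := x)) :
      ContMDiffAt 𝓘(ℝ, E) (𝓡 n) ∞ (fun u => φ u • x) 0).continuousAt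
  have hsrc : ∀ᶠ u in 𝓝 (0 : E), φ u • x ∈ e.source := by
    refine hc.eventually (e.open_source.eventually_mem ?_)
    simpa [h.map_zero] using hx
  filter_upwards [h.translate, hsrc] with u₀ ⟨τ, hτ, hτ0, hφ⟩ hu₀
  let ψ : EuclideanSpace ℝ (Fin n) → EuclideanSpace ℝ (Fin n) := fun y => e (φ u₀ • e.symm y)
  have hψ : DifferentiableAt ℝ ψ (f (τ u₀)) := by
    have hfe : f (τ u₀) = e x := by simp [hf, hτ0, h.map_zero]
    rw [hfe]
    refine ContDiffAt.differentiableAt (n := ∞) ?_ (by simp)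
    rw [← contMDiffAt_iff_contDiffAt]
    have h2 : ContMDiffAt (𝓡 n) (𝓡 n) ∞ (fun y => φ u₀ • e.symm y) (e x) :=
      ((contMDiff_const_smul' m (φ u₀)).contMDiffAt).comp (e x)
      (contMDiffAt_symm_of_mem_maximalAtlas he (e.map_source hx))
    refine ContMDiffAt.comp (e x) ?_ h2
    rw [e.left_inv hx]
    exact contMDiffAt_of_mem_maximalAtlas he hu₀
  have hf0 : DifferentiableAt ℝ f (τ u₀) := by
    rw [hτ0]
    exact (h.smooth_smul he hx).self_of_nhds.differentiableAt (by simp)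
  have heq : f =ᶠ[𝓝 u₀] (ψ ∘ f) ∘ τ := by
    have h3 : ∀ᶠ u in 𝓝 u₀, φ (τ u) • x ∈ e.source := by
      have : Tendsto τ (𝓝 u₀) (𝓝 0) := by simpa [hτ0] using hτ.continuousAt.tendsto
      exact this.eventually hsrc
    filter_upwards [h3, hφ] with u hu hu'
    simp only [hf, ψ, Function.comp, e.left_inv hu]
    rw [smul_smul, ← hu']
  rw [heq.fderiv_eq, fderiv_comp u₀ (hψ.comp _ hf0) hτ, fderiv_comp (τ u₀) hψ hf0, hτ0]
  refine (Submodule.finrank_mono (t := LinearMap.range (((fderiv ℝ ψ (f 0)) ∘L (fderiv ℝ f 0) :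
    E →L[ℝ] EuclideanSpace ℝ (Fin n)) : E →ₗ[ℝ] EuclideanSpace ℝ (Fin n))) ?_).trans ?_
  · rintro _ ⟨u, rfl⟩
    exact ⟨_, rfl⟩
  · rw [ContinuousLinearMap.toLinearMap_comp, LinearMap.range_comp]
    exact Submodule.finrank_map_le _ _

theorem IsLocalParam.image_smul_mem [IsTopologicalGroup G] [T2Space M] [ContinuousSMul G M]
    [CompactSpace G]
    (h : IsLocalParam m Γ φ) (hΓ : IsClosed (Γ : Set G)) {O : Set E} (hO : O ∈ 𝓝 0) (y : M) :
    (fun u => φ u • y) '' O ∈ 𝓝[MulAction.orbit Γ y] y := by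
  have := smul_mem_nhdsWithin_orbit hΓ (h.image_mem O hO) y
  rwa [image_image] at this

end Normed

variable [InnerProductSpace ℝ E] [FiniteDimensional ℝ E] {φ : E → G}

theorem IsLocalParam.hasLocalDim_orbit [IsTopologicalGroup G] [IsManifold (𝓡 n) ∞ M]
    [T2Space M] [ContinuousSMul G M] [CompactSpace G] [ContMDiffSMul (𝓡 m) (𝓡 n) ∞ G M]
    (h : IsLocalParam m Γ φ) (hΓ : IsClosed (Γ : Set G))
    {e : OpenPartialHomeomorph M (EuclideanSpace ℝ (Fin n))}
    (he : e ∈ IsManifold.maximalAtlas (𝓡 n) ∞ M) {x : M} (hx : x ∈ e.source) :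
    HasLocalDim n (MulAction.orbit Γ x) x (finrank ℝ (LinearMap.range
      (fderiv ℝ (fun u => e (φ u • x)) 0 : E →ₗ[ℝ] EuclideanSpace ℝ (Fin n)))) := by
  have h0 : φ 0 • x = x := by simp [h.map_zero]
  have := hasLocalDim_of_constant_rank he (p := fun u => φ u • x) (A := MulAction.orbit Γ x)
    (by simpa [h0] using hx)
    (h.smooth.self_of_nhds.smul (contMDiffAt_const (c := x)) :
      ContMDiffAt 𝓘(ℝ, E) (𝓡 n) ∞ (fun u => φ u • x) 0).continuousAt
    (h.smooth_smul he hx) (h.rank_le he hx)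
    (h.mem.mono fun u hu => ⟨⟨φ u, hu⟩, rfl⟩)
    (fun O hO => by simpa [h0] using h.image_smul_mem hΓ hO x)
  simpa only [h0] using this

/-- To first order, orbits stay in their tangent space. -/
theorem IsLocalParam.orbit_tangency [IsTopologicalGroup G] [T2Space M] [ContinuousSMul G M]
    [CompactSpace G] [ContMDiffSMul (𝓡 m) (𝓡 n) ∞ G M]
    (h : IsLocalParam m Γ φ) (hΓ : IsClosed (Γ : Set G))
    {e : OpenPartialHomeomorph M (EuclideanSpace ℝ (Fin n))}
    (he : e ∈ IsManifold.maximalAtlas (𝓡 n) ∞ M) {x : M} (hx : x ∈ e.source) :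
    ∃ C : ℝ, 0 ≤ C ∧ ∀ᶠ z in 𝓝[MulAction.orbit Γ x] x, ∀ w ∈ (LinearMap.range
      (fderiv ℝ (fun u => e (φ u • x)) 0 : E →ₗ[ℝ] EuclideanSpace ℝ (Fin n)))ᗮ,
      |inner ℝ (e z - e x) w| ≤ C * ‖w‖ * ‖e z - e x‖ ^ 2 := by
  obtain ⟨C, hC, hev⟩ := constant_rank_tangency (h.smooth_smul he hx) (h.rank_le he hx) rfl
  refine ⟨C, hC, ?_⟩
  filter_upwards [h.image_smul_mem hΓ hev x] with z hz
  obtain ⟨u, hu, rfl⟩ := hz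
  simpa [h.map_zero] using hu

/-- The fiber of the orbit map of `x` is parametrized by `j`, with derivative the inclusion of the
kernel. Along `j` the group elements fix `x`, hence `y`, so the orbit map of `y` has zero derivative
there. -/
theorem IsLocalParam.ker_le [ContinuousSMul G M] [ContMDiffSMul (𝓡 m) (𝓡 n) ∞ G M]
    (h : IsLocalParam m Γ φ)
    {e : OpenPartialHomeomorph M (EuclideanSpace ℝ (Fin n))}
    (he : e ∈ IsManifold.maximalAtlas (𝓡 n) ∞ M) {x : M} (hx : x ∈ e.source)
    {e' : OpenPartialHomeomorph M (EuclideanSpace ℝ (Fin n))}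
    (he' : e' ∈ IsManifold.maximalAtlas (𝓡 n) ∞ M) {y : M} (hy : y ∈ e'.source)
    (hxy : ∀ g ∈ Γ, g • x = x → g • y = y) :
    LinearMap.ker (fderiv ℝ (fun u => e (φ u • x)) 0 : E →ₗ[ℝ] EuclideanSpace ℝ (Fin n)) ≤
    LinearMap.ker (fderiv ℝ (fun u => e' (φ u • y)) 0 : E →ₗ[ℝ] EuclideanSpace ℝ (Fin n)) := by
  obtain ⟨-, j, hj0, hjs, hj', hfj, -⟩ := constant_rank (h.smooth_smul he hx) (h.rank_le he hx) rfl
  intro u hu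
  have hjc : Tendsto j (𝓝 0) (𝓝 0) := by simpa [hj0] using hj'.continuousAt.tendsto
  have hc : ContinuousAt (fun u => φ u • x) 0 :=
    (h.smooth.self_of_nhds.smul (contMDiffAt_const (c := x)) :
      ContMDiffAt 𝓘(ℝ, E) (𝓡 n) ∞ (fun u => φ u • x) 0).continuousAt
  have hsrc : ∀ᶠ u in 𝓝 (0 : E), φ u • x ∈ e.source := by
    refine hc.eventually (e.open_source.eventually_mem ?_)
    simpa [h.map_zero] using hx
  have hconst : (fun b => e' (φ (j b) • y)) =ᶠ[𝓝 0] fun _ => e' y := by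
    filter_upwards [hfj, hjc.eventually hsrc, hjc.eventually h.mem] with b hb hb2 hb3
    simp only [h.map_zero, one_smul] at hb
    have := e.injOn hb2 hx hb
    rw [hxy _ hb3 this]
  have hd : HasFDerivAt (fun u => e' (φ u • y)) (fderiv ℝ (fun u => e' (φ u • y)) 0) (j 0) := by
    rw [hj0]
    exact ((h.smooth_smul he' hy).self_of_nhds.differentiableAt (by simp)).hasFDerivAt
  have h1 := hd.comp 0 hj'
  have h2 : HasFDerivAt (fun b => e' (φ (j b) • y)) (0 : _ →L[ℝ] EuclideanSpace ℝ (Fin n)) 0 :=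
    (hasFDerivAt_const _ _).congr_of_eventuallyEq hconst
  exact DFunLike.congr_fun (h1.unique h2) ⟨u, hu⟩

/-- The isotropy group is a fiber of the orbit map, which has constant rank. The parametrization of
the fiber therefore shows it to be a Lie subgroup, and its tangent space is the kernel `N`. -/
theorem IsLocalParam.stabilizer [ContinuousSMul G M] [ContMDiffSMul (𝓡 m) (𝓡 n) ∞ G M]
    (h : IsLocalParam m Γ φ)
    {e : OpenPartialHomeomorph M (EuclideanSpace ℝ (Fin n))}
    (he : e ∈ IsManifold.maximalAtlas (𝓡 n) ∞ M) {x : M} (hx : x ∈ e.source)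
    {N : Submodule ℝ E} (hN : N = LinearMap.ker
      (fderiv ℝ (fun u => e (φ u • x)) 0 : E →ₗ[ℝ] EuclideanSpace ℝ (Fin n))) :
    ∃ j : N → E, j 0 = 0 ∧ HasFDerivAt j N.subtypeL 0 ∧
      IsLocalParam m (Γ ⊓ MulAction.stabilizer G x) (φ ∘ j) := by
  obtain ⟨-, j, hj0, hjs, hj', hfj, hjN⟩ := constant_rank (h.smooth_smul he hx) (h.rank_le he hx) hN
  have hjc : Tendsto j (𝓝 0) (𝓝 0) := by simpa [hj0] using hj'.continuousAt.tendsto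
  have hc : ContinuousAt (fun u => φ u • x) 0 :=
    (h.smooth.self_of_nhds.smul (contMDiffAt_const (c := x)) :
      ContMDiffAt 𝓘(ℝ, E) (𝓡 n) ∞ (fun u => φ u • x) 0).continuousAt
  have hsrc : ∀ᶠ u in 𝓝 (0 : E), φ u • x ∈ e.source := by
    refine hc.eventually (e.open_source.eventually_mem ?_)
    simpa [h.map_zero] using hx
  have hjx : ∀ᶠ b in 𝓝 0, φ (j b) • x = x := by
    filter_upwards [hfj, hjc.eventually hsrc] with b hb hb2
    simp only [h.map_zero, one_smul] at hb
    exact e.injOn hb2 hx hb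
  simp only [h.map_zero, one_smul] at hjN
  refine ⟨j, hj0, hj', by simp [hj0, h.map_zero], ?_, ?_, fun O hO => ?_, ?_⟩
  · filter_upwards [hjx, hjc.eventually h.mem] with b hb hb2 using ⟨hb2, hb⟩
  · filter_upwards [hjs, hjc.eventually h.smooth] with b hb hb2
    exact hb2.comp b hb.contMDiffAt
  · have hP : Tendsto N.orthogonalProjectionOnto (𝓝 0) (𝓝 0) := by
      simpa using N.orthogonalProjectionOnto.continuous.tendsto 0
    have h1 := h.image_mem _ (hjN.and (hP.eventually hO))
    have h2 : 𝓝[(Γ ⊓ MulAction.stabilizer G x : Subgroup G)] (1 : G) ≤ 𝓝[(Γ : Set G)] 1 :=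
      nhdsWithin_mono _ fun g hg => hg.1
    filter_upwards [h2 h1, self_mem_nhdsWithin] with g hg hg2
    obtain ⟨u, ⟨hu1, hu2⟩, rfl⟩ := hg
    have h3 : φ u • x = x := hg2.2
    exact ⟨_, hu2, by simp [hu1 (by rw [h3])]⟩
  · filter_upwards [hjc.eventually h.translate, hjx, hjs, hjx.eventually_nhds] with
      b₀ ⟨τ, hτ, hτ0, hφ⟩ hb₀ hjb₀ hjx'
    have hτc : Tendsto (fun b => τ (j b)) (𝓝 b₀) (𝓝 0) := by
      have := hτ.continuousAt.tendsto.comp hjb₀.continuousAt.tendsto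
      rwa [hτ0] at this
    refine ⟨fun b => N.orthogonalProjectionOnto (τ (j b)),
      N.orthogonalProjectionOnto.differentiableAt.comp b₀
        (hτ.comp b₀ (hjb₀.differentiableAt (by simp))), by simp [hτ0], ?_⟩
    filter_upwards [hτc.eventually hjN, hjb₀.continuousAt.eventually hφ, hjx'] with b hb hb2 hb3
    have h3 : φ (τ (j b)) • x = x := by
      rw [hb2, mul_smul] at hb3
      exact (smul_left_cancel (φ (j b₀)) (hb3.trans hb₀.symm))
    simp only [Function.comp]
    rw [hb (by rw [h3]), hb2]

end Orbits

theorem exists_isLocalParam_top {m : ℕ} {G : Type*} [Group G] [TopologicalSpace G]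
    [ChartedSpace (EuclideanSpace ℝ (Fin m)) G] [LieGroup (𝓡 m) ∞ G] :
    ∃ φ : EuclideanSpace ℝ (Fin m) → G, IsLocalParam m (⊤ : Subgroup G) φ := by
  have : IsTopologicalGroup G := topologicalGroup_of_lieGroup (𝓡 m) ∞
  set e := chartAt (EuclideanSpace ℝ (Fin m)) (1 : G) with he
  have he1 : (1 : G) ∈ e.source := mem_chart_source _ _
  have hea : e ∈ IsManifold.maximalAtlas (𝓡 m) ∞ G := IsManifold.chart_mem_maximalAtlas _
  have hadd : Tendsto (fun u => u + e 1) (𝓝 0) (𝓝 (e 1)) := by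
    have : Continuous (fun u => u + e 1) := by fun_prop
    simpa using this.tendsto 0
  have htar : ∀ᶠ u in 𝓝 0, u + e 1 ∈ e.target :=
    hadd.eventually (e.open_target.eventually_mem (e.map_source he1))
  have hsm : ∀ u, u + e 1 ∈ e.target →
      ContMDiffAt 𝓘(ℝ, EuclideanSpace ℝ (Fin m)) (𝓡 m) ∞ (fun u => e.symm (u + e 1)) u :=
    fun u hu => (contMDiffAt_symm_of_mem_maximalAtlas hea hu).comp u
      (contDiffAt_id.add contDiffAt_const).contMDiffAt
  refine ⟨fun u => e.symm (u + e 1), by simp [e.left_inv he1], by simp, htar.mono hsm,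
    fun O hO => ?_, ?_⟩
  · simp only [Subgroup.coe_top, nhdsWithin_univ]
    have h1 : Tendsto (fun g => e g - e 1) (𝓝 1) (𝓝 0) := by
      have := (e.continuousAt he1).tendsto.sub_const (e 1)
      simpa using this
    filter_upwards [h1 hO, e.open_source.mem_nhds he1] with g hg hg2
    exact ⟨_, hg, by simp [e.left_inv hg2]⟩
  · filter_upwards [htar] with u₀ hu₀
    set g₀ := e.symm (u₀ + e 1) with hg₀
    have hs : ContMDiffAt 𝓘(ℝ, EuclideanSpace ℝ (Fin m)) (𝓡 m) ∞
        (fun u => g₀⁻¹ * e.symm (u + e 1)) u₀ := contMDiffAt_const.mul (hsm u₀ hu₀)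
    have h1 : g₀⁻¹ * e.symm (u₀ + e 1) = 1 := by simp [hg₀]
    refine ⟨fun u => e (g₀⁻¹ * e.symm (u + e 1)) - e 1, ?_, by simp [h1], ?_⟩
    · refine DifferentiableAt.sub_const ?_ _
      refine ContDiffAt.differentiableAt (n := ∞) ?_ (by simp)
      rw [← contMDiffAt_iff_contDiffAt]
      refine ContMDiffAt.comp u₀ ?_ hs
      rw [h1]
      exact contMDiffAt_of_mem_maximalAtlas hea he1
    · have := hs.continuousAt
      rw [ContinuousAt, h1] at this
      filter_upwards [this.eventually (e.open_source.eventually_mem he1)] with u hu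
      simp [e.left_inv hu]

/-! ### Smoothness of integrals over a compact parameter space. -/

section ParametricIntegral

universe u

variable {Z X : Type*} [NormedAddCommGroup Z] [NormedSpace ℝ Z] [TopologicalSpace X]

/-- A family of maps which, in a continuous parameter, is the restriction of a smooth map. -/
def IsSmoothFamilyAt (Z : Type*) [NormedAddCommGroup Z] [NormedSpace ℝ Z]
    {E F : Type*} [NormedAddCommGroup E] [NormedSpace ℝ E]
    [NormedAddCommGroup F] [NormedSpace ℝ F] (h : X → E → F) (q₀ : X × E) : Prop :=
  ∃ (c : X → Z) (H : Z × E → F), ContinuousAt c q₀.1 ∧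
    (∀ᶠ p in 𝓝 (c q₀.1, q₀.2), ContDiffAt ℝ ∞ H p) ∧ ∀ᶠ q in 𝓝 q₀, h q.1 q.2 = H (c q.1, q.2)

section
variable {E F : Type*} [NormedAddCommGroup E] [NormedSpace ℝ E]
    [NormedAddCommGroup F] [NormedSpace ℝ F] {h : X → E → F} {q₀ : X × E}

theorem IsSmoothFamilyAt.continuousAt (hh : IsSmoothFamilyAt Z h q₀) :
    ContinuousAt (fun q : X × E => h q.1 q.2) q₀ := by
  obtain ⟨c, H, hc, hH, he⟩ := hh
  refine ContinuousAt.congr ?_ (he.mono fun q hq => hq.symm)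
  have h1 : ContinuousAt (fun q : X × E => (c q.1, q.2)) q₀ :=
    (ContinuousAt.comp (f := Prod.fst) hc continuousAt_fst).prodMk continuousAt_snd
  exact ContinuousAt.comp (f := fun q : X × E => (c q.1, q.2)) hH.self_of_nhds.continuousAt h1

theorem IsSmoothFamilyAt.differentiableAt (hh : IsSmoothFamilyAt Z h q₀) :
    DifferentiableAt ℝ (h q₀.1) q₀.2 := by
  obtain ⟨c, H, hc, hH, he⟩ := hh
  have h1 : h q₀.1 =ᶠ[𝓝 q₀.2] fun y => H (c q₀.1, y) :=
    ((Continuous.prodMk_right q₀.1).tendsto q₀.2).eventually he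
  refine DifferentiableAt.congr_of_eventuallyEq ?_ h1
  exact (hH.self_of_nhds.differentiableAt (by simp)).comp q₀.2
    (hasFDerivAt_prodMk_right (c q₀.1) q₀.2).differentiableAt

theorem IsSmoothFamilyAt.fderiv (hh : IsSmoothFamilyAt Z h q₀) :
    IsSmoothFamilyAt Z (fun l y => fderiv ℝ (h l) y) q₀ := by
  obtain ⟨c, H, hc, hH, he⟩ := hh
  refine ⟨c, fun p => (_root_.fderiv ℝ H p) ∘L ContinuousLinearMap.inr ℝ Z E, hc, ?_, ?_⟩
  · filter_upwards [hH] with p hp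
    have : ContDiffAt ℝ ∞ (_root_.fderiv ℝ H) p := hp.fderiv_right (by simp)
    exact this.clm_comp contDiffAt_const
  · have h1 : ContinuousAt (fun q : X × E => (c q.1, q.2)) q₀ :=
      (ContinuousAt.comp (f := Prod.fst) hc continuousAt_fst).prodMk continuousAt_snd
    filter_upwards [he.eventually_nhds, h1.eventually hH] with q hq hq2
    have h2 : h q.1 =ᶠ[𝓝 q.2] fun y => H (c q.1, y) :=
      ((Continuous.prodMk_right q.1).tendsto q.2).eventually hq
    rw [h2.fderiv_eq]
    exact ((hq2.differentiableAt (by simp)).hasFDerivAt.comp q.2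
      (hasFDerivAt_prodMk_right (c q.1) q.2)).fderiv

end

variable [CompactSpace X] [MeasurableSpace X] [BorelSpace X] (μ : Measure X) [IsFiniteMeasure μ]

theorem hasFDerivAt_integral_of_isSmoothFamilyAt {E F : Type*} [NormedAddCommGroup E]
    [NormedSpace ℝ E] [FiniteDimensional ℝ E] [NormedAddCommGroup F] [NormedSpace ℝ F]
    [CompleteSpace F] {h : X → E → F} {U : Set E}
    (hU : IsOpen U) (hh : ∀ l, ∀ y ∈ U, IsSmoothFamilyAt Z h (l, y)) {y₀ : E} (hy₀ : y₀ ∈ U) :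
    HasFDerivAt (fun y => ∫ l, h l y ∂μ) (∫ l, fderiv ℝ (h l) y₀ ∂μ) y₀ := by
  have hc : ∀ y ∈ U, Continuous fun l => h l y := fun y hy => continuous_iff_continuousAt.2 fun l =>
    ContinuousAt.comp (f := fun l => (l, y)) (g := fun q : X × E => h q.1 q.2)
      (hh l y hy).continuousAt (Continuous.prodMk_left y).continuousAt
  have hc' : ∀ y ∈ U, Continuous fun l => fderiv ℝ (h l) y := fun y hy =>
    continuous_iff_continuousAt.2 fun l =>
    ContinuousAt.comp (f := fun l => (l, y)) (g := fun q : X × E => fderiv ℝ (h q.1) q.2)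
      (hh l y hy).fderiv.continuousAt (Continuous.prodMk_left y).continuousAt
  obtain ⟨ε, hε, hball⟩ := Metric.nhds_basis_closedBall.mem_iff.1 (hU.mem_nhds hy₀)
  have hK : IsCompact ((univ : Set X) ×ˢ Metric.closedBall y₀ ε) :=
    isCompact_univ.prod (isCompact_closedBall y₀ ε)
  have hKc : ContinuousOn (fun q : X × E => fderiv ℝ (h q.1) q.2)
      ((univ : Set X) ×ˢ Metric.closedBall y₀ ε) := fun q hq =>
    ((hh q.1 q.2 (hball hq.2)).fderiv.continuousAt).continuousWithinAt
  obtain ⟨C, hC⟩ := hK.exists_bound_of_continuousOn hKc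
  refine hasFDerivAt_integral_of_dominated_of_fderiv_le (bound := fun _ => C)
    -- The dominating constant `C` comes from continuity of the derivative on the compact product of
    -- `X` with a closed ball.
    (s := Metric.ball y₀ ε) (F' := fun y l => fderiv ℝ (h l) y)
    (Metric.ball_mem_nhds y₀ hε) ?_ ?_ ?_ ?_ (integrable_const C) ?_
  · filter_upwards [hU.mem_nhds hy₀] with y hy using
      ((hc y hy).integrable_of_hasCompactSupport
        (HasCompactSupport.of_compactSpace _)).aestronglyMeasurable
  · exact (hc y₀ hy₀).integrable_of_hasCompactSupport (HasCompactSupport.of_compactSpace _)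
  · exact ((hc' y₀ hy₀).integrable_of_hasCompactSupport
      (HasCompactSupport.of_compactSpace _)).aestronglyMeasurable
  · exact Eventually.of_forall fun l y hy => hC (l, y) ⟨mem_univ _, Metric.ball_subset_closedBall hy⟩
  · exact Eventually.of_forall fun l y hy =>
      (hh l y (hball (Metric.ball_subset_closedBall hy))).differentiableAt.hasFDerivAt

/-- The derivative of the integral is the integral of the derivatives, again a smooth family, now
with values in `E →L[ℝ] F`. The induction therefore generalizes `F`, and `E` and `F` share a
universe. -/
theorem contDiffOn_integral_of_isSmoothFamilyAt {E : Type u} [NormedAddCommGroup E]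
    [NormedSpace ℝ E] [FiniteDimensional ℝ E] {U : Set E} (hU : IsOpen U) (k : ℕ) :
    ∀ {F : Type u} [NormedAddCommGroup F] [NormedSpace ℝ F] [CompleteSpace F] {h : X → E → F},
    (∀ l, ∀ y ∈ U, IsSmoothFamilyAt Z h (l, y)) →
    ContDiffOn ℝ k (fun y => ∫ l, h l y ∂μ) U := by
  induction k with
  | zero =>
    intro F _ _ _ h hh
    rw [Nat.cast_zero, contDiffOn_zero]
    exact fun y hy => (hasFDerivAt_integral_of_isSmoothFamilyAt μ hU hh
      hy).continuousAt.continuousWithinAt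
  | succ k ih =>
    intro F _ _ _ h hh
    push_cast
    rw [contDiffOn_succ_iff_fderiv_of_isOpen hU]
    refine ⟨fun y hy => (hasFDerivAt_integral_of_isSmoothFamilyAt μ hU hh
      hy).differentiableAt.differentiableWithinAt, by simp, ?_⟩
    refine (ih fun l y hy => (hh l y hy).fderiv).congr fun y hy => ?_
    exact (hasFDerivAt_integral_of_isSmoothFamilyAt μ hU hh hy).fderiv

end ParametricIntegral

/-! ### Bochner linearization at a fixed point. -/

section Linearization

variable {m n : ℕ} {G M : Type*} [Group G] [TopologicalSpace G]
  [ChartedSpace (EuclideanSpace ℝ (Fin m)) G]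
  [TopologicalSpace M] [ChartedSpace (EuclideanSpace ℝ (Fin n)) M] [MulAction G M]

/-- An affine change of a chart turns the Riemannian inner product at `x` into the Euclidean one.
Differentials of isometries fixing `x` then become orthogonal maps. -/
theorem exists_chart_fderiv_isometric [IsManifold (𝓡 n) ∞ M]
    [Bundle.RiemannianBundle (fun x : M => TangentSpace (𝓡 n) x)]
    [ContMDiffSMul (𝓡 m) (𝓡 n) ∞ G M] (hisom : IsIsometricAction n G M) (x : M) :
    ∃ e ∈ IsManifold.maximalAtlas (𝓡 n) ∞ M, x ∈ e.source ∧ e x = 0 ∧ ∀ g : G, g • x = x →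
      ∀ v, ‖fderiv ℝ (fun y => e (g • e.symm y)) 0 v‖ = ‖v‖ := by
  let c := chartAt (EuclideanSpace ℝ (Fin n)) x
  have hcx : x ∈ c.source := mem_chart_source _ x
  have hfr : finrank ℝ (TangentSpace (𝓡 n) x) = n := finrank_euclideanSpace_fin
  have hfd : FiniteDimensional ℝ (TangentSpace (𝓡 n) x) :=
    inferInstanceAs (FiniteDimensional ℝ (EuclideanSpace ℝ (Fin n)))
  let J₀ : TangentSpace (𝓡 n) x ≃ₗᵢ[ℝ] EuclideanSpace ℝ (Fin n) :=
    ((stdOrthonormalBasis ℝ (TangentSpace (𝓡 n) x)).reindex (finCongr hfr)).repr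
  let J₁ : EuclideanSpace ℝ (Fin n) ≃ₗ[ℝ] EuclideanSpace ℝ (Fin n) := J₀.toLinearEquiv
  let J : EuclideanSpace ℝ (Fin n) ≃L[ℝ] EuclideanSpace ℝ (Fin n) := J₁.toContinuousLinearEquiv
  have hJ : ∀ v : TangentSpace (𝓡 n) x, ‖J v‖ ^ 2 = inner ℝ v v := fun v => by
    have : J v = J₀ v := rfl
    rw [this, J₀.norm_map, real_inner_self_eq_norm_sq]
  let h : OpenPartialHomeomorph (EuclideanSpace ℝ (Fin n)) (EuclideanSpace ℝ (Fin n)) :=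
    ((Homeomorph.subRight (c x)).trans J.toHomeomorph).toOpenPartialHomeomorph
  have hh : ∀ y, h y = J (y - c x) := fun y => rfl
  have he : c.trans h ∈ IsManifold.maximalAtlas (𝓡 n) ∞ M := by
    refine trans_mem_maximalAtlas_of_contDiffAt (IsManifold.chart_mem_maximalAtlas x)
      (fun y _ => ?_) (fun y _ => ?_)
    · exact (J.contDiff.comp (contDiff_id.sub contDiff_const)).contDiffAt
    · exact (J.symm.contDiff.add contDiff_const).contDiffAt
  refine ⟨_, he, ?_, ?_, fun g hg v => ?_⟩
  · rw [c.trans_source]; exact ⟨hcx, mem_univ _⟩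
  · simp [hh]
  · have hmd : MDifferentiableAt (𝓡 n) (𝓡 n) (fun y : M => g • y) x :=
      (contMDiff_const_smul' m g).mdifferentiable (by simp) x
    set D : EuclideanSpace ℝ (Fin n) →L[ℝ] EuclideanSpace ℝ (Fin n) :=
      fderiv ℝ (fun y => c (g • c.symm y)) (c x) with hD
    have hmf : mfderiv (𝓡 n) (𝓡 n) (fun y : M => g • y) x = D := by
      rw [hmd.mfderiv, hD]
      simp only [writtenInExtChartAt, extChartAt, mfld_simps, fderivWithin_univ]
      rw [hg]
      rfl
    have hiso : ∀ w : EuclideanSpace ℝ (Fin n), ‖J (D w)‖ ^ 2 = ‖J w‖ ^ 2 := by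
      intro w
      have h1 := hisom g x w w
      rw [hmf] at h1
      have h2 : ∀ z : M, z = x → ∀ a b : EuclideanSpace ℝ (Fin n),
          inner ℝ (show TangentSpace (𝓡 n) z from a) (show TangentSpace (𝓡 n) z from b) =
          inner ℝ (show TangentSpace (𝓡 n) x from a) (show TangentSpace (𝓡 n) x from b) := by
        rintro z rfl a b; rfl
      exact (hJ (D w)).trans (((h2 _ hg _ _).symm.trans h1).trans (hJ w).symm)
    have hDd : HasFDerivAt (fun y => c (g • c.symm y)) D (c x) := by
      refine (ContDiffAt.differentiableAt (n := ∞) ?_ (by simp)).hasFDerivAt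
      rw [← contMDiffAt_iff_contDiffAt]
      refine ContMDiffAt.comp (c x) (g := c) (I' := 𝓡 n) ?_
        ((contMDiff_const_smul' m g).contMDiffAt.comp (c x) (contMDiffAt_symm_of_mem_maximalAtlas
          (IsManifold.chart_mem_maximalAtlas x) (c.map_source hcx)))
      simp only [c.left_inv hcx, hg]
      exact contMDiffAt_of_mem_maximalAtlas (IsManifold.chart_mem_maximalAtlas x) hcx
    have hDh : HasFDerivAt (fun y => (c.trans h) (g • (c.trans h).symm y))
        ((J : _ →L[ℝ] EuclideanSpace ℝ (Fin n)) ∘L D ∘L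
        (J.symm : _ →L[ℝ] EuclideanSpace ℝ (Fin n))) 0 := by
      have h1 : HasFDerivAt (fun y : EuclideanSpace ℝ (Fin n) => J.symm y + c x)
          (J.symm : _ →L[ℝ] EuclideanSpace ℝ (Fin n)) 0 := J.symm.hasFDerivAt.add_const _
      have h2 : HasFDerivAt (fun y => c (g • c.symm y)) D (J.symm 0 + c x) := by simpa using hDd
      have h3 := (h2.comp 0 h1).sub_const (c x)
      exact J.hasFDerivAt.comp 0 h3
    rw [hDh.fderiv]
    have h4 := hiso (J.symm v)
    rw [J.apply_symm_apply] at h4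
    exact (sq_eq_sq₀ (norm_nonneg _) (norm_nonneg _)).1 h4

/-- The bad points are the projection of a closed subset of `L × M` along the compact factor `L`,
hence a closed set. -/
theorem isOpen_forall_smul_mem [T2Space G] [ContinuousSMul G M] [CompactSpace G] {L : Subgroup G}
    (hL : IsClosed (L : Set G)) {S : Set M} (hS : IsOpen S) :
    IsOpen {z : M | ∀ l ∈ L, l • z ∈ S} := by
  have : CompactSpace L := isCompact_iff_compactSpace.1 hL.isCompact
  have h1 : IsClosed {q : L × M | (q.1 : G) • q.2 ∉ S} := by
    refine hS.isClosed_compl.preimage (f := fun q : L × M => (q.1 : G) • q.2) ?_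
    fun_prop
  have h2 := isClosedMap_snd_of_compactSpace _ h1
  rw [← isClosed_compl_iff]
  convert h2 using 1
  ext z
  simp

end Linearization

theorem IsSmoothFamilyAt.clm_apply {X : Type*} [TopologicalSpace X] {Z Z' E F F' : Type*}
    [NormedAddCommGroup Z] [NormedSpace ℝ Z]
    [NormedAddCommGroup Z'] [NormedSpace ℝ Z'] [NormedAddCommGroup E] [NormedSpace ℝ E]
    [NormedAddCommGroup F] [NormedSpace ℝ F] [NormedAddCommGroup F'] [NormedSpace ℝ F']
    {a : X → E → F →L[ℝ] F'} {h : X → E → F} {l₀ : X} {y₁ y₀ : E}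
    (ha : IsSmoothFamilyAt Z a (l₀, y₁)) (hh : IsSmoothFamilyAt Z' h (l₀, y₀)) :
    IsSmoothFamilyAt (Z × Z') (fun l y => a l y₁ (h l y)) (l₀, y₀) := by
  obtain ⟨c, A, hc, hA, hea⟩ := ha
  obtain ⟨c', H, hc', hH, heh⟩ := hh
  refine ⟨fun l => (c l, c' l), fun p => A (p.1.1, y₁) (H (p.1.2, p.2)), hc.prodMk hc', ?_, ?_⟩
  · have h1 : Tendsto (fun p : (Z × Z') × E => (p.1.1, y₁)) (𝓝 ((c l₀, c' l₀), y₀))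
        (𝓝 (c l₀, y₁)) := by
      have : Continuous (fun p : (Z × Z') × E => (p.1.1, y₁)) := by fun_prop
      exact this.tendsto _
    have h2 : Tendsto (fun p : (Z × Z') × E => (p.1.2, p.2)) (𝓝 ((c l₀, c' l₀), y₀))
        (𝓝 (c' l₀, y₀)) := by
      have : Continuous (fun p : (Z × Z') × E => (p.1.2, p.2)) := by fun_prop
      exact this.tendsto _
    filter_upwards [h1.eventually hA, h2.eventually hH] with p hp hp'
    refine ContDiffAt.clm_apply ?_ ?_
    · exact ContDiffAt.comp (f := fun p : (Z × Z') × E => (p.1.1, y₁)) p hp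
        (by fun_prop)
    · exact ContDiffAt.comp (f := fun p : (Z × Z') × E => (p.1.2, p.2)) p hp'
        (by fun_prop)
  · have h1 : Tendsto (fun q : X × E => (q.1, y₁)) (𝓝 (l₀, y₀)) (𝓝 (l₀, y₁)) := by
      have : Continuous (fun q : X × E => (q.1, y₁)) := by fun_prop
      exact this.tendsto _
    filter_upwards [heh, h1.eventually hea] with q hq hq'
    rw [hq, hq']

section Linearization

variable {m n : ℕ} {G M : Type*} [Group G] [TopologicalSpace G]
  [ChartedSpace (EuclideanSpace ℝ (Fin m)) G]
  [TopologicalSpace M] [ChartedSpace (EuclideanSpace ℝ (Fin n)) M] [MulAction G M]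

theorem isSmoothFamilyAt_smul [IsManifold (𝓡 m) ∞ G] [ContMDiffSMul (𝓡 m) (𝓡 n) ∞ G M]
    {X : Type*} [TopologicalSpace X] {θ : X → G} (hθ : Continuous θ)
    {e : OpenPartialHomeomorph M (EuclideanSpace ℝ (Fin n))}
    (he : e ∈ IsManifold.maximalAtlas (𝓡 n) ∞ M) {l₀ : X} {y₀ : EuclideanSpace ℝ (Fin n)}
    (hy₀ : y₀ ∈ e.target) (hl₀ : θ l₀ • e.symm y₀ ∈ e.source) :
    IsSmoothFamilyAt (EuclideanSpace ℝ (Fin m)) (fun l y => e (θ l • e.symm y)) (l₀, y₀) := by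
  have : ContinuousSMul G M := ContMDiffSMul.continuousSMul (I := 𝓡 m) (I' := 𝓡 n) ∞
  set c := chartAt (EuclideanSpace ℝ (Fin m)) (θ l₀) with hc
  have hcs : θ l₀ ∈ c.source := mem_chart_source _ _
  have hca : c ∈ IsManifold.maximalAtlas (𝓡 m) ∞ G := IsManifold.chart_mem_maximalAtlas _
  refine ⟨fun l => c (θ l), fun p => e (c.symm p.1 • e.symm p.2),
    (c.continuousAt hcs).comp hθ.continuousAt, ?_, ?_⟩
  · have h1 : ∀ᶠ p in 𝓝 (c (θ l₀), y₀), p.1 ∈ c.target ∧ p.2 ∈ e.target :=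
      (continuousAt_fst.eventually (c.open_target.eventually_mem (c.map_source hcs))).and
        (continuousAt_snd.eventually (e.open_target.eventually_mem hy₀))
    have hsm : ∀ p : EuclideanSpace ℝ (Fin m) × EuclideanSpace ℝ (Fin n),
        p.1 ∈ c.target ∧ p.2 ∈ e.target →
        ContMDiffAt 𝓘(ℝ, EuclideanSpace ℝ (Fin m) × EuclideanSpace ℝ (Fin n)) (𝓡 n) ∞
          (fun p => c.symm p.1 • e.symm p.2) p := by
      intro p hp
      exact ((contMDiffAt_symm_of_mem_maximalAtlas hca hp.1).comp p
        contDiffAt_fst.contMDiffAt).smul ((contMDiffAt_symm_of_mem_maximalAtlas he hp.2).comp p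
        contDiffAt_snd.contMDiffAt)
    have h2 : ∀ᶠ p in 𝓝 (c (θ l₀), y₀), c.symm p.1 • e.symm p.2 ∈ e.source := by
      refine (hsm _ h1.self_of_nhds).continuousAt.eventually (e.open_source.eventually_mem ?_)
      simpa [c.left_inv hcs] using hl₀
    filter_upwards [h1, h2] with p hp hp2
    rw [← contMDiffAt_iff_contDiffAt]
    exact (contMDiffAt_of_mem_maximalAtlas he hp2).comp p (hsm p hp)
  · have h1 : Tendsto (fun q : X × EuclideanSpace ℝ (Fin n) => θ q.1) (𝓝 (l₀, y₀))
        (𝓝 (θ l₀)) := (hθ.comp continuous_fst).tendsto _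
    filter_upwards [h1.eventually (c.open_source.eventually_mem hcs)] with q hq
    simp [c.left_inv hq]

/-- Bochner linearization: near a fixed point, a compact group of isometries acts linearly in
a suitable chart. -/
theorem exists_linear_chart [LieGroup (𝓡 m) ∞ G] [T2Space G] [CompactSpace G]
    [IsManifold (𝓡 n) ∞ M]
    [Bundle.RiemannianBundle (fun x : M => TangentSpace (𝓡 n) x)]
    [ContMDiffSMul (𝓡 m) (𝓡 n) ∞ G M] (hisom : IsIsometricAction n G M)
    {L : Subgroup G} (hL : IsClosed (L : Set G)) {x : M} (hx : ∀ l ∈ L, l • x = x) :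
    ∃ e ∈ IsManifold.maximalAtlas (𝓡 n) ∞ M,
      ∃ (A : G → EuclideanSpace ℝ (Fin n) →L[ℝ] EuclideanSpace ℝ (Fin n)) (r : ℝ), 0 < r ∧
      x ∈ e.source ∧ e x = 0 ∧ e.target = Metric.ball 0 r ∧ (∀ l ∈ L, ∀ v, ‖A l v‖ = ‖v‖) ∧
      ∀ l ∈ L, ∀ y ∈ e.source, l • y ∈ e.source ∧ e (l • y) = A l (e y) := by
  have : ContinuousSMul G M := ContMDiffSMul.continuousSMul (I := 𝓡 m) (I' := 𝓡 n) ∞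
  have : IsTopologicalGroup G := topologicalGroup_of_lieGroup (𝓡 m) ∞
  have : CompactSpace L := isCompact_iff_compactSpace.1 hL.isCompact
  obtain ⟨e, he, hxe, hex, hiso⟩ := exists_chart_fderiv_isometric (m := m) hisom x
  have hesym : e.symm 0 = x := by rw [← hex, e.left_inv hxe]
  have h0t : (0 : EuclideanSpace ℝ (Fin n)) ∈ e.target := hex ▸ e.map_source hxe
  let D : G → EuclideanSpace ℝ (Fin n) →L[ℝ] EuclideanSpace ℝ (Fin n) :=
    fun g => fderiv ℝ (fun y => e (g • e.symm y)) 0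
  have hfam : ∀ (θ : L → L), Continuous θ → ∀ l : L, ∀ y ∈ e.target,
      (θ l : G) • e.symm y ∈ e.source →
      IsSmoothFamilyAt (EuclideanSpace ℝ (Fin m)) (fun (l : L) y => e ((θ l : G) • e.symm y))
        (l, y) := fun θ hθ l y hy hly =>
    isSmoothFamilyAt_smul (θ := fun l => (θ l : G)) (continuous_subtype_val.comp hθ) he hy hly
  have hDd : ∀ l : L, HasFDerivAt (fun y => e ((l : G) • e.symm y)) (D l) 0 := fun l =>
    (hfam id continuous_id l 0 h0t (by simp [hesym, hx l l.2, hxe])).differentiableAt.hasFDerivAt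
  have hDmul : ∀ k l : L, D (k * l : L) = D k ∘L D l := by
    intro k l
    have h1 : HasFDerivAt (fun y => e ((k : G) • e.symm y)) (D k) (e ((l : G) • e.symm 0)) := by
      rw [hesym, hx l l.2, hex]; exact hDd k
    have h2 := h1.comp 0 (hDd l)
    refine HasFDerivAt.fderiv (h2.congr_of_eventuallyEq ?_)
    have h3 : ContinuousAt (fun y => (l : G) • e.symm y) 0 :=
      (e.continuousAt_symm h0t).const_smul (l : G)
    have h4 : ∀ᶠ y in 𝓝 0, (l : G) • e.symm y ∈ e.source :=
      h3.eventually (e.open_source.eventually_mem (by simpa [hesym, hx l l.2] using hxe))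
    filter_upwards [h4] with y hy
    simp [e.left_inv hy, mul_smul]
  have hDone : D (1 : L) = ContinuousLinearMap.id ℝ _ := by
    refine HasFDerivAt.fderiv ((hasFDerivAt_id _).congr_of_eventuallyEq ?_)
    filter_upwards [e.open_target.eventually_mem h0t] with y hy
    simp [e.right_inv hy]
  -- the averaged chart
  set U₁ : Set M := {z | ∀ l ∈ L, l • z ∈ e.source} with hU₁
  have hU₁o : IsOpen U₁ := isOpen_forall_smul_mem hL e.open_source
  have hxU₁ : x ∈ U₁ := fun l hl => by rw [hx l hl]; exact hxe
  set U : Set (EuclideanSpace ℝ (Fin n)) := e.target ∩ e.symm ⁻¹' U₁ with hU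
  have hUo : IsOpen U := e.isOpen_inter_preimage_symm hU₁o
  have h0U : (0 : EuclideanSpace ℝ (Fin n)) ∈ U := ⟨h0t, by simpa [hesym] using hxU₁⟩
  let _ : MeasurableSpace L := borel L
  have : BorelSpace L := ⟨rfl⟩
  let μ : Measure L := Measure.haarMeasure ⊤
  have hμ : IsProbabilityMeasure μ := ⟨by
    have := Measure.haarMeasure_self (G := L) (K₀ := ⊤)
    simpa using this⟩
  -- The integrand of the average of `D l ∘ e ∘ l⁻¹` over `L`. Left invariance of Haar measure makes
  -- the average equivariant. Each integrand has derivative `D l ∘ D l⁻¹ = id` at `0`, so the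
  -- average over total mass one is again a local diffeomorphism.
  let h : L → EuclideanSpace ℝ (Fin n) → EuclideanSpace ℝ (Fin n) :=
    fun l y => D l (e (((l⁻¹ : L) : G) • e.symm y))
  have hh : ∀ l, ∀ y ∈ U, IsSmoothFamilyAt (EuclideanSpace ℝ (Fin m) × EuclideanSpace ℝ (Fin m))
      h (l, y) := fun l y hy =>
    (hfam id continuous_id l 0 h0t (by simp [hesym, hx l l.2, hxe])).fderiv.clm_apply
      (hfam _ continuous_inv l y hy.1 (hy.2 _ (l⁻¹ : L).2))
  let f : EuclideanSpace ℝ (Fin n) → EuclideanSpace ℝ (Fin n) := fun y => ∫ l, h l y ∂μ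
  have hfsm : ∀ y ∈ U, ContDiffAt ℝ ∞ f y := by
    intro y hy
    have h1 : ContDiffOn ℝ ∞ f U :=
      contDiffOn_infty.2 fun k => contDiffOn_integral_of_isSmoothFamilyAt μ hUo k hh
    exact h1.contDiffAt (hUo.mem_nhds hy)
  have hf0 : f 0 = 0 := by
    have h1 : ∀ l, h l 0 = 0 := fun l => by
      simp only [h]
      rw [hesym, hx _ (l⁻¹ : L).2, hex, map_zero]
    simp [f, h1]
  have hf' : HasFDerivAt f ((ContinuousLinearEquiv.refl ℝ (EuclideanSpace ℝ (Fin n)) :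
      _ ≃L[ℝ] EuclideanSpace ℝ (Fin n)) :
      EuclideanSpace ℝ (Fin n) →L[ℝ] EuclideanSpace ℝ (Fin n)) 0 := by
    have h1 := hasFDerivAt_integral_of_isSmoothFamilyAt μ hUo hh h0U
    have h2 : ∀ l : L, fderiv ℝ (h l) 0 = ContinuousLinearMap.id ℝ _ := fun l => by
      have h3 := (D l).hasFDerivAt.comp 0 (hDd l⁻¹)
      rw [← hDmul, mul_inv_cancel, hDone] at h3
      exact h3.fderiv
    simp only [h2, integral_const, probReal_univ, one_smul] at h1
    exact h1
  have hequiv : ∀ k : L, ∀ z ∈ U₁, f (e ((k : G) • z)) = D k (f (e z)) := by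
    intro k z hz
    have hze : z ∈ e.source := by simpa using hz 1 L.one_mem
    have hint : Integrable (fun l => h l (e z)) μ := by
      have hez : e z ∈ U := ⟨e.map_source hze, by simpa [e.left_inv hze] using hz⟩
      have : Continuous fun l => h l (e z) := continuous_iff_continuousAt.2 fun l =>
        ContinuousAt.comp (f := fun l => (l, e z))
          (g := fun q : L × EuclideanSpace ℝ (Fin n) => h q.1 q.2)
          (hh l _ hez).continuousAt (Continuous.prodMk_left _).continuousAt
      exact this.integrable_of_hasCompactSupport (HasCompactSupport.of_compactSpace _)
    simp only [f]
    rw [← (D k).integral_comp_comm hint,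
      ← integral_mul_left_eq_self (μ := μ) (fun l => h l (e ((k : G) • z))) k]
    congr 1
    ext1 l
    simp only [h]
    rw [hDmul, e.left_inv (hz k k.2), e.left_inv hze]
    simp [smul_smul]
  obtain ⟨a, h0a, haU, hacoe, hasm, hasymm⟩ := exists_smooth_localInverse
    (Filter.mem_of_superset (hUo.mem_nhds h0U) hfsm) _ hf' (hUo.mem_nhds h0U)
  have ha0 : a 0 = 0 := by rw [hacoe, hf0]
  set U₂ : Set M := {z | ∀ l ∈ L, l • z ∈ (e.trans a).source} with hU₂
  have hU₂o : IsOpen U₂ := isOpen_forall_smul_mem hL (e.trans a).open_source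
  have hxea : x ∈ (e.trans a).source := by
    rw [e.trans_source]; exact ⟨hxe, by simpa [hex] using h0a⟩
  have hxU₂ : x ∈ U₂ := fun l hl => by rw [hx l hl]; exact hxea
  have heax : (e.trans a) x = 0 := by simp [hex, ha0]
  have hV : (e.trans a).target ∩ (e.trans a).symm ⁻¹' U₂ ∈ 𝓝 0 := by
    refine ((e.trans a).isOpen_inter_preimage_symm hU₂o).mem_nhds ⟨?_, ?_⟩
    · rw [← heax]; exact (e.trans a).map_source hxea
    · rw [mem_preimage, ← heax, (e.trans a).left_inv hxea]; exact hxU₂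
  obtain ⟨r, hr, hball⟩ := Metric.mem_nhds_iff.1 hV
  -- Cutting the target down to a ball keeps the chart domain `L`-invariant, since the maps `D l`
  -- preserve the norm.
  let a' := (a.symm.restrOpen (Metric.ball 0 r) Metric.isOpen_ball).symm
  have ha's : ∀ y, y ∈ a'.source ↔ y ∈ a.source ∧ a y ∈ Metric.ball 0 r := fun y => Iff.rfl
  have ha't : ∀ y, y ∈ a'.target ↔ y ∈ a.target ∧ y ∈ Metric.ball 0 r := fun y => Iff.rfl
  have hsrc : ∀ z, z ∈ (e.trans a').source ↔
      z ∈ (e.trans a).source ∧ (e.trans a) z ∈ Metric.ball 0 r := by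
    intro z
    rw [e.trans_source, e.trans_source]
    exact (and_congr_right fun _ => ha's (e z)).trans and_assoc.symm
  have hcoe : ∀ z, (e.trans a') z = f (e z) := fun z => hacoe (e z)
  have hcoe' : ∀ z, (e.trans a) z = f (e z) := fun z => hacoe (e z)
  refine ⟨e.trans a', trans_mem_maximalAtlas_of_contDiffAt he (fun y hy => ?_) (fun y hy => ?_),
    D, r, hr, ?_, ?_, ?_, fun l hl => hiso l (hx l hl), fun l hl z hz => ?_⟩
  · exact (hasm y hy.1).congr_of_eventuallyEq (Eventually.of_forall hacoe)
  · exact hasymm y hy.1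
  · rw [hsrc, heax]; exact ⟨hxea, Metric.mem_ball_self hr⟩
  · rw [hcoe, hex, hf0]
  · rw [e.trans_target]
    ext y
    constructor
    · intro hy; exact ((ha't y).1 hy.1).2
    · intro hy
      have h1 := (hball hy).1
      rw [e.trans_target] at h1
      exact ⟨(ha't y).2 ⟨h1.1, hy⟩, h1.2⟩
  · obtain ⟨h1, h2⟩ := (hsrc z).1 hz
    have h3 := (hball h2).2
    rw [mem_preimage, (e.trans a).left_inv h1] at h3
    have h4 : z ∈ U₁ := fun l hl => by
      have := h3 l hl
      rw [e.trans_source] at this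
      exact this.1
    have h5 : f (e (l • z)) = D l (f (e z)) := hequiv ⟨l, hl⟩ z h4
    refine ⟨(hsrc _).2 ⟨h3 l hl, ?_⟩, by rw [hcoe, hcoe, h5]⟩
    rw [hcoe', mem_ball_zero_iff] at h2 ⊢
    rw [h5, hiso l (hx l hl)]
    exact h2

end Linearization

/-- In a linear action with submanifolds as orbits, vectors with minimal isotropy are dense. -/
theorem exists_principal_vector {G : Type*} [Group G] [TopologicalSpace G] {L : Subgroup G}
    (hL : IsCompact (L : Set G)) {T : Type*} [NormedAddCommGroup T] [InnerProductSpace ℝ T]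
    [FiniteDimensional ℝ T] {A : G → T →L[ℝ] T} (hnorm : ∀ l ∈ L, ∀ v, ‖A l v‖ = ‖v‖)
    (hmul : ∀ k ∈ L, ∀ l ∈ L, ∀ v, A (k * l) v = A k (A l v))
    (hcont : ∀ v, ContinuousOn (fun l => A l v) L) {V : Submodule ℝ T}
    (hV : ∀ l ∈ L, ∀ v ∈ V, A l v ∈ V) {B : Set T} (hB : IsOpen B) (hBV : (B ∩ V).Nonempty)
    (hreg : ∀ v ∈ B ∩ V, ∃ S : Submodule ℝ T,
      (∃ C : ℝ, 0 ≤ C ∧ ∀ᶠ z in 𝓝[(fun l => A l v) '' L] v, ∀ w ∈ Sᗮ,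
        |inner ℝ (z - v) w| ≤ C * ‖w‖ * ‖z - v‖ ^ 2) ∧
      ∀ w, (∀ l ∈ L, ‖w - v‖ ≤ ‖w - A l v‖) → w - v ∈ Sᗮ) :
    ∃ v ∈ B ∩ V, ∀ u ∈ V, ∃ l ∈ L, ∀ h ∈ L, A h v = v → A h (A l u) = A l u := by
  -- `Fix v` consists of the vectors of `V` fixed by the isotropy group of `v`. A vector with `Fix
  -- v` of maximal dimension has smallest isotropy: normal vectors at `v` will turn out to lie in
  -- `Fix v`.
  let Fix : T → Submodule ℝ T := fun v =>
    { carrier := {w | w ∈ V ∧ ∀ h ∈ L, A h v = v → A h w = w}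
      add_mem' := fun {a b} ha hb => ⟨V.add_mem ha.1 hb.1, fun h hh hv => by
        rw [map_add, ha.2 h hh hv, hb.2 h hh hv]⟩
      zero_mem' := ⟨V.zero_mem, fun h _ _ => map_zero _⟩
      smul_mem' := fun c a ha => ⟨V.smul_mem c ha.1, fun h hh hv => by
        rw [map_smul, ha.2 h hh hv]⟩ }
  obtain ⟨v, ⟨hvB, hvV⟩, hmax⟩ : ∃ v ∈ B ∩ V, ∀ w ∈ B ∩ V,
      finrank ℝ (Fix w) ≤ finrank ℝ (Fix v) := by
    have hfin : ((fun v => finrank ℝ (Fix v)) '' (B ∩ V)).Finite :=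
      (finite_Iic (finrank ℝ T)).subset (by
        rintro _ ⟨v, -, rfl⟩
        exact Submodule.finrank_le _)
    obtain ⟨k, ⟨v, hv, rfl⟩, hk⟩ := exists_max_image _ id hfin (hBV.image _)
    exact ⟨v, hv, fun w hw => hk _ ⟨w, hw, rfl⟩⟩
  refine ⟨v, ⟨hvB, hvV⟩, fun u hu => ?_⟩
  obtain ⟨S, ⟨C, hC, htan⟩, hnear⟩ := hreg v ⟨hvB, hvV⟩
  -- the isotropy group of `v` fixes the normal vectors
  have hfix : ∀ w ∈ Sᗮ, w ∈ V → ∀ h ∈ L, A h v = v → A h w = w := by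
    intro w hwS hwV
    obtain ⟨η, hη, hball⟩ := Metric.mem_nhdsWithin_iff.1 htan
    have hsmall : ∀ᶠ t in 𝓝[>] (0 : ℝ), v + t • w ∈ B ∧ 2 * ‖t • w‖ < η ∧
        2 * C * ‖t • w‖ < 1 := by
      have h1 : Tendsto (fun t : ℝ => v + t • w) (𝓝 0) (𝓝 v) := by
        have : Continuous (fun t : ℝ => v + t • w) := by fun_prop
        simpa using this.tendsto 0
      have h2 : Tendsto (fun t : ℝ => 2 * ‖t • w‖) (𝓝 0) (𝓝 0) := by
        have : Continuous (fun t : ℝ => 2 * ‖t • w‖) := by fun_prop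
        simpa using this.tendsto 0
      have h3 : Tendsto (fun t : ℝ => 2 * C * ‖t • w‖) (𝓝 0) (𝓝 0) := by
        have : Continuous (fun t : ℝ => 2 * C * ‖t • w‖) := by fun_prop
        simpa using this.tendsto 0
      exact ((h1.eventually (hB.eventually_mem hvB)).and ((h2.eventually (gt_mem_nhds hη)).and
        (h3.eventually (gt_mem_nhds one_pos)))).filter_mono nhdsWithin_le_nhds
    obtain ⟨t, ⟨htB, ht1, ht2⟩, ht0⟩ := (hsmall.and self_mem_nhdsWithin).exists
    replace ht0 : 0 < t := ht0
    set w' := t • w with hw'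
    have hw'S : w' ∈ Sᗮ := Sᗮ.smul_mem t hwS
    -- A small normal displacement does not enlarge the isotropy group. If `h` fixes `v + w'` and `z
    -- = A h v`, then `‖z - v‖ ^ 2 = 2 ⟪z - v, w'⟫`. The tangency estimate bounds this by `2 * C *
    -- ‖w'‖ * ‖z - v‖ ^ 2`, and `2 * C * ‖w'‖ < 1` forces `z = v`.
    have hsub : ∀ h ∈ L, A h (v + w') = v + w' → A h v = v := by
      intro h hh hhv
      set z := A h v with hz
      have e1 : ‖(z - v) - w'‖ = ‖w'‖ := by
        have : (z - v) - w' = A h (-w') := by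
          rw [map_add] at hhv
          rw [map_neg, hz, sub_sub, ← hhv]; abel
        rw [this, hnorm h hh, norm_neg]
      have e2 : ‖z - v‖ ^ 2 = 2 * inner ℝ (z - v) w' := by
        have := norm_sub_sq_real (z - v) w'
        rw [e1] at this
        linarith
      have e3 : ‖z - v‖ ≤ 2 * ‖w'‖ := by
        have := norm_add_le ((z - v) - w') w'
        rw [e1, sub_add_cancel] at this
        linarith
      have e4 : z ∈ Metric.ball v η ∩ (fun l => A l v) '' L :=
        ⟨by rw [mem_ball_iff_norm]; linarith, ⟨h, hh, rfl⟩⟩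
      have e5 := (le_abs_self _).trans (hball e4 w' hw'S)
      have e6 : ‖z - v‖ ^ 2 ≤ 2 * C * ‖w'‖ * ‖z - v‖ ^ 2 := by linarith
      have e7 : ‖z - v‖ ^ 2 ≤ 0 := by
        by_contra hcon
        push Not at hcon
        have := mul_lt_mul_of_pos_right ht2 hcon
        linarith
      have e8 : ‖z - v‖ = 0 := by
        have := sq_nonneg ‖z - v‖
        exact pow_eq_zero_iff (two_ne_zero) |>.1 (le_antisymm e7 this)
      exact sub_eq_zero.1 (norm_eq_zero.1 e8)
    have hvw : v + w' ∈ B ∩ V := ⟨htB, V.add_mem hvV (V.smul_mem t hwV)⟩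
    have hle : Fix v ≤ Fix (v + w') := fun a ha => ⟨ha.1, fun h hh hv => ha.2 h hh (hsub h hh hv)⟩
    -- Maximality gives `Fix v = Fix (v + w')`, which contains `v + w'`. So the isotropy group of
    -- `v` fixes `w'`, and hence `w`.
    have heq := Submodule.eq_of_le_of_finrank_le hle (hmax _ hvw)
    have hmem : v + w' ∈ Fix v := heq ▸ (⟨hvw.2, fun h _ hv => hv⟩ : v + w' ∈ Fix (v + w'))
    intro h hh hv
    have h1 := hmem.2 h hh hv
    rw [map_add, hv, add_right_inj, hw', map_smul] at h1
    exact smul_right_injective T ht0.ne' h1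
  -- the point of the orbit of `u` closest to `v`
  obtain ⟨l, hl, hlmin⟩ := hL.exists_isMinOn ⟨1, L.one_mem⟩
    (f := fun l => ‖A l u - v‖) ((hcont u).sub continuousOn_const).norm
  refine ⟨l, hl, fun h hh hhv => ?_⟩
  -- By isometry `v` is also the point of its own orbit closest to `A l u`. Hence `A l u - v` is
  -- normal and is fixed by the isotropy group of `v`.
  have hclose : ∀ k ∈ L, ‖A l u - v‖ ≤ ‖A l u - A k v‖ := by
    intro k hk
    have h1 : ‖A l u - v‖ ≤ ‖A (k⁻¹ * l) u - v‖ := hlmin (L.mul_mem (L.inv_mem hk) hl)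
    have h2 : ‖A k (A (k⁻¹ * l) u - v)‖ = ‖A (k⁻¹ * l) u - v‖ := hnorm k hk _
    rw [map_sub, ← hmul k hk _ (L.mul_mem (L.inv_mem hk) hl), mul_inv_cancel_left] at h2
    rw [h2]; exact h1
  have h3 := hfix _ (hnear _ hclose) (V.sub_mem (hV l hl u hu) hvV) h hh hhv
  rw [map_sub, hhv] at h3
  exact sub_left_injective h3

/-! ### Orthogonal actions in linear charts. -/

section LinearChart

variable {m n : ℕ} {G M : Type*} [Group G]
  [TopologicalSpace M] [ChartedSpace (EuclideanSpace ℝ (Fin n)) M] [MulAction G M]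

/-- `e` is a chart centered at `x`, in which `L` acts by the linear isometries `A l`. -/
structure IsLinearChart (L : Subgroup G) (x : M)
    (e : OpenPartialHomeomorph M (EuclideanSpace ℝ (Fin n)))
    (A : G → EuclideanSpace ℝ (Fin n) →L[ℝ] EuclideanSpace ℝ (Fin n)) (r : ℝ) : Prop where
  mem_atlas : e ∈ IsManifold.maximalAtlas (𝓡 n) ∞ M
  pos : 0 < r
  mem_source : x ∈ e.source
  map_self : e x = 0
  target_eq : e.target = Metric.ball 0 r
  norm_map : ∀ l ∈ L, ∀ v, ‖A l v‖ = ‖v‖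
  smul_mem : ∀ l ∈ L, ∀ y ∈ e.source, l • y ∈ e.source
  map_smul : ∀ l ∈ L, ∀ y ∈ e.source, e (l • y) = A l (e y)

namespace IsLinearChart

variable {L : Subgroup G} {x : M} {e : OpenPartialHomeomorph M (EuclideanSpace ℝ (Fin n))}
  {A : G → EuclideanSpace ℝ (Fin n) →L[ℝ] EuclideanSpace ℝ (Fin n)} {r : ℝ}

theorem mem_target (h : IsLinearChart L x e A r) {v : EuclideanSpace ℝ (Fin n)} :
    v ∈ e.target ↔ ‖v‖ < r := by
  rw [h.target_eq, mem_ball_zero_iff]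

theorem symm_zero (h : IsLinearChart L x e A r) : e.symm 0 = x := by
  rw [← h.map_self, e.left_inv h.mem_source]

theorem smul_symm (h : IsLinearChart L x e A r) {l : G} (hl : l ∈ L)
    {v : EuclideanSpace ℝ (Fin n)} (hv : ‖v‖ < r) : l • e.symm v = e.symm (A l v) := by
  have hv' := h.mem_target.2 hv
  have h1 := h.map_smul l hl _ (e.map_target hv')
  rw [e.right_inv hv'] at h1
  rw [← h1, e.left_inv (h.smul_mem l hl _ (e.map_target hv'))]

theorem smul_self (h : IsLinearChart L x e A r) {l : G} (hl : l ∈ L) : l • x = x := by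
  have := h.smul_symm hl (v := 0) (by simpa using h.pos)
  simpa [h.symm_zero] using this

/-- The chart sees only vectors of norm less than `r`; linearity extends identities between the
operators to all vectors by scaling. -/
theorem eq_of_norm_lt (h : IsLinearChart L x e A r)
    {B B' : EuclideanSpace ℝ (Fin n) →L[ℝ] EuclideanSpace ℝ (Fin n)}
    (hB : ∀ v, ‖v‖ < r → B v = B' v) : B = B' := by
  ext1 v
  have h1 : ∀ᶠ t in 𝓝[>] (0 : ℝ), ‖t • v‖ < r := by
    have h2 : Tendsto (fun t : ℝ => ‖t • v‖) (𝓝 0) (𝓝 0) := by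
      have : Continuous (fun t : ℝ => ‖t • v‖) := by fun_prop
      simpa using this.tendsto 0
    exact (h2.eventually (gt_mem_nhds h.pos)).filter_mono nhdsWithin_le_nhds
  obtain ⟨t, ht, ht0⟩ := (h1.and self_mem_nhdsWithin).exists
  replace ht0 : 0 < t := ht0
  have h3 := hB _ ht
  rw [_root_.map_smul, _root_.map_smul] at h3
  exact smul_right_injective _ ht0.ne' h3

theorem map_mul (h : IsLinearChart L x e A r) {k l : G} (hk : k ∈ L) (hl : l ∈ L) :
    A (k * l) = A k ∘L A l := by
  refine h.eq_of_norm_lt fun v hv => ?_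
  have hlv : ‖A l v‖ < r := by rwa [h.norm_map l hl]
  have hkv : ‖A k (A l v)‖ < r := by rwa [h.norm_map k hk]
  have hklv : ‖A (k * l) v‖ < r := by rwa [h.norm_map _ (L.mul_mem hk hl)]
  have h1 := h.smul_symm (L.mul_mem hk hl) hv
  rw [mul_smul, h.smul_symm hl hv, h.smul_symm hk hlv] at h1
  exact e.symm.injOn (h.mem_target.2 hklv) (h.mem_target.2 hkv) h1.symm

theorem map_one (h : IsLinearChart L x e A r) : A 1 = ContinuousLinearMap.id ℝ _ := by
  refine h.eq_of_norm_lt fun v hv => ?_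
  have h1 := h.smul_symm L.one_mem hv
  rw [one_smul] at h1
  have h2 : ‖A 1 v‖ < r := by rwa [h.norm_map _ L.one_mem]
  exact (e.symm.injOn (h.mem_target.2 hv) (h.mem_target.2 h2) h1).symm

theorem map_apply_inv (h : IsLinearChart L x e A r) {l : G} (hl : l ∈ L)
    (v : EuclideanSpace ℝ (Fin n)) : A l (A l⁻¹ v) = v := by
  have := DFunLike.congr_fun (h.map_mul hl (L.inv_mem hl)) v
  rw [mul_inv_cancel, h.map_one] at this
  exact this.symm

theorem inner_map_map (h : IsLinearChart L x e A r) {l : G} (hl : l ∈ L)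
    (v w : EuclideanSpace ℝ (Fin n)) : inner ℝ (A l v) (A l w) = inner ℝ v w :=
  LinearIsometry.inner_map_map
    (⟨(A l : EuclideanSpace ℝ (Fin n) →ₗ[ℝ] EuclideanSpace ℝ (Fin n)), h.norm_map l hl⟩ :
      EuclideanSpace ℝ (Fin n) →ₗᵢ[ℝ] EuclideanSpace ℝ (Fin n)) v w

theorem map_orthogonal (h : IsLinearChart L x e A r)
    {R : Submodule ℝ (EuclideanSpace ℝ (Fin n))} (hR : ∀ l ∈ L, ∀ v ∈ R, A l v ∈ R) {l : G}
    (hl : l ∈ L) {v : EuclideanSpace ℝ (Fin n)} (hv : v ∈ Rᗮ) : A l v ∈ Rᗮ := by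
  rw [Submodule.mem_orthogonal] at hv ⊢
  intro u hu
  rw [← h.map_apply_inv hl u, h.inner_map_map hl]
  exact hv _ (hR _ (L.inv_mem hl) u hu)

theorem continuousOn [TopologicalSpace G] [ContinuousSMul G M] (h : IsLinearChart L x e A r)
    (v : EuclideanSpace ℝ (Fin n)) : ContinuousOn (fun l => A l v) L := by
  have h1 : ∀ᶠ t in 𝓝[>] (0 : ℝ), ‖t • v‖ < r := by
    have h2 : Tendsto (fun t : ℝ => ‖t • v‖) (𝓝 0) (𝓝 0) := by
      have : Continuous (fun t : ℝ => ‖t • v‖) := by fun_prop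
      simpa using this.tendsto 0
    exact (h2.eventually (gt_mem_nhds h.pos)).filter_mono nhdsWithin_le_nhds
  obtain ⟨t, ht, ht0⟩ := (h1.and self_mem_nhdsWithin).exists
  replace ht0 : 0 < t := ht0
  have ht' := h.mem_target.2 ht
  have h2 : ContinuousOn (fun l : G => e (l • e.symm (t • v))) L := by
    refine e.continuousOn.comp (continuous_id.smul continuous_const).continuousOn ?_
    exact fun l hl => h.smul_mem l hl _ (e.map_target ht')
  refine (h2.const_smul t⁻¹).congr fun l hl => ?_
  change A l v = t⁻¹ • e (l • e.symm (t • v))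
  rw [h.map_smul l hl _ (e.map_target ht'), e.right_inv ht', _root_.map_smul,
    inv_smul_smul₀ ht0.ne']

end IsLinearChart

theorem exists_isLinearChart [TopologicalSpace G] [ChartedSpace (EuclideanSpace ℝ (Fin m)) G]
    [LieGroup (𝓡 m) ∞ G] [T2Space G] [CompactSpace G] [IsManifold (𝓡 n) ∞ M]
    [Bundle.RiemannianBundle (fun x : M => TangentSpace (𝓡 n) x)]
    [ContMDiffSMul (𝓡 m) (𝓡 n) ∞ G M] (hisom : IsIsometricAction n G M)
    {L : Subgroup G} (hL : IsClosed (L : Set G)) {x : M} (hx : ∀ l ∈ L, l • x = x) :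
    ∃ e A r, IsLinearChart (n := n) L x e A r := by
  obtain ⟨e, he, A, r, hr, h1, h2, h3, h4, h5⟩ := exists_linear_chart (m := m) hisom hL hx
  exact ⟨e, A, r, he, hr, h1, h2, h3, h4, fun l hl y hy => (h5 l hl y hy).1,
    fun l hl y hy => (h5 l hl y hy).2⟩

variable [TopologicalSpace G] [ChartedSpace (EuclideanSpace ℝ (Fin m)) G]
  [IsTopologicalGroup G] [CompactSpace G] [T2Space M] [ContinuousSMul G M]
  [ContMDiffSMul (𝓡 m) (𝓡 n) ∞ G M]
  {L : Subgroup G} {x : M} {e : OpenPartialHomeomorph M (EuclideanSpace ℝ (Fin n))}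
  {A : G → EuclideanSpace ℝ (Fin n) →L[ℝ] EuclideanSpace ℝ (Fin n)} {r : ℝ}
  {E : Type*} [NormedAddCommGroup E] [InnerProductSpace ℝ E] [FiniteDimensional ℝ E] {φ : E → G}

/-- This supplies the regularity hypothesis of `exists_principal_vector`, with `S` the tangent space
of the orbit. The second property is the first variation of the distance to `w` along the orbit. -/
theorem IsLinearChart.orbit_tangency (h : IsLinearChart L x e A r) (hφ : IsLocalParam m L φ)
    (hL : IsClosed (L : Set G)) {v : EuclideanSpace ℝ (Fin n)} (hv : ‖v‖ < r) :
    ∃ S : Submodule ℝ (EuclideanSpace ℝ (Fin n)),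
      (∃ C : ℝ, 0 ≤ C ∧ ∀ᶠ z in 𝓝[(fun l => A l v) '' L] v, ∀ w ∈ Sᗮ,
        |inner ℝ (z - v) w| ≤ C * ‖w‖ * ‖z - v‖ ^ 2) ∧
      ∀ w, (∀ l ∈ L, ‖w - v‖ ≤ ‖w - A l v‖) → w - v ∈ Sᗮ := by
  have hvt := h.mem_target.2 hv
  have hy := e.map_target hvt
  obtain ⟨C, hC, htan⟩ := hφ.orbit_tangency hL h.mem_atlas hy
  refine ⟨LinearMap.range (fderiv ℝ (fun u => e (φ u • e.symm v)) 0 :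
    E →ₗ[ℝ] EuclideanSpace ℝ (Fin n)), ⟨C, hC, ?_⟩, fun w hw => ?_⟩
  · have h1 : Tendsto e.symm (𝓝[(fun l => A l v) '' L] v)
        (𝓝[MulAction.orbit L (e.symm v)] (e.symm v)) := by
      rw [tendsto_nhdsWithin_iff]
      refine ⟨(e.continuousAt_symm hvt).mono_left nhdsWithin_le_nhds,
        eventually_nhdsWithin_of_forall ?_⟩
      rintro _ ⟨l, hl, rfl⟩
      exact ⟨⟨l, hl⟩, h.smul_symm hl hv⟩
    filter_upwards [h1.eventually htan, self_mem_nhdsWithin] with z hz hz2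
    obtain ⟨l, hl, rfl⟩ := hz2
    have h2 : A l v ∈ e.target := h.mem_target.2 (by rwa [h.norm_map l hl])
    simpa only [e.right_inv h2, e.right_inv hvt] using hz
  · rw [Submodule.mem_orthogonal]
    rintro _ ⟨u, rfl⟩
    set f : E → EuclideanSpace ℝ (Fin n) := fun u => e (φ u • e.symm v) with hf
    have hf0 : f 0 = v := by simp [hf, hφ.map_zero, e.right_inv hvt]
    have hd : HasDerivAt (fun t : ℝ => f (t • u)) (fderiv ℝ f 0 u) 0 := by
      have h1 : HasDerivAt (fun t : ℝ => t • u) u 0 := by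
        simpa using (hasDerivAt_id (0 : ℝ)).smul_const u
      have h2 : HasFDerivAt f (fderiv ℝ f 0) ((0 : ℝ) • u) := by
        rw [zero_smul]
        exact ((hφ.smooth_smul h.mem_atlas hy).self_of_nhds.differentiableAt
          (by simp)).hasFDerivAt
      exact h2.comp_hasDerivAt (0 : ℝ) h1
    have hmin : IsLocalMin (fun t : ℝ => ‖w - f (t • u)‖ ^ 2) 0 := by
      have h1 : Tendsto (fun t : ℝ => t • u) (𝓝 0) (𝓝 0) := by
        have : Continuous (fun t : ℝ => t • u) := by fun_prop
        simpa using this.tendsto 0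
      filter_upwards [h1.eventually hφ.mem] with t ht
      have h2 : f (t • u) = A (φ (t • u)) v := by
        rw [hf]
        simp only
        rw [h.map_smul _ ht _ hy, e.right_inv hvt]
      rw [zero_smul, hf0, h2]
      gcongr
      exact hw _ ht
    have h3 := hmin.hasDerivAt_eq_zero ((hd.const_sub w).norm_sq)
    rw [zero_smul, hf0, inner_neg_right] at h3
    change inner ℝ (fderiv ℝ f 0 u) (w - v) = 0
    rw [real_inner_comm]
    linarith

end LinearChart

/-! ### Slices and tubular neighbourhoods of orbits. -/

section Slice

variable {m n : ℕ} {G M : Type*} [Group G]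
  [TopologicalSpace M] [ChartedSpace (EuclideanSpace ℝ (Fin n)) M] [MulAction G M]

/-- A slice for the action of `Γ` at `x`: `R` is the tangent space of the orbit in a linear chart
`e`, the slice is the image of `Rᗮ`, `σ` is a local section of `Γ → Γ • x`, and `a` describes the
resulting tubular neighbourhood of the orbit. -/
structure IsSlice (Γ : Subgroup G) (x : M)
    (e : OpenPartialHomeomorph M (EuclideanSpace ℝ (Fin n)))
    (A : G → EuclideanSpace ℝ (Fin n) →L[ℝ] EuclideanSpace ℝ (Fin n)) (r : ℝ)
    (R : Submodule ℝ (EuclideanSpace ℝ (Fin n))) (σ : EuclideanSpace ℝ (Fin n) → G)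
    (a : OpenPartialHomeomorph (EuclideanSpace ℝ (Fin n)) (EuclideanSpace ℝ (Fin n)))
    (ε : ℝ) : Prop where
  chart : IsLinearChart (Γ ⊓ MulAction.stabilizer G x) x e A r
  map_mem : ∀ l ∈ Γ ⊓ MulAction.stabilizer G x, ∀ v ∈ R, A l v ∈ R
  pos : 0 < ε
  le : ε ≤ r
  ball_subset : Metric.ball 0 ε ⊆ a.source
  map_zero : a 0 = 0
  smooth : ∀ y ∈ a.source, ContDiffAt ℝ ∞ a y
  smooth_symm : ∀ y ∈ a.target, ContDiffAt ℝ ∞ a.symm y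
  sec_zero : σ 0 = 1
  sec_mem : ∀ y ∈ Metric.ball 0 ε, σ y ∈ Γ
  sec_add : ∀ y, ∀ v ∈ Rᗮ, σ (y + v) = σ y
  smul_mem : ∀ y ∈ Metric.ball 0 ε, σ y • e.symm (Rᗮ.starProjection y) ∈ e.source
  apply_eq : ∀ y ∈ Metric.ball 0 ε, a y = e (σ y • e.symm (Rᗮ.starProjection y))
  factor : ∃ O ∈ 𝓝 x, ∀ g ∈ Γ, g • x ∈ O → ∃ ρ ∈ R, ‖ρ‖ < ε / 2 ∧
    (σ ρ)⁻¹ * g ∈ Γ ⊓ MulAction.stabilizer G x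

/-- The section is `σ = φ ∘ κ`, with `κ` the partial inverse of the orbit derivative. The map
sending `y` to `σ y` applied to its slice component has derivative the identity, hence is a local
diffeomorphism `a`. -/
theorem exists_isSlice [TopologicalSpace G] [ChartedSpace (EuclideanSpace ℝ (Fin m)) G]
    [IsTopologicalGroup G] [CompactSpace G] [T2Space M] [ContinuousSMul G M]
    [ContMDiffSMul (𝓡 m) (𝓡 n) ∞ G M]
    {E : Type*} [NormedAddCommGroup E] [InnerProductSpace ℝ E] [FiniteDimensional ℝ E] {φ : E → G}
    {Γ : Subgroup G} {x : M} {e : OpenPartialHomeomorph M (EuclideanSpace ℝ (Fin n))}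
    {A : G → EuclideanSpace ℝ (Fin n) →L[ℝ] EuclideanSpace ℝ (Fin n)} {r : ℝ}
    (hΓ : IsClosed (Γ : Set G))
    (hφ : IsLocalParam m Γ φ) (h : IsLinearChart (Γ ⊓ MulAction.stabilizer G x) x e A r)
    {R : Submodule ℝ (EuclideanSpace ℝ (Fin n))} (hR : R = LinearMap.range
      (fderiv ℝ (fun u => e (φ u • x)) 0 : E →ₗ[ℝ] EuclideanSpace ℝ (Fin n))) :
    ∃ σ a ε, IsSlice Γ x e A r R σ a ε := by
  set f : E → EuclideanSpace ℝ (Fin n) := fun u => e (φ u • x) with hf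
  set D := fderiv ℝ f 0 with hD
  have hf0 : f 0 = 0 := by simp [hf, hφ.map_zero, h.map_self]
  have hfd : HasFDerivAt f D 0 :=
    ((hφ.smooth_smul h.mem_atlas h.mem_source).self_of_nhds.differentiableAt (by simp)).hasFDerivAt
  set L := Γ ⊓ MulAction.stabilizer G x with hL
  -- invariance of the tangent space
  have hmap : ∀ l ∈ L, ∀ v ∈ R, A l v ∈ R := by
    intro l hl v hv
    rw [← R.orthogonal_orthogonal, Submodule.mem_orthogonal]
    intro w hw
    rw [hR] at hv
    obtain ⟨u, rfl⟩ := hv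
    obtain ⟨C, hC, htan⟩ := hφ.orbit_tangency hΓ h.mem_atlas h.mem_source
    have h1 : Tendsto (fun t : ℝ => t • u) (𝓝 0) (𝓝 0) := by
      have : Continuous (fun t : ℝ => t • u) := by fun_prop
      simpa using this.tendsto 0
    have hd : HasDerivAt (fun t : ℝ => f (t • u)) (D u) 0 := by
      have h1 : HasDerivAt (fun t : ℝ => t • u) u 0 := by
        simpa using (hasDerivAt_id (0 : ℝ)).smul_const u
      have h2 : HasFDerivAt f D ((0 : ℝ) • u) := by rw [zero_smul]; exact hfd
      exact h2.comp_hasDerivAt (0 : ℝ) h1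
    have hd2 : HasDerivAt (fun t : ℝ => inner ℝ (A l (f (t • u))) w) (inner ℝ (A l (D u)) w) 0 := by
      have h3 := ((A l).hasFDerivAt.comp_hasDerivAt (0 : ℝ) hd).inner ℝ
        (hasDerivAt_const (0 : ℝ) w)
      simpa using h3
    have hbound : ∀ᶠ t in 𝓝 (0 : ℝ),
        ‖inner ℝ (A l (f (t • u))) w‖ ≤ C * ‖w‖ * ‖‖f (t • u)‖ ^ 2‖ := by
      have h2 : ContinuousAt (fun u => φ u • x) 0 :=
        (hφ.smooth.self_of_nhds.continuousAt).smul continuousAt_const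
      have h3 : Tendsto (fun t : ℝ => l • φ (t • u) • x) (𝓝 0) (𝓝 x) := by
        have := (h2.tendsto.comp h1).const_smul l
        simpa [hφ.map_zero, h.smul_self hl] using this
      have h4 : Tendsto (fun t : ℝ => l • φ (t • u) • x) (𝓝 0) (𝓝[MulAction.orbit Γ x] x) := by
        refine tendsto_nhdsWithin_iff.2 ⟨h3, ?_⟩
        filter_upwards [h1.eventually hφ.mem] with t ht
        exact ⟨⟨l * φ (t • u), Γ.mul_mem hl.1 ht⟩, mul_smul _ _ _⟩
      have h5 : Tendsto (fun t : ℝ => φ (t • u) • x) (𝓝 0) (𝓝 x) := by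
        have := h2.tendsto.comp h1
        rwa [hφ.map_zero, one_smul] at this
      filter_upwards [h4.eventually htan, h5.eventually (e.open_source.eventually_mem h.mem_source)]
        with t ht ht2
      have h6 := ht w (hR ▸ hw)
      rw [h.map_smul l hl _ ht2, h.map_self, sub_zero, h.norm_map l hl] at h6
      simpa using h6
    have hlo : (fun t : ℝ => inner ℝ (A l (f (t • u))) w) =o[𝓝 0] fun t : ℝ => t := by
      have h2 : (fun t : ℝ => f (t • u)) =O[𝓝 0] fun t : ℝ => t := by
        have := hd.hasFDerivAt.isBigO_sub
        simpa [hf0] using this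
      have h3 : (fun t : ℝ => ‖f (t • u)‖ ^ 2) =O[𝓝 0] fun t : ℝ => t ^ 2 := h2.norm_left.pow 2
      have h4 : (fun t : ℝ => t ^ 2) =o[𝓝 0] fun t : ℝ => t := by
        simpa using Asymptotics.isLittleO_pow_pow (𝕜 := ℝ) (m := 1) (n := 2) (by norm_num)
      exact ((Asymptotics.IsBigO.of_bound _ hbound).trans h3).trans_isLittleO h4
    have hd3 : HasDerivAt (fun t : ℝ => inner ℝ (A l (f (t • u))) w) 0 0 := by
      rw [hasDerivAt_iff_isLittleO]
      simpa [hf0] using hlo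
    have := hd2.unique hd3
    rw [real_inner_comm]
    exact this
  obtain ⟨κ, hκN, hκR, hκ0, hκc⟩ := exists_partial_inverse D
    (N := LinearMap.ker (D : E →ₗ[ℝ] EuclideanSpace ℝ (Fin n))) rfl hR
  obtain ⟨hrk, -⟩ := constant_rank (hφ.smooth_smul h.mem_atlas h.mem_source)
    (hφ.rank_le h.mem_atlas h.mem_source) rfl
  set P := Rᗮ.starProjection with hP
  have h0t : (0 : EuclideanSpace ℝ (Fin n)) ∈ e.target := h.mem_target.2 (by simpa using h.pos)
  -- the map `Θ` of the normal bundle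
  let Ξ : E × EuclideanSpace ℝ (Fin n) → EuclideanSpace ℝ (Fin n) :=
    fun q => e (φ q.1 • e.symm q.2)
  have hev : ∀ᶠ q in 𝓝 ((0 : E), (0 : EuclideanSpace ℝ (Fin n))),
      ContMDiffAt 𝓘(ℝ, E × EuclideanSpace ℝ (Fin n)) (𝓡 n) ∞
        (fun q : E × EuclideanSpace ℝ (Fin n) => φ q.1 • e.symm q.2) q := by
    filter_upwards [continuousAt_fst.eventually hφ.smooth,
      continuousAt_snd.eventually (e.open_target.eventually_mem h0t)] with q hq1 hq2
    exact (hq1.comp q contDiffAt_fst.contMDiffAt).smul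
      ((contMDiffAt_symm_of_mem_maximalAtlas h.mem_atlas hq2).comp q contDiffAt_snd.contMDiffAt)
  have hsrc : ∀ᶠ q in 𝓝 ((0 : E), (0 : EuclideanSpace ℝ (Fin n))),
      φ q.1 • e.symm q.2 ∈ e.source := by
    refine hev.self_of_nhds.continuousAt.eventually (e.open_source.eventually_mem ?_)
    simpa [hφ.map_zero, h.symm_zero] using h.mem_source
  have hΞ : ∀ᶠ q in 𝓝 ((0 : E), (0 : EuclideanSpace ℝ (Fin n))), ContDiffAt ℝ ∞ Ξ q := by
    filter_upwards [hev, hsrc] with q hq1 hq2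
    rw [← contMDiffAt_iff_contDiffAt]
    exact (contMDiffAt_of_mem_maximalAtlas h.mem_atlas hq2).comp q hq1
  have hΞd := (hΞ.self_of_nhds.differentiableAt (by simp)).hasFDerivAt
  set Ξ' := fderiv ℝ Ξ (0, 0)
  have hΞ1 : ∀ u, Ξ' (u, 0) = D u := by
    have h1 := hΞd.comp (0 : E) (hasFDerivAt_prodMk_left (𝕜 := ℝ) (0 : E)
      (0 : EuclideanSpace ℝ (Fin n)))
    have h2 : Ξ ∘ (fun u => (u, 0)) = f := by
      funext u; simp [Ξ, hf, h.symm_zero]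
    rw [h2] at h1
    intro u
    exact (DFunLike.congr_fun (h1.unique hfd) u)
  have hΞ2 : ∀ v, Ξ' (0, v) = v := by
    have h1 := hΞd.comp (0 : EuclideanSpace ℝ (Fin n)) (hasFDerivAt_prodMk_right (𝕜 := ℝ) (0 : E)
      (0 : EuclideanSpace ℝ (Fin n)))
    have h2 : HasFDerivAt (Ξ ∘ fun v => ((0 : E), v))
        (ContinuousLinearMap.id ℝ (EuclideanSpace ℝ (Fin n))) 0 := by
      refine (hasFDerivAt_id _).congr_of_eventuallyEq ?_
      filter_upwards [e.open_target.eventually_mem h0t] with v hv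
      simp [Ξ, hφ.map_zero, e.right_inv hv]
    intro v
    exact DFunLike.congr_fun (h1.unique h2) v
  have hlin : Tendsto (fun y => (κ y, P y)) (𝓝 0) (𝓝 (0, 0)) := by
    have : Continuous (fun y => (κ y, P y)) := by fun_prop
    simpa using this.tendsto 0
  have hΘd : HasFDerivAt (fun y => Ξ (κ y, P y))
      ((ContinuousLinearEquiv.refl ℝ (EuclideanSpace ℝ (Fin n)) :
      _ ≃L[ℝ] EuclideanSpace ℝ (Fin n)) :
      EuclideanSpace ℝ (Fin n) →L[ℝ] EuclideanSpace ℝ (Fin n)) 0 := by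
    have h1 : HasFDerivAt Ξ Ξ' (κ 0, P 0) := by simpa using hΞd
    have h2 := h1.comp 0 ((κ.prod P).hasFDerivAt (x := 0))
    convert! h2 using 1
    ext1 y
    have h3 : (κ y, P y) = (κ y, 0) + (0, P y) := by simp
    have h4 : D (κ y) = R.starProjection y := by
      have h5 := hκ0 _ (R.sub_starProjection_mem_orthogonal y)
      rw [map_sub, sub_eq_zero] at h5
      rw [h5, hκR _ (Submodule.starProjection_apply_mem _ _)]
    change y = Ξ' (κ y, P y)
    rw [h3, map_add, hΞ1, hΞ2, h4, hP, Submodule.starProjection_orthogonal_val]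
    abel
  have hΘs : ∀ᶠ y in 𝓝 0, ContDiffAt ℝ ∞ (fun y => Ξ (κ y, P y)) y := by
    filter_upwards [hlin.eventually hΞ] with y hy
    exact ContDiffAt.comp (g := Ξ) (f := fun y => (κ y, P y)) y hy (κ.prod P).contDiff.contDiffAt
  obtain ⟨a, h0a, haS, hacoe, hasm, hasymm⟩ := exists_smooth_localInverse hΘs _ hΘd
    (inter_mem (hlin.eventually hsrc)
      ((continuous_fst.tendsto _).comp hlin |>.eventually hφ.mem))
  obtain ⟨ε₀, hε₀, hball⟩ := Metric.mem_nhds_iff.1 (a.open_source.mem_nhds h0a)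
  set ε := min ε₀ r with hε
  have hεpos : 0 < ε := lt_min hε₀ h.pos
  have hball' : Metric.ball 0 ε ⊆ a.source :=
    (Metric.ball_subset_ball (min_le_left _ _)).trans hball
  refine ⟨fun y => φ (κ y), a, ε, h, hmap, hεpos, min_le_right _ _, hball', ?_,
    fun y hy => (hasm y hy).congr_of_eventuallyEq (Eventually.of_forall hacoe), hasymm,
    by simp [hφ.map_zero], fun y hy => (haS (hball' hy)).2, fun y v hv => by simp [hκ0 v hv],
    fun y hy => (haS (hball' hy)).1, fun y hy => hacoe y, ?_⟩
  · rw [hacoe]; simp [Ξ, hφ.map_zero, h.symm_zero, h.map_self]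
  · have hc : ContinuousAt (fun u => φ u • x) 0 :=
      (hφ.smooth.self_of_nhds.continuousAt).smul continuousAt_const
    have hcs : ∀ᶠ u in 𝓝 0, φ u • x ∈ e.source := by
      refine hc.eventually (e.open_source.eventually_mem ?_)
      simpa [hφ.map_zero] using h.mem_source
    have hDs : ∀ᶠ c in 𝓝 (0 : E), ‖D c‖ < ε / 2 := by
      have : Tendsto (fun c => ‖D c‖) (𝓝 0) (𝓝 0) := by
        have : Continuous (fun c => ‖D c‖) := by fun_prop
        simpa using this.tendsto 0
      exact this.eventually (gt_mem_nhds (by positivity))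
    have h1 := hφ.image_smul_mem hΓ
      ((hrk _ ((hDs.and hcs).and hφ.mem)).and hcs) x
    obtain ⟨O, hO, hxO, hOsub⟩ := mem_nhdsWithin.1 h1
    refine ⟨O, hO.mem_nhds hxO, fun g hg hgO => ?_⟩
    obtain ⟨u, ⟨⟨c, hcN, ⟨⟨hc1, hc2⟩, hc3⟩, hfc⟩, hu⟩, hgu⟩ := hOsub ⟨hgO, ⟨⟨g, hg⟩, rfl⟩⟩
    have h2 : φ u • x = φ c • x := e.injOn hu hc2 hfc
    -- Since `c` lies in the complement of the kernel, `κ (D c) = c`, so the section at `D c` is `φ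
    -- c`. This moves `x` exactly as `g` does.
    refine ⟨D c, hR ▸ ⟨c, rfl⟩, hc1, ?_⟩
    simp only [hκc c hcN]
    refine ⟨Γ.mul_mem (Γ.inv_mem hc3) hg, ?_⟩
    have h3 : g • x = φ c • x := by rw [← h2]; exact hgu.symm
    exact MulAction.mem_stabilizer_iff.2 (by rw [mul_smul, h3, inv_smul_smul])

namespace IsSlice

variable {Γ : Subgroup G} {x : M}
    {e : OpenPartialHomeomorph M (EuclideanSpace ℝ (Fin n))}
    {A : G → EuclideanSpace ℝ (Fin n) →L[ℝ] EuclideanSpace ℝ (Fin n)} {r : ℝ}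
    {R : Submodule ℝ (EuclideanSpace ℝ (Fin n))} {σ : EuclideanSpace ℝ (Fin n) → G}
    {a : OpenPartialHomeomorph (EuclideanSpace ℝ (Fin n)) (EuclideanSpace ℝ (Fin n))}
    {ε : ℝ}

theorem symm_apply (h : IsSlice Γ x e A r R σ a ε) {y : EuclideanSpace ℝ (Fin n)}
    (hy : y ∈ Metric.ball 0 ε) : e.symm (a y) = σ y • e.symm (Rᗮ.starProjection y) := by
  rw [h.apply_eq y hy, e.left_inv (h.smul_mem y hy)]

theorem add_mem_ball {ρ v : EuclideanSpace ℝ (Fin n)} {ε : ℝ} (hρ : ‖ρ‖ < ε / 2)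
    (hv : ‖v‖ < ε / 2) : ρ + v ∈ Metric.ball 0 ε := by
  rw [mem_ball_zero_iff]
  linarith [norm_add_le ρ v]

theorem starProjection_add {R : Submodule ℝ (EuclideanSpace ℝ (Fin n))}
    {ρ v : EuclideanSpace ℝ (Fin n)} (hρ : ρ ∈ R) (hv : v ∈ Rᗮ) :
    Rᗮ.starProjection (ρ + v) = v := by
  rw [map_add, Submodule.starProjection_eq_self_iff.2 hv,
    Submodule.starProjection_orthogonal_val, Submodule.starProjection_eq_self_iff.2 hρ, sub_self,
    zero_add]

/-- The action of an element of `Γ` which moves `x` only a little. -/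
theorem exists_smul_eq (h : IsSlice Γ x e A r R σ a ε) :
    ∃ O ∈ 𝓝 x, ∀ g ∈ Γ, g • x ∈ O → ∃ ρ ∈ R, ∃ k ∈ Γ ⊓ MulAction.stabilizer G x, g = σ ρ * k ∧
      ∀ v ∈ Rᗮ, ‖v‖ < ε / 2 → ρ + A k v ∈ Metric.ball 0 ε ∧
        g • e.symm v ∈ e.source ∧ e (g • e.symm v) = a (ρ + A k v) := by
  obtain ⟨O, hO, hfac⟩ := h.factor
  refine ⟨O, hO, fun g hg hgO => ?_⟩
  obtain ⟨ρ, hρ, hρε, hk⟩ := hfac g hg hgO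
  refine ⟨ρ, hρ, _, hk, by simp, fun v hv hvε => ?_⟩
  set k := (σ ρ)⁻¹ * g with hkdef
  have hAv : A k v ∈ Rᗮ := h.chart.map_orthogonal h.map_mem hk hv
  have hAn : ‖A k v‖ = ‖v‖ := h.chart.norm_map k hk v
  have hvr : ‖v‖ < r := hvε.trans_le (by linarith [h.le, h.pos])
  have hball : ρ + A k v ∈ Metric.ball 0 ε := add_mem_ball hρε (by rwa [hAn])
  have hg : g • e.symm v = σ (ρ + A k v) • e.symm (Rᗮ.starProjection (ρ + A k v)) := by
    rw [h.sec_add ρ _ hAv, starProjection_add hρ hAv, ← h.chart.smul_symm hk hvr, hkdef,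
      smul_smul, mul_inv_cancel_left]
  refine ⟨hball, ?_, ?_⟩
  · rw [hg]; exact h.smul_mem _ hball
  · rw [hg, h.apply_eq _ hball]

/-- Elements moving `x` out of a neighbourhood form a compact set without isotropy at `x`, hence
without isotropy at nearby points. For the others, injectivity of the tube map `a` leaves no
displacement along the orbit, so they lie in `L`. -/
theorem isotropy [TopologicalSpace G] [CompactSpace G] [T2Space M] [ContinuousSMul G M]
    (h : IsSlice Γ x e A r R σ a ε) (hΓ : IsClosed (Γ : Set G)) :
    ∃ δ > 0, δ ≤ ε / 2 ∧ ∀ v ∈ Rᗮ, ‖v‖ < δ → ∀ g ∈ Γ, g • e.symm v = e.symm v →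
      g • x = x ∧ A g v = v := by
  obtain ⟨O, hO, hsmul⟩ := h.exists_smul_eq
  have hev : ∀ᶠ z in 𝓝 x, ∀ g ∈ {g | g ∈ Γ ∧ g • x ∉ interior O}, g • z ≠ z := by
    have hcomp : IsCompact {g | g ∈ Γ ∧ g • x ∉ interior O} := by
      refine IsClosed.isCompact ?_
      exact hΓ.inter (isOpen_interior.isClosed_compl.preimage
        (continuous_id.smul continuous_const))
    refine hcomp.eventually_forall_of_forall_eventually fun g hg => ?_
    have h1 : g • x ≠ x := fun hgx => hg.2 (by rw [hgx]; exact mem_interior_iff_mem_nhds.2 hO)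
    have h2 : Continuous (fun q : M × G => q.2 • q.1) := by fun_prop
    exact (isOpen_ne_fun h2 continuous_fst).mem_nhds h1
  have h0t : (0 : EuclideanSpace ℝ (Fin n)) ∈ e.target :=
    h.chart.mem_target.2 (by simpa using h.chart.pos)
  have hc : Tendsto e.symm (𝓝 0) (𝓝 x) := by
    have := (e.continuousAt_symm h0t).tendsto
    rwa [h.chart.symm_zero] at this
  obtain ⟨δ, hδ, hball⟩ := Metric.mem_nhds_iff.1 (hc.eventually hev)
  refine ⟨min δ (ε / 2), lt_min hδ (half_pos h.pos), min_le_right _ _, fun v hv hvδ g hg hgv => ?_⟩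
  have hvδ' : ‖v‖ < δ := hvδ.trans_le (min_le_left _ _)
  have hvε : ‖v‖ < ε / 2 := hvδ.trans_le (min_le_right _ _)
  have hgO : g • x ∈ O := by
    by_contra hcon
    exact hball (mem_ball_zero_iff.2 hvδ') g ⟨hg, fun h => hcon (interior_subset h)⟩ hgv
  obtain ⟨ρ, hρ, k, hk, hgk, hact⟩ := hsmul g hg hgO
  obtain ⟨h1, -, h3⟩ := hact v hv hvε
  have hvr : ‖v‖ < r := hvε.trans_le (by linarith [h.le, h.pos])
  have hvb : v ∈ Metric.ball 0 ε := mem_ball_zero_iff.2 (by linarith [h.pos])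
  have h4 : a v = v := by
    have h5 := h.apply_eq v hvb
    have h6 := h.sec_add 0 v hv
    rw [zero_add] at h6
    rw [h5, h6, h.sec_zero, one_smul, Submodule.starProjection_eq_self_iff.2 hv,
      e.right_inv (h.chart.mem_target.2 hvr)]
  have h5 : ρ + A k v = v := by
    refine a.injOn (h.ball_subset h1) (h.ball_subset hvb) ?_
    rw [← h3, hgv, h4, e.right_inv (h.chart.mem_target.2 hvr)]
  have hAv : A k v ∈ Rᗮ := h.chart.map_orthogonal h.map_mem hk hv
  have h6 : A k v = v := by
    have := congrArg Rᗮ.starProjection h5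
    rwa [starProjection_add hρ hAv, Submodule.starProjection_eq_self_iff.2 hv] at this
  have h7 : ρ = 0 := by rwa [h6, add_eq_right] at h5
  have h8 : g = k := by rw [hgk, h7, h.sec_zero, one_mul]
  rw [h8]
  exact ⟨hk.2, h6⟩

theorem apply_of_mem_orthogonal (h : IsSlice Γ x e A r R σ a ε)
    {v : EuclideanSpace ℝ (Fin n)} (hv : v ∈ Rᗮ) (hvε : ‖v‖ < ε) : a v = v := by
  have h6 := h.sec_add 0 v hv
  rw [zero_add] at h6
  rw [h.apply_eq v (mem_ball_zero_iff.2 hvε), h6, h.sec_zero, one_smul,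
    Submodule.starProjection_eq_self_iff.2 hv,
    e.right_inv (h.chart.mem_target.2 (hvε.trans_le h.le))]

end IsSlice
end Slice

/-! ### The principal orbit theorem. -/

section Principal

/-- Up to conjugation in `Γ`, the isotropy group of `z` is contained in those of the points
of `S`. -/
def IsMinimalIsotropy {G M : Type*} [Group G] [MulAction G M] (Γ : Subgroup G) (z : M)
    (S : Set M) : Prop :=
  ∀ y ∈ S, ∃ g ∈ Γ, ∀ h ∈ Γ, h • z = z → h • g • y = g • y

theorem IsMinimalIsotropy.trans {G M : Type*} [Group G] [MulAction G M] {Γ : Subgroup G}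
    {z z' : M} {S S' : Set M} (h : IsMinimalIsotropy Γ z S) (hz' : z' ∈ S)
    (h' : IsMinimalIsotropy Γ z' S') : IsMinimalIsotropy Γ z S' := by
  intro y hy
  obtain ⟨g₁, hg₁, h₁⟩ := h' y hy
  obtain ⟨g₂, hg₂, h₂⟩ := h z' hz'
  refine ⟨g₂ * g₁, Γ.mul_mem hg₂ hg₁, fun k hk hkz => ?_⟩
  have h3 := h₂ k hk hkz
  have h4 := h₁ (g₂⁻¹ * k * g₂) (Γ.mul_mem (Γ.mul_mem (Γ.inv_mem hg₂) hk) hg₂) (by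
    rw [mul_smul, mul_smul, h3, inv_smul_smul])
  rw [mul_smul, mul_smul, inv_smul_eq_iff] at h4
  rw [mul_smul, h4]

variable {m n : ℕ} {G M : Type*} [Group G]
  [TopologicalSpace G] [ChartedSpace (EuclideanSpace ℝ (Fin m)) G] [LieGroup (𝓡 m) ∞ G]
  [IsTopologicalGroup G] [T2Space G] [CompactSpace G]
  [TopologicalSpace M] [T2Space M] [ChartedSpace (EuclideanSpace ℝ (Fin n)) M]
  [IsManifold (𝓡 n) ∞ M] [Bundle.RiemannianBundle (fun x : M => TangentSpace (𝓡 n) x)]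
  [MulAction G M] [ContinuousSMul G M] [ContMDiffSMul (𝓡 m) (𝓡 n) ∞ G M]
  {E : Type*} [NormedAddCommGroup E] [InnerProductSpace ℝ E] [FiniteDimensional ℝ E] {φ : E → G}
  {Γ : Subgroup G}

theorem isClosed_inf_stabilizer {G M : Type*} [Group G] [TopologicalSpace G] [TopologicalSpace M]
    [T1Space M] [MulAction G M] [ContinuousSMul G M] {Γ : Subgroup G}
    (hΓ : IsClosed (Γ : Set G)) (x : M) :
    IsClosed ((Γ ⊓ MulAction.stabilizer G x : Subgroup G) : Set G) :=
  hΓ.inter (isClosed_singleton.preimage (f := fun g : G => g • x)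
    (continuous_id.smul continuous_const))

/-- Every point of a tube is a translate of a slice vector, and the isotropy group of a small slice
vector lies in `L`. The claim thereby reduces to the orthogonal action of `L` on `Rᗮ`, treated by
`exists_principal_vector`. -/
theorem exists_open_isMinimalIsotropy (hisom : IsIsometricAction n G M)
    (hΓ : IsClosed (Γ : Set G)) (hφ : IsLocalParam m Γ φ) (x : M) :
    ∃ U : Set M, IsOpen U ∧ x ∈ U ∧ ∀ B : Set M, IsOpen B → (B ∩ U).Nonempty →
      ∃ z ∈ B ∩ U, IsMinimalIsotropy Γ z U := by
  have hL := isClosed_inf_stabilizer hΓ x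
  obtain ⟨e, A, r, hchart⟩ := exists_isLinearChart (m := m) (n := n) hisom hL (fun l hl => hl.2)
  obtain ⟨j, -, -, hφL⟩ := hφ.stabilizer hchart.mem_atlas hchart.mem_source rfl
  obtain ⟨σ, a, ε, hs⟩ := exists_isSlice hΓ hφ hchart rfl
  set R := LinearMap.range (fderiv ℝ (fun u => e (φ u • x)) 0 : E →ₗ[ℝ] EuclideanSpace ℝ (Fin n))
  obtain ⟨δ, hδ, hδε, hiso⟩ := hs.isotropy hΓ
  have hδε' : δ ≤ ε := by linarith [hs.pos]
  have hδr : δ ≤ r := hδε'.trans hs.le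
  have hsub : Metric.ball 0 δ ⊆ Metric.ball (0 : EuclideanSpace ℝ (Fin n)) ε :=
    Metric.ball_subset_ball hδε'
  have hPlt : ∀ y ∈ Metric.ball (0 : EuclideanSpace ℝ (Fin n)) δ,
      ‖Rᗮ.starProjection y‖ < δ := fun y hy =>
    (Rᗮ.norm_starProjection_apply_le y).trans_lt (mem_ball_zero_iff.1 hy)
  have hPm : ∀ y, Rᗮ.starProjection y ∈ Rᗮ := fun y => Submodule.starProjection_apply_mem _ _
  set U : Set M := e.source ∩ e ⁻¹' (a '' Metric.ball 0 δ) with hU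
  have hUeq : ∀ z ∈ U, ∃ y ∈ Metric.ball (0 : EuclideanSpace ℝ (Fin n)) δ,
      z = σ y • e.symm (Rᗮ.starProjection y) := by
    rintro z ⟨hz, y, hy, hyz⟩
    refine ⟨y, hy, ?_⟩
    rw [← hs.symm_apply (hsub hy), hyz, e.left_inv hz]
  have hUo : IsOpen U := e.isOpen_inter_preimage
    (a.isOpen_image_of_subset_source Metric.isOpen_ball (hsub.trans hs.ball_subset))
  refine ⟨U, hUo, ⟨hchart.mem_source, 0, Metric.mem_ball_self hδ, ?_⟩, ?_⟩
  · rw [hs.map_zero, hchart.map_self]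
  rintro B hB ⟨z₁, hz₁B, hz₁U⟩
  obtain ⟨y₁, hy₁, hzy₁⟩ := hUeq z₁ hz₁U
  have hB'o : IsOpen (Metric.ball 0 δ ∩ (fun v => σ y₁ • e.symm v) ⁻¹' (B ∩ U)) := by
    refine ContinuousOn.isOpen_inter_preimage ?_ Metric.isOpen_ball (hB.inter hUo)
    refine ContinuousOn.const_smul (e.continuousOn_symm.mono ?_) _
    rw [hchart.target_eq]
    exact Metric.ball_subset_ball hδr
  obtain ⟨v, ⟨⟨hvδ, hvBU⟩, hvR⟩, hv⟩ := exists_principal_vector hL.isCompact (V := Rᗮ)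
    (fun l hl => hchart.norm_map l hl)
    (fun k hk l hl v => DFunLike.congr_fun (hchart.map_mul hk hl) v) hchart.continuousOn
    (fun l hl v hv => hchart.map_orthogonal hs.map_mem hl hv) hB'o
    ⟨_, ⟨mem_ball_zero_iff.2 (hPlt y₁ hy₁), by
      rw [mem_preimage, ← hzy₁]; exact ⟨hz₁B, hz₁U⟩⟩, hPm y₁⟩
    (fun v hv => hchart.orbit_tangency hφL hL ((mem_ball_zero_iff.1 hv.1.1).trans_le hδr))
  rw [mem_ball_zero_iff] at hvδ
  refine ⟨_, hvBU, fun z' hz' => ?_⟩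
  obtain ⟨y', hy', rfl⟩ := hUeq z' hz'
  obtain ⟨l, hl, hmin⟩ := hv _ (hPm y')
  set v' := Rᗮ.starProjection y' with hv'
  have hv'r : ‖v'‖ < r := (hPlt y' hy').trans_le hδr
  have hlv' : ‖A l v'‖ < r := by rwa [hchart.norm_map l hl]
  have h1 := hs.sec_mem y₁ (hsub hy₁)
  refine ⟨σ y₁ * l * (σ y')⁻¹, Γ.mul_mem (Γ.mul_mem h1 hl.1) (Γ.inv_mem
    (hs.sec_mem y' (hsub hy'))), fun h hh hhz => ?_⟩
  rw [mul_smul, inv_smul_smul, mul_smul, hchart.smul_symm hl hv'r]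
  set k := (σ y₁)⁻¹ * h * σ y₁ with hk
  have hkΓ : k ∈ Γ := Γ.mul_mem (Γ.mul_mem (Γ.inv_mem h1) hh) h1
  have hkh : ∀ w : M, h • σ y₁ • w = σ y₁ • k • w := fun w => by
    simp [hk, mul_smul]
  have hkv : k • e.symm v = e.symm v := by
    have h2 : h • σ y₁ • e.symm v = σ y₁ • e.symm v := hhz
    rw [hkh] at h2
    exact smul_left_cancel _ h2
  obtain ⟨hkx, hkA⟩ := hiso v hvR hvδ k hkΓ hkv
  have hkL : k ∈ Γ ⊓ MulAction.stabilizer G x := ⟨hkΓ, hkx⟩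
  rw [hkh, hchart.smul_symm hkL hlv', hmin k hkL hkA]

/-- The principal orbit theorem: points with minimal isotropy group are dense. -/
theorem exists_mem_isMinimalIsotropy [ConnectedSpace M] (hisom : IsIsometricAction n G M)
    (hΓ : IsClosed (Γ : Set G)) (hφ : IsLocalParam m Γ φ) {B : Set M} (hB : IsOpen B)
    (hne : B.Nonempty) : ∃ z ∈ B, IsMinimalIsotropy Γ z univ := by
  choose U hUo hxU hU using exists_open_isMinimalIsotropy hisom hΓ hφ
  obtain ⟨x, hx⟩ := hne
  obtain ⟨z, hz, hzU⟩ := hU x B hB ⟨x, hx, hxU x⟩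
  refine ⟨z, hz.1, ?_⟩
  -- `S` is clopen. At a limit point `y` the sets `W` and `U y` overlap in a point that is minimal
  -- on all of `U y`, and minimality is transitive.
  set S : Set M := {y | ∃ W : Set M, IsOpen W ∧ y ∈ W ∧ IsMinimalIsotropy Γ z W} with hS
  have hSo : IsOpen S := by
    rw [isOpen_iff_mem_nhds]
    rintro y ⟨W, hW, hyW, hzW⟩
    exact Filter.mem_of_superset (hW.mem_nhds hyW) fun w hw => ⟨W, hW, hw, hzW⟩
  have hSc : IsClosed S := by
    rw [← closure_subset_iff_isClosed]
    intro y hy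
    obtain ⟨y', hy'U, W, hW, hy'W, hzW⟩ := mem_closure_iff.1 hy (U y) (hUo y) (hxU y)
    obtain ⟨w, hw, hwU⟩ := hU y W hW ⟨y', hy'W, hy'U⟩
    exact ⟨U y, hUo y, hxU y, hzW.trans hw.1 hwU⟩
  have hSu : S = univ := IsClopen.eq_univ ⟨hSc, hSo⟩ ⟨x, U x, hUo x, hxU x, hzU⟩
  intro y _
  obtain ⟨W, -, hyW, hzW⟩ : y ∈ S := hSu ▸ mem_univ y
  exact hzW y hyW

end Principal

/-! ### Dimensions of orbits. -/

section OrbitRank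

variable {m n : ℕ} {G M : Type*} [Group G]
  [TopologicalSpace G] [ChartedSpace (EuclideanSpace ℝ (Fin m)) G]
  [TopologicalSpace M] [ChartedSpace (EuclideanSpace ℝ (Fin n)) M] [IsManifold (𝓡 n) ∞ M]
  [MulAction G M]  [ContMDiffSMul (𝓡 m) (𝓡 n) ∞ G M]
  {E : Type*} [NormedAddCommGroup E] [InnerProductSpace ℝ E] [FiniteDimensional ℝ E] {φ : E → G}
  {Γ : Subgroup G}

/-- The derivative of the orbit map through `y`, in the preferred chart at `y`. -/
noncomputable def orbitDeriv (n : ℕ) {G M : Type*} [Group G] [TopologicalSpace M]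
    [ChartedSpace (EuclideanSpace ℝ (Fin n)) M] [MulAction G M] {E : Type*}
    [NormedAddCommGroup E] [NormedSpace ℝ E] (φ : E → G) (y : M) :
    E →L[ℝ] EuclideanSpace ℝ (Fin n) :=
  fderiv ℝ (fun u => chartAt (EuclideanSpace ℝ (Fin n)) y (φ u • y)) 0

/-- The dimension of the orbit through `y`. -/
noncomputable def orbitRank (n : ℕ) {G M : Type*} [Group G] [TopologicalSpace M]
    [ChartedSpace (EuclideanSpace ℝ (Fin n)) M] [MulAction G M] {E : Type*}
    [NormedAddCommGroup E] [NormedSpace ℝ E] (φ : E → G) (y : M) : ℕ :=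
  finrank ℝ (LinearMap.range (orbitDeriv n φ y : E →ₗ[ℝ] EuclideanSpace ℝ (Fin n)))

theorem IsLocalParam.orbitRank_mono [ContinuousSMul G M] (hφ : IsLocalParam m Γ φ) {x y : M}
    (hxy : ∀ g ∈ Γ, g • x = x → g • y = y) : orbitRank n φ y ≤ orbitRank n φ x := by
  have h1 := hφ.ker_le (IsManifold.chart_mem_maximalAtlas x)
    (mem_chart_source (EuclideanSpace ℝ (Fin n)) x) (IsManifold.chart_mem_maximalAtlas y)
    (mem_chart_source (EuclideanSpace ℝ (Fin n)) y) hxy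
  have h2 := Submodule.finrank_mono h1
  have h3 := LinearMap.finrank_range_add_finrank_ker
    (orbitDeriv n φ x : E →ₗ[ℝ] EuclideanSpace ℝ (Fin n))
  have h4 := LinearMap.finrank_range_add_finrank_ker
    (orbitDeriv n φ y : E →ₗ[ℝ] EuclideanSpace ℝ (Fin n))
  unfold orbitRank
  unfold orbitDeriv at *
  omega

/-- This is `dim K/H + dim G/K = dim G/H` for `H ⊆ K = G_p`. The orbit map of `K` at `y` is a
restriction of that of `Γ` with the same kernel, because the kernel at `y` lies in the kernel at
`p`. -/
theorem IsLocalParam.exists_stabilizer [ContinuousSMul G M] (hφ : IsLocalParam m Γ φ) (p : M) :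
    ∃ (N : Submodule ℝ E) (ψ : N → G), IsLocalParam m (Γ ⊓ MulAction.stabilizer G p) ψ ∧
      ∀ y : M, (∀ g ∈ Γ, g • y = y → g • p = p) →
        orbitRank n ψ y + orbitRank n φ p = orbitRank n φ y := by
  obtain ⟨j, hj0, hj', hψ⟩ := hφ.stabilizer (IsManifold.chart_mem_maximalAtlas p)
    (mem_chart_source (EuclideanSpace ℝ (Fin n)) p) rfl
  refine ⟨_, _, hψ, fun y hy => ?_⟩
  have h1 : orbitDeriv n (φ ∘ j) y = orbitDeriv n φ y ∘L Submodule.subtypeL _ := by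
    have h2 := ((hφ.smooth_smul (IsManifold.chart_mem_maximalAtlas y)
      (mem_chart_source (EuclideanSpace ℝ (Fin n)) y)).self_of_nhds.differentiableAt
      (by simp)).hasFDerivAt
    rw [← hj0] at h2
    have h3 := (h2.comp 0 hj').fderiv
    rw [hj0] at h3
    exact h3
  have hker := hφ.ker_le (IsManifold.chart_mem_maximalAtlas y)
    (mem_chart_source (EuclideanSpace ℝ (Fin n)) y) (IsManifold.chart_mem_maximalAtlas p)
    (mem_chart_source (EuclideanSpace ℝ (Fin n)) p) hy
  change LinearMap.ker (orbitDeriv n φ y : E →ₗ[ℝ] EuclideanSpace ℝ (Fin n)) ≤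
    LinearMap.ker (orbitDeriv n φ p : E →ₗ[ℝ] EuclideanSpace ℝ (Fin n)) at hker
  have h2 := LinearMap.finrank_range_add_finrank_ker
    (orbitDeriv n (φ ∘ j) y).toLinearMap
  have h3 := LinearMap.finrank_range_add_finrank_ker
    (orbitDeriv n φ y : E →ₗ[ℝ] EuclideanSpace ℝ (Fin n))
  have h4 := LinearMap.finrank_range_add_finrank_ker
    (orbitDeriv n φ p : E →ₗ[ℝ] EuclideanSpace ℝ (Fin n))
  have h5 : finrank ℝ (LinearMap.ker (orbitDeriv n (φ ∘ j) y).toLinearMap) =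
      finrank ℝ (LinearMap.ker (orbitDeriv n φ y : E →ₗ[ℝ] EuclideanSpace ℝ (Fin n))) := by
    rw [h1, ContinuousLinearMap.toLinearMap_comp, LinearMap.ker_comp]
    exact (Submodule.comapSubtypeEquivOfLe hker).finrank_eq
  change _ + _ = finrank ℝ (LinearMap.ker (orbitDeriv n φ p : E →ₗ[ℝ] EuclideanSpace ℝ (Fin n)))
    at h2
  unfold orbitRank
  omega

variable [IsTopologicalGroup G] [CompactSpace G] [T2Space M] [ContinuousSMul G M]

theorem IsLocalParam.hasLocalDim_of_mem_orbit (hφ : IsLocalParam m Γ φ)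
    (hΓ : IsClosed (Γ : Set G)) {y z : M} (hz : z ∈ MulAction.orbit Γ y) :
    HasLocalDim n (MulAction.orbit Γ y) z (orbitRank n φ y) := by
  have h1 : HasLocalDim n (MulAction.orbit Γ y) y (orbitRank n φ y) :=
    hφ.hasLocalDim_orbit hΓ (IsManifold.chart_mem_maximalAtlas y) (mem_chart_source _ y)
  obtain ⟨g, rfl⟩ := hz
  have h2 : ContMDiff (𝓡 n) (𝓡 n) ∞ (Homeomorph.smul (g : G)⁻¹ : M ≃ₜ M) :=
    contMDiff_const_smul' m _
  have h3 : ContMDiff (𝓡 n) (𝓡 n) ∞ (Homeomorph.smul (g : G)⁻¹ : M ≃ₜ M).symm := by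
    have := contMDiff_const_smul' (M := M) (n := n) m ((g : G)⁻¹)⁻¹
    exact this
  have h4 : (Homeomorph.smul (g : G)⁻¹ : M ≃ₜ M) (g • y) = y := by
    simp [Subgroup.smul_def]
  have h5 := HasLocalDim.preimage (Homeomorph.smul (g : G)⁻¹ : M ≃ₜ M) h2 h3 (x := g • y)
    (A := MulAction.orbit Γ y) (d := orbitRank n φ y) (by rw [h4]; exact h1)
  convert h5 using 1
  ext w
  change w ∈ _ ↔ (g⁻¹ : Γ) • w ∈ MulAction.orbit Γ y
  refine ⟨fun ⟨b, hb⟩ => ⟨g⁻¹ * b, ?_⟩, fun ⟨b, hb⟩ => ⟨g * b, ?_⟩⟩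
  · rw [← hb]; exact mul_smul _ _ _
  · change (g * b) • y = w
    rw [mul_smul, show b • y = g⁻¹ • w from hb, smul_inv_smul]

theorem IsLocalParam.hasDim_orbit (hφ : IsLocalParam m Γ φ)
    (hΓ : IsClosed (Γ : Set G)) (y : M) :
    HasDim n (MulAction.orbit Γ y) (orbitRank n φ y) :=
  ⟨⟨y, MulAction.mem_orbit_self y, hφ.hasLocalDim_of_mem_orbit hΓ (MulAction.mem_orbit_self y)⟩,
    fun _ hz => ⟨_, le_rfl, hφ.hasLocalDim_of_mem_orbit hΓ hz⟩⟩

theorem IsLocalParam.orbitRank_eq (hφ : IsLocalParam m Γ φ)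
    (hΓ : IsClosed (Γ : Set G)) {y : M} {d : ℕ} (hd : HasDim n (MulAction.orbit Γ y) d) :
    orbitRank n φ y = d := by
  obtain ⟨⟨z, hz, hzd⟩, -⟩ := hd
  exact (hφ.hasLocalDim_of_mem_orbit hΓ hz).unique hzd

theorem IsLocalParam.orbitRank_smul (hφ : IsLocalParam m Γ φ)
    (hΓ : IsClosed (Γ : Set G)) {g : G} (hg : g ∈ Γ) (y : M) :
    orbitRank n φ (g • y) = orbitRank n φ y := by
  refine hφ.orbitRank_eq hΓ ?_
  have : MulAction.orbit Γ (g • y) = MulAction.orbit Γ y := MulAction.orbit_smul (⟨g, hg⟩ : Γ) y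
  rw [this]
  exact hφ.hasDim_orbit hΓ y

theorem IsLocalParam.orbitRank_eq_finrank (hφ : IsLocalParam m Γ φ)
    (hΓ : IsClosed (Γ : Set G)) {y : M} {e : OpenPartialHomeomorph M (EuclideanSpace ℝ (Fin n))}
    (he : e ∈ IsManifold.maximalAtlas (𝓡 n) ∞ M) (hy : y ∈ e.source) :
    orbitRank n φ y = finrank ℝ (LinearMap.range
      (fderiv ℝ (fun u => e (φ u • y)) 0 : E →ₗ[ℝ] EuclideanSpace ℝ (Fin n))) :=
  (hφ.hasLocalDim_of_mem_orbit hΓ (MulAction.mem_orbit_self y)).unique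
    (hφ.hasLocalDim_orbit hΓ he hy)

/-- An orbit of full dimension is open, and it is compact, so it would be all of the connected `M`.
All orbits would then have full dimension. -/
theorem IsLocalParam.orbitRank_lt [ConnectedSpace M] (hφ : IsLocalParam m Γ φ)
    (hΓ : IsClosed (Γ : Set G)) {x : M} (hx : orbitRank n φ x < n) (y : M) :
    orbitRank n φ y < n := by
  have hle : orbitRank n φ y ≤ n := by
    have := Submodule.finrank_le
      (LinearMap.range (orbitDeriv n φ y : E →ₗ[ℝ] EuclideanSpace ℝ (Fin n)))
    rwa [finrank_euclideanSpace_fin] at this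
  refine lt_of_le_of_ne hle fun hyn => ?_
  have hopen : IsOpen (MulAction.orbit Γ y) := by
    rw [isOpen_iff_mem_nhds]
    intro z hz
    obtain ⟨e, he, hze, W, hW, hA⟩ := hφ.hasLocalDim_of_mem_orbit (n := n) hΓ hz
    have hWt : W = ⊤ := Submodule.eq_top_of_finrank_eq (by
      rw [hW, hyn, finrank_euclideanSpace_fin])
    filter_upwards [e.open_source.mem_nhds hze] with w hw
    rw [hA w hw, hWt]
    trivial
  have hclosed : IsClosed (MulAction.orbit Γ y) := by
    have : CompactSpace Γ := isCompact_iff_compactSpace.1 hΓ.isCompact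
    have hc : Continuous fun g : Γ => g • y := continuous_id.smul continuous_const
    exact (isCompact_range hc).isClosed
  have huniv : MulAction.orbit Γ y = univ :=
    IsClopen.eq_univ ⟨hclosed, hopen⟩ ⟨y, MulAction.mem_orbit_self y⟩
  obtain ⟨g, rfl⟩ : x ∈ MulAction.orbit Γ y := huniv ▸ mem_univ x
  have h1 := hφ.orbitRank_smul (n := n) (M := M) hΓ g.2 y
  change orbitRank n φ ((g : G) • y) < n at hx
  omega

end OrbitRank

/-- In a compact group, a closed subgroup is not conjugate to a proper subgroup of itself. -/
theorem inv_mul_mul_mem_of_forall_mul_mul_inv_mem {G : Type*} [Group G] [TopologicalSpace G]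
    [IsTopologicalGroup G] [CompactSpace G] {H : Subgroup G} (hH : IsClosed (H : Set G)) {g : G}
    (hg : ∀ h ∈ H, g * h * g⁻¹ ∈ H) : ∀ h ∈ H, g⁻¹ * h * g ∈ H := by
  have hpow : ∀ k : ℕ, ∀ h ∈ H, g ^ k * h * (g ^ k)⁻¹ ∈ H := by
    intro k
    induction k with
    | zero => intro h hh; simpa using hh
    | succ k ih =>
      intro h hh
      have := hg _ (ih h hh)
      simpa [pow_succ', mul_assoc] using this
  intro h hh
  have hcl : IsClosed {a : G | a * h * a⁻¹ ∈ H} := hH.preimage (by fun_prop)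
  -- In a compact group the inverse of `g` is a limit of positive powers of `g`, and these conjugate
  -- `H` into itself.
  have hmem : g⁻¹ ∈ closure (range fun k : ℕ => g ^ k) := by
    have := mapClusterPt_self_zpow_atTop_pow g (-1)
    rw [zpow_neg_one] at this
    refine mem_closure_iff_clusterPt.2 (ClusterPt.mono this ?_)
    rw [le_principal_iff, mem_map]
    exact Eventually.of_forall fun k => mem_range_self k
  have h1 : closure (range fun k : ℕ => g ^ k) ⊆ {a : G | a * h * a⁻¹ ∈ H} :=
    hcl.closure_subset_iff.2 (by rintro _ ⟨k, rfl⟩; exact hpow k h hh)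
  simpa using h1 hmem

/-! ### Fixed points of a normal isotropy group. -/

section FixedPoints

theorem finrank_range_add_two_le {E F : Type*} [AddCommGroup E] [Module ℝ E]
    [NormedAddCommGroup F] [InnerProductSpace ℝ F] [FiniteDimensional ℝ F] (D : E →ₗ[ℝ] F)
    {w w' : F} (hw : w ≠ 0) (hw' : w' ≠ 0) (hww' : inner ℝ w w' = 0)
    (hD : ∀ u, inner ℝ (D u) w = 0) (hD' : ∀ u, inner ℝ (D u) w' = 0) :
    finrank ℝ (LinearMap.range D) + 2 ≤ finrank ℝ F := by
  have h1 : LinearIndependent ℝ ![w, w'] := by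
    refine linearIndependent_of_ne_zero_of_inner_eq_zero ?_ ?_
    · intro i; fin_cases i <;> assumption
    · intro i j hij
      fin_cases i <;> fin_cases j <;> simp_all [real_inner_comm]
  have h2 := finrank_span_eq_card h1
  rw [Fintype.card_fin] at h2
  have h3 : Submodule.span ℝ (range ![w, w']) ≤ (LinearMap.range D)ᗮ := by
    rw [Submodule.span_le]
    rintro _ ⟨i, rfl⟩
    rw [SetLike.mem_coe, Submodule.mem_orthogonal]
    rintro _ ⟨u, rfl⟩
    fin_cases i
    exacts [hD u, hD' u]
  have h4 := Submodule.finrank_mono h3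
  have h5 := (LinearMap.range D).finrank_add_finrank_orthogonal
  omega

variable {m n : ℕ} {G M : Type*} [Group G]
  [TopologicalSpace G] [ChartedSpace (EuclideanSpace ℝ (Fin m)) G]
  [TopologicalSpace M] [ChartedSpace (EuclideanSpace ℝ (Fin n)) M]
  [MulAction G M] [ContMDiffSMul (𝓡 m) (𝓡 n) ∞ G M]
  {E : Type*} [NormedAddCommGroup E] [InnerProductSpace ℝ E] [FiniteDimensional ℝ E] {φ : E → G}
  {Γ : Subgroup G} {x : M} {e : OpenPartialHomeomorph M (EuclideanSpace ℝ (Fin n))}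
  {A : G → EuclideanSpace ℝ (Fin n) →L[ℝ] EuclideanSpace ℝ (Fin n)} {r : ℝ}
  {R : Submodule ℝ (EuclideanSpace ℝ (Fin n))} {σ : EuclideanSpace ℝ (Fin n) → G}
  {a : OpenPartialHomeomorph (EuclideanSpace ℝ (Fin n)) (EuclideanSpace ℝ (Fin n))}
  {ε : ℝ}

theorem inner_fderiv_eq_zero_of_norm_eq {E F : Type*} [NormedAddCommGroup E] [NormedSpace ℝ E]
    [NormedAddCommGroup F] [InnerProductSpace ℝ F] [FiniteDimensional ℝ F] {b : E → F}
    {D : E →L[ℝ] F} (hb : HasFDerivAt b D 0) (W : Submodule ℝ F) {c : ℝ}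
    (hc : ∀ᶠ u in 𝓝 0, ‖W.starProjection (b u)‖ = c) (u : E) :
    inner ℝ (D u) (W.starProjection (b 0)) = 0 := by
  have h1 := (W.starProjection.hasFDerivAt.comp 0 hb).norm_sq
  have h2 : (fun u => ‖(W.starProjection ∘ b) u‖ ^ 2) =ᶠ[𝓝 0] fun _ => c ^ 2 := by
    filter_upwards [hc] with u hu
    simp [hu]
  have h3 := DFunLike.congr_fun
    (h1.unique ((hasFDerivAt_const (c ^ 2) (0 : E)).congr_of_eventuallyEq h2)) u
  have h4 : inner ℝ (W.starProjection (b 0)) (W.starProjection (D u)) = 0 := by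
    simpa using h3
  rw [← Submodule.inner_starProjection_left_eq_right,
    Submodule.starProjection_eq_self_iff.2 (W.starProjection_apply_mem _), real_inner_comm] at h4
  exact h4

/-- Orbits meeting the slice off an invariant subspace and its complement have codimension at
least two. -/
theorem IsSlice.finrank_orbit_add_two_le [IsTopologicalGroup G]
    (h : IsSlice Γ x e A r R σ a ε) (hφ : IsLocalParam m Γ φ)
    {W : Submodule ℝ (EuclideanSpace ℝ (Fin n))} (hWR : W ≤ Rᗮ)
    (hW : ∀ l ∈ Γ ⊓ MulAction.stabilizer G x, ∀ w ∈ W, A l w ∈ W)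
    {v : EuclideanSpace ℝ (Fin n)} (hv : v ∈ Rᗮ) (hvε : ‖v‖ < ε / 2)
    (hw : W.starProjection v ≠ 0) (hw' : v - W.starProjection v ≠ 0) :
    finrank ℝ (LinearMap.range
      (fderiv ℝ (fun u => e (φ u • e.symm v)) 0 : E →ₗ[ℝ] EuclideanSpace ℝ (Fin n))) + 2 ≤ n := by
  have hε := h.pos
  have hav : a v = v := h.apply_of_mem_orthogonal hv (by linarith)
  have hvr : ‖v‖ < r := by linarith [h.le]
  have hvt : v ∈ e.target := h.chart.mem_target.2 hvr
  have hvs : v ∈ a.source := h.ball_subset (mem_ball_zero_iff.2 (by linarith))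
  have hva : v ∈ a.target := by
    have := a.map_source hvs
    rwa [hav] at this
  have hsv : a.symm v = v := by
    have := a.left_inv hvs
    rwa [hav] at this
  set f : E → EuclideanSpace ℝ (Fin n) := fun u => e (φ u • e.symm v) with hf
  have hfs := (hφ.smooth_smul h.chart.mem_atlas (e.map_target hvt)).self_of_nhds
  have hf0 : f 0 = v := by simp [hf, hφ.map_zero, e.right_inv hvt]
  have hfd : HasFDerivAt f (fderiv ℝ f 0) 0 := (hfs.differentiableAt (by simp)).hasFDerivAt
  have hbd : DifferentiableAt ℝ (fun u => a.symm (f u)) 0 :=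
    DifferentiableAt.comp (0 : E)
      (by rw [hf0]; exact (h.smooth_symm v hva).differentiableAt (by simp))
      hfd.differentiableAt
  set b : E → EuclideanSpace ℝ (Fin n) := fun u => a.symm (f u) with hb
  have hb0 : b 0 = v := by rw [hb]; simp only [hf0, hsv]
  obtain ⟨O, hO, hact⟩ := h.exists_smul_eq
  have hφO : ∀ᶠ u in 𝓝 0, φ u • x ∈ O := by
    have h1 : ContinuousAt (fun u => φ u • x) 0 :=
      (hφ.smooth.self_of_nhds.smul (contMDiffAt_const (c := x)) :
        ContMDiffAt 𝓘(ℝ, E) (𝓡 n) ∞ (fun u => φ u • x) 0).continuousAt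
    refine h1 ?_
    simpa [hφ.map_zero] using hO
  have hbeq : ∀ᶠ u in 𝓝 0, ∃ ρ ∈ R, ∃ k ∈ Γ ⊓ MulAction.stabilizer G x, b u = ρ + A k v := by
    filter_upwards [hφO, hφ.mem] with u hu hu'
    obtain ⟨ρ, hρ, k, hk, -, hkv⟩ := hact _ hu' hu
    obtain ⟨h1, -, h3⟩ := hkv v hv hvε
    refine ⟨ρ, hρ, k, hk, ?_⟩
    rw [hb, hf]
    simp only [h3]
    exact a.left_inv (h.ball_subset h1)
  -- In tube coordinates the orbit has slice component `A k v`. The norms of this component and of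
  -- its `W`-part are constant, which gives two independent normal directions.
  have hR : ∀ u, inner ℝ (fderiv ℝ b 0 u) v = 0 := by
    have h1 : ∀ᶠ u in 𝓝 0, ‖Rᗮ.starProjection (b u)‖ = ‖v‖ := by
      filter_upwards [hbeq] with u ⟨ρ, hρ, k, hk, hu⟩
      rw [hu, IsSlice.starProjection_add hρ (h.chart.map_orthogonal h.map_mem hk hv),
        h.chart.norm_map k hk]
    intro u
    have := inner_fderiv_eq_zero_of_norm_eq hbd.hasFDerivAt Rᗮ h1 u
    rwa [hb0, Submodule.starProjection_eq_self_iff.2 hv] at this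
  have hWd : ∀ u, inner ℝ (fderiv ℝ b 0 u) (W.starProjection v) = 0 := by
    have h1 : ∀ᶠ u in 𝓝 0, ‖W.starProjection (b u)‖ = ‖W.starProjection v‖ := by
      filter_upwards [hbeq] with u ⟨ρ, hρ, k, hk, hu⟩
      have h2 : W.starProjection ρ = 0 := by
        rw [Submodule.starProjection_apply_eq_zero_iff]
        exact Submodule.orthogonal_le hWR (by rwa [Submodule.orthogonal_orthogonal])
      have h3 : A k v = A k (W.starProjection v) + A k (v - W.starProjection v) := by
        rw [← map_add, add_sub_cancel]
      have h4 := h.chart.map_orthogonal hW hk (W.sub_starProjection_mem_orthogonal v)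
      rw [hu, h3, map_add, map_add, h2, zero_add, Submodule.starProjection_eq_self_iff.2
        (hW k hk _ (W.starProjection_apply_mem v)),
        (Submodule.starProjection_apply_eq_zero_iff W).2 h4, add_zero, h.chart.norm_map k hk]
    intro u
    have := inner_fderiv_eq_zero_of_norm_eq hbd.hasFDerivAt W h1 u
    rwa [hb0] at this
  have h1 := finrank_range_add_two_le (fderiv ℝ b 0).toLinearMap hw hw'
    (Submodule.inner_right_of_mem_orthogonal (W.starProjection_apply_mem v)
      (W.sub_starProjection_mem_orthogonal v)) hWd
    (fun u => by
      change inner ℝ (fderiv ℝ b 0 u) _ = 0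
      rw [inner_sub_right, hR, hWd, sub_zero])
  rw [finrank_euclideanSpace_fin] at h1
  have h2 : fderiv ℝ f 0 = fderiv ℝ a v ∘L fderiv ℝ b 0 := by
    have h3 : HasFDerivAt a (fderiv ℝ a v) (b 0) := by
      rw [hb0]
      exact ((h.smooth v hvs).differentiableAt (by simp)).hasFDerivAt
    have h4 : f =ᶠ[𝓝 0] a ∘ b := by
      filter_upwards [hfd.continuousAt.eventually (a.open_target.eventually_mem
        (by rwa [hf0]))] with u hu
      exact (a.right_inv hu).symm
    exact ((h3.comp 0 hbd.hasFDerivAt).congr_of_eventuallyEq h4).fderiv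
  have h3 : finrank ℝ (LinearMap.range (fderiv ℝ f 0 : E →ₗ[ℝ] EuclideanSpace ℝ (Fin n))) ≤
      finrank ℝ (LinearMap.range (fderiv ℝ b 0 : E →ₗ[ℝ] EuclideanSpace ℝ (Fin n))) := by
    rw [h2, ContinuousLinearMap.toLinearMap_comp, LinearMap.range_comp]
    exact Submodule.finrank_map_le _ _
  omega

omit [FiniteDimensional ℝ E] in
-- A normal subgroup fixing `x` fixes the whole orbit `G(x)`, so it acts trivially on the tangent
-- space.
theorem IsLinearChart.map_orbit_tangent {K : Subgroup G} [ContinuousSMul G M]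
    (h : IsLinearChart K x e A r) (hφ : IsLocalParam m ⊤ φ) (hK : K.Normal) {k : G}
    (hk : k ∈ K) {v : EuclideanSpace ℝ (Fin n)} (hv : v ∈ LinearMap.range
      (fderiv ℝ (fun u => e (φ u • x)) 0 : E →ₗ[ℝ] EuclideanSpace ℝ (Fin n))) : A k v = v := by
  obtain ⟨u, rfl⟩ := hv
  have hd := ((hφ.smooth_smul h.mem_atlas h.mem_source).self_of_nhds.differentiableAt
    (by simp)).hasFDerivAt
  have h1 : ContinuousAt (fun u => φ u • x) 0 :=
    (hφ.smooth.self_of_nhds.smul (contMDiffAt_const (c := x)) :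
      ContMDiffAt 𝓘(ℝ, E) (𝓡 n) ∞ (fun u => φ u • x) 0).continuousAt
  have h2 : (fun u => e (φ u • x)) =ᶠ[𝓝 0] A k ∘ fun u => e (φ u • x) := by
    filter_upwards [h1.eventually (e.open_source.eventually_mem
      (by simpa [hφ.map_zero] using h.mem_source))] with u hu
    have h3 : k • φ u • x = φ u • x := by
      have h4 := h.smul_self (by simpa using hK.conj_mem k hk (φ u)⁻¹ : (φ u)⁻¹ * k * φ u ∈ K)
      rw [mul_smul, mul_smul, inv_smul_eq_iff] at h4
      exact h4
    change _ = A k (e (φ u • x))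
    rw [← h.map_smul k hk _ hu, h3]
  exact (DFunLike.congr_fun (hd.unique
    (((A k).hasFDerivAt.comp 0 hd).congr_of_eventuallyEq h2)) u).symm


variable [LieGroup (𝓡 m) ∞ G] [IsTopologicalGroup G] [T2Space G] [CompactSpace G] [T2Space M]
  [ConnectedSpace M] [IsManifold (𝓡 n) ∞ M]
  [Bundle.RiemannianBundle (fun x : M => TangentSpace (𝓡 n) x)]
  [ContinuousSMul G M]

/-- If a normal isotropy group is singular, then its fixed points in a slice are trivial. -/
theorem IsSlice.eq_zero_of_forall_map_eq (hisom : IsIsometricAction n G M)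
    (hφ : IsLocalParam m ⊤ φ) {p : M} (hK : (MulAction.stabilizer G p).Normal)
    (hp : orbitRank n φ p + 1 < n)
    (hmin : ∀ z : M, IsMinimalIsotropy (⊤ : Subgroup G) z univ → orbitRank n φ z + 1 = n)
    (h : IsSlice ⊤ x e A r R σ a ε)
    (hKx : MulAction.stabilizer G p ≤ MulAction.stabilizer G x)
    (hKR : ∀ k ∈ MulAction.stabilizer G p, ∀ v ∈ R, A k v = v)
    {w₀ : EuclideanSpace ℝ (Fin n)} (hw₀ : w₀ ∈ Rᗮ)
    (hw₀K : ∀ k ∈ MulAction.stabilizer G p, A k w₀ = w₀) : w₀ = 0 := by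
  by_contra hne
  have hKL : ∀ k ∈ MulAction.stabilizer G p, k ∈ ⊤ ⊓ MulAction.stabilizer G x :=
    fun k hk => ⟨trivial, hKx hk⟩
  have hΓ : IsClosed ((⊤ : Subgroup G) : Set G) := isClosed_univ
  let W : Submodule ℝ (EuclideanSpace ℝ (Fin n)) :=
    { carrier := {w | w ∈ Rᗮ ∧ ∀ k ∈ MulAction.stabilizer G p, A k w = w}
      add_mem' := fun {u v} hu hv => ⟨Rᗮ.add_mem hu.1 hv.1, fun k hk => by
        rw [map_add, hu.2 k hk, hv.2 k hk]⟩
      zero_mem' := ⟨Rᗮ.zero_mem, fun k _ => (A k).map_zero⟩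
      smul_mem' := fun c v hv => ⟨Rᗮ.smul_mem c hv.1, fun k hk => by
        rw [map_smul, hv.2 k hk]⟩ }
  have hWR : W ≤ Rᗮ := fun w hw => hw.1
  -- Normality: `k * l = l * (l⁻¹ * k * l)`, and the conjugate on the right again fixes `w`.
  have hW : ∀ l ∈ ⊤ ⊓ MulAction.stabilizer G x, ∀ w ∈ W, A l w ∈ W := by
    refine fun l hl w hw => ⟨h.chart.map_orthogonal h.map_mem hl hw.1, fun k hk => ?_⟩
    have h1 : l⁻¹ * k * l ∈ MulAction.stabilizer G p := by
      simpa using hK.conj_mem k hk l⁻¹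
    have h2 := DFunLike.congr_fun (h.chart.map_mul (hKL k hk) hl) w
    have h3 := DFunLike.congr_fun (h.chart.map_mul hl (hKL _ h1)) w
    rw [show l * (l⁻¹ * k * l) = k * l by group, h2] at h3
    simpa [hw.2 _ h1] using h3
  -- If `K` acts trivially on the slice, it fixes the whole chart domain, including a principal
  -- point `z`. So `dim G(z) ≤ dim G(p)`, which is too small.
  by_cases hRW : Rᗮ ≤ W
  · obtain ⟨z, hz, hzmin⟩ := exists_mem_isMinimalIsotropy hisom hΓ hφ e.open_source
      ⟨x, h.chart.mem_source⟩
    have h1 : orbitRank n φ z ≤ orbitRank n φ p := by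
      refine hφ.orbitRank_mono fun k _ hk => ?_
      refine e.injOn (h.chart.smul_mem k (hKL k hk) z hz) hz ?_
      rw [h.chart.map_smul k (hKL k hk) z hz]
      have h2 := (hRW (Submodule.starProjection_apply_mem Rᗮ (e z))).2 k hk
      have h3 := hKR k hk _ (R.starProjection_apply_mem (e z))
      have h4 := R.starProjection_orthogonal_val (e z)
      rw [h4, map_sub, h3] at h2
      exact sub_left_injective h2
    have := hmin z hzmin
    omega
  · obtain ⟨v₁, hv₁, hv₁W⟩ := SetLike.not_le_iff_exists.1 hRW
    set w₁ := v₁ - W.starProjection v₁ with hw₁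
    have hw₁0 : w₁ ≠ 0 := fun h0 => hv₁W (by
      rw [sub_eq_zero.1 h0]; exact W.starProjection_apply_mem _)
    have hw₁W : w₁ ∈ Wᗮ := W.sub_starProjection_mem_orthogonal v₁
    have hw₁R : w₁ ∈ Rᗮ := Rᗮ.sub_mem hv₁ (hWR (W.starProjection_apply_mem _))
    -- Both slice components nonzero is an open condition, and it holds at small multiples of `w₀ +
    -- w₁`. Density puts a principal point there, where orbits have codimension at least two.
    set Y : Set (EuclideanSpace ℝ (Fin n)) := Metric.ball 0 (ε / 2) ∩
      ({y | W.starProjection y ≠ 0} ∩ {y | Rᗮ.starProjection y - W.starProjection y ≠ 0}) with hY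
    have hYo : IsOpen Y := by
      refine Metric.isOpen_ball.inter (IsOpen.inter ?_ ?_)
      · exact isOpen_ne_fun (by fun_prop) (by fun_prop)
      · exact isOpen_ne_fun (by fun_prop) (by fun_prop)
    have hYb : Y ⊆ Metric.ball 0 ε := fun y hy =>
      Metric.ball_subset_ball (by linarith [h.pos]) hy.1
    have hBo : IsOpen (e.source ∩ e ⁻¹' (a '' Y)) := e.isOpen_inter_preimage
      (a.isOpen_image_of_subset_source hYo (hYb.trans h.ball_subset))
    have hBne : (e.source ∩ e ⁻¹' (a '' Y)).Nonempty := by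
      have h1 : ∀ᶠ t in 𝓝[>] (0 : ℝ), ‖t • (w₀ + w₁)‖ < ε / 2 := by
        have h2 : Tendsto (fun t : ℝ => ‖t • (w₀ + w₁)‖) (𝓝 0) (𝓝 0) := by
          have : Continuous (fun t : ℝ => ‖t • (w₀ + w₁)‖) := by fun_prop
          simpa using this.tendsto 0
        exact (h2.eventually (gt_mem_nhds (half_pos h.pos))).filter_mono nhdsWithin_le_nhds
      obtain ⟨t, ht, ht0⟩ := (h1.and self_mem_nhdsWithin).exists
      replace ht0 : 0 < t := ht0
      set y := t • (w₀ + w₁) with hy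
      have hyR : y ∈ Rᗮ := Rᗮ.smul_mem t (Rᗮ.add_mem hw₀ hw₁R)
      have hyW : W.starProjection y = t • w₀ := by
        rw [hy, map_smul, map_add, Submodule.starProjection_eq_self_iff.2
          (⟨hw₀, hw₀K⟩ : w₀ ∈ W), (Submodule.starProjection_apply_eq_zero_iff W).2 hw₁W, add_zero]
      have hyε : ‖y‖ < ε := by linarith [h.pos]
      have hyt : y ∈ e.target := h.chart.mem_target.2 (hyε.trans_le h.le)
      refine ⟨e.symm y, e.map_target hyt, y, ⟨mem_ball_zero_iff.2 ht, ?_, ?_⟩, ?_⟩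
      · rw [mem_ofPred_eq, hyW]
        exact smul_ne_zero ht0.ne' hne
      · rw [mem_ofPred_eq, hyW, Submodule.starProjection_eq_self_iff.2 hyR, hy, ← smul_sub,
          add_sub_cancel_left]
        exact smul_ne_zero ht0.ne' hw₁0
      · rw [h.apply_of_mem_orthogonal hyR hyε, e.right_inv hyt]
    obtain ⟨z, ⟨hz, y, hy, hyz⟩, hzmin⟩ := exists_mem_isMinimalIsotropy hisom hΓ hφ hBo hBne
    have h1 : z = σ y • e.symm (Rᗮ.starProjection y) := by
      rw [← h.symm_apply (hYb hy), hyz, e.left_inv hz]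
    have h2 := hmin z hzmin
    set v := Rᗮ.starProjection y with hv
    have hvR : v ∈ Rᗮ := Rᗮ.starProjection_apply_mem y
    have hvε : ‖v‖ < ε / 2 :=
      (Rᗮ.norm_starProjection_apply_le y).trans_lt (mem_ball_zero_iff.1 hy.1)
    have hWv : W.starProjection v = W.starProjection y := by
      have h3 : y = v + R.starProjection y := by
        rw [hv, Submodule.starProjection_orthogonal_val, sub_add_cancel]
      have h4 : W.starProjection (R.starProjection y) = 0 := by
        rw [Submodule.starProjection_apply_eq_zero_iff]
        exact Submodule.orthogonal_le hWR (by
          rw [Submodule.orthogonal_orthogonal]; exact R.starProjection_apply_mem y)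
      conv_rhs => rw [h3, map_add, h4, add_zero]
    have h3 := h.finrank_orbit_add_two_le hφ hWR hW hvR hvε (by rw [hWv]; exact hy.2.1)
      (by rw [hWv]; exact hy.2.2)
    have hvr : ‖v‖ < r := by linarith [h.le, h.pos]
    have h4 := hφ.orbitRank_eq_finrank hΓ h.chart.mem_atlas
      (e.map_target (h.chart.mem_target.2 hvr))
    rw [h1, hφ.orbitRank_smul hΓ trivial] at h2
    omega

/-- If a normal isotropy group is singular, then its fixed point set is locally an orbit. -/
theorem IsLocalParam.hasLocalDim_fixedPoints (hisom : IsIsometricAction n G M)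
    (hφ : IsLocalParam m ⊤ φ) {p : M} (hK : (MulAction.stabilizer G p).Normal)
    (hp : orbitRank n φ p + 1 < n)
    (hmin : ∀ z : M, IsMinimalIsotropy (⊤ : Subgroup G) z univ → orbitRank n φ z + 1 = n)
    (hx : x ∈ MulAction.fixedPoints (MulAction.stabilizer G p) M) :
    HasLocalDim n (MulAction.fixedPoints (MulAction.stabilizer G p) M) x (orbitRank n φ x) := by
  have hΓ : IsClosed ((⊤ : Subgroup G) : Set G) := isClosed_univ
  have hKx : MulAction.stabilizer G p ≤ MulAction.stabilizer G x := fun k hk => hx ⟨k, hk⟩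
  have hKL : ∀ k ∈ MulAction.stabilizer G p, k ∈ ⊤ ⊓ MulAction.stabilizer G x :=
    fun k hk => ⟨trivial, hKx hk⟩
  obtain ⟨e, A, r, hchart⟩ := exists_isLinearChart (m := m) (n := n) hisom
    (isClosed_inf_stabilizer hΓ x) (fun l hl => hl.2)
  obtain ⟨σ, a, ε, hs⟩ := exists_isSlice hΓ hφ hchart rfl
  set R := LinearMap.range (fderiv ℝ (fun u => e (φ u • x)) 0 : E →ₗ[ℝ] EuclideanSpace ℝ (Fin n))
    with hR
  have hKR : ∀ k ∈ MulAction.stabilizer G p, ∀ v ∈ R, A k v = v := by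
    intro k hk v hv
    have hc : IsLinearChart (MulAction.stabilizer G p) x e A r :=
      { hchart with
        norm_map := fun l hl => hchart.norm_map l (hKL l hl)
        smul_mem := fun l hl => hchart.smul_mem l (hKL l hl)
        map_smul := fun l hl => hchart.map_smul l (hKL l hl) }
    exact hc.map_orbit_tangent hφ hK hk hv
  refine ⟨e, hchart.mem_atlas, hchart.mem_source, R,
    (hφ.orbitRank_eq_finrank hΓ hchart.mem_atlas hchart.mem_source).symm, fun y hy => ?_⟩
  rw [hchart.map_self, sub_zero]
  constructor
  · intro hyK
    have h1 : e y - R.starProjection (e y) = 0 := by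
      refine hs.eq_zero_of_forall_map_eq hisom hφ hK hp hmin hKx hKR
        (R.sub_starProjection_mem_orthogonal _) fun k hk => ?_
      have h2 : k • y = y := hyK ⟨k, hk⟩
      rw [map_sub, hKR k hk _ (R.starProjection_apply_mem _), ← hchart.map_smul k (hKL k hk) y hy,
        h2]
    rw [sub_eq_zero.1 h1]
    exact R.starProjection_apply_mem _
  · rintro hyR ⟨k, hk⟩
    change k • y = y
    refine e.injOn (hchart.smul_mem k (hKL k hk) y hy) hy ?_
    rw [hchart.map_smul k (hKL k hk) y hy, hKR k hk _ hyR]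

end FixedPoints

/-! ### Restriction of the action to a normal isotropy group. -/

section Normal

theorem orbit_top {G M : Type*} [Group G] [MulAction G M] (y : M) :
    MulAction.orbit (⊤ : Subgroup G) y = MulAction.orbit G y := by
  ext z
  exact ⟨fun ⟨g, hg⟩ => ⟨g, hg⟩, fun ⟨g, hg⟩ => ⟨⟨g, trivial⟩, hg⟩⟩

theorem isPrincipalPoint_iff_isMinimalIsotropy_top {G M : Type*} [Group G] [MulAction G M]
    {x : M} : IsPrincipalPoint G x ↔ IsMinimalIsotropy (⊤ : Subgroup G) x univ := by
  refine ⟨fun hx y _ => ?_, fun hx y => ?_⟩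
  · obtain ⟨g, hg⟩ := hx y
    exact ⟨g, trivial, fun h _ hh => hg hh⟩
  · obtain ⟨g, -, hg⟩ := hx y trivial
    exact ⟨g, fun h hh => hg h trivial hh⟩

theorem isPrincipalPoint_iff_isMinimalIsotropy {G M : Type*} [Group G] [MulAction G M]
    {Γ : Subgroup G} {x : M} : IsPrincipalPoint Γ x ↔ IsMinimalIsotropy Γ x univ := by
  refine ⟨fun hx y _ => ?_, fun hx y => ?_⟩
  · obtain ⟨g, hg⟩ := hx y
    exact ⟨g, g.2, fun h hh hhx => @hg ⟨h, hh⟩ hhx⟩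
  · obtain ⟨g, hg, hgy⟩ := hx y trivial
    exact ⟨⟨g, hg⟩, fun h hh => hgy h h.2 hh⟩

theorem IsMinimalIsotropy.smul {G M : Type*} [Group G] [MulAction G M] {Γ : Subgroup G} {x : M}
    {S : Set M} (hx : IsMinimalIsotropy Γ x S) {a : G} (ha : a ∈ Γ) :
    IsMinimalIsotropy Γ (a • x) S := by
  intro y hy
  obtain ⟨g, hg, hgy⟩ := hx y hy
  refine ⟨a * g, Γ.mul_mem ha hg, fun h hh hhx => ?_⟩
  have h1 := hgy (a⁻¹ * h * a) (Γ.mul_mem (Γ.mul_mem (Γ.inv_mem ha) hh) ha) (by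
    rw [mul_smul, mul_smul, hhx, inv_smul_smul])
  rw [mul_smul, mul_smul, inv_smul_eq_iff] at h1
  rw [mul_smul, h1]

theorem IsMinimalIsotropy.stabilizer_le {G M : Type*} [Group G] [MulAction G M] {x p : M}
    (hx : IsMinimalIsotropy (⊤ : Subgroup G) x univ) (hK : (MulAction.stabilizer G p).Normal) :
    MulAction.stabilizer G x ≤ MulAction.stabilizer G p := by
  intro h hh
  obtain ⟨g, -, hg⟩ := hx p trivial
  have h1 := hg h trivial hh
  have h2 : g⁻¹ * h * g ∈ MulAction.stabilizer G p := by
    rw [MulAction.mem_stabilizer_iff, mul_smul, mul_smul, h1, inv_smul_smul]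
  simpa [mul_assoc] using hK.conj_mem _ h2 g

/-- If a minimal isotropy group is contained in `K`, and `K` has minimal isotropy groups, then it is
also minimal for the action of `K`. -/
theorem IsMinimalIsotropy.restrict {G M : Type*} [Group G] [TopologicalSpace G]
    [IsTopologicalGroup G] [CompactSpace G] [TopologicalSpace M] [T1Space M] [MulAction G M]
    [ContinuousSMul G M] {K : Subgroup G} {x z : M}
    (hx : IsMinimalIsotropy (⊤ : Subgroup G) x univ) (hK : K.Normal)
    (hxK : MulAction.stabilizer G x ≤ K) (hz : IsMinimalIsotropy K z univ) :
    IsMinimalIsotropy K x univ := by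
  obtain ⟨k, hk, hkx⟩ := hz x trivial
  obtain ⟨g, -, hg⟩ := hx z trivial
  have hgK : ∀ h ∈ MulAction.stabilizer G x, g⁻¹ * h * g ∈ K := fun h hh => by
    simpa using hK.conj_mem h (hxK hh) g⁻¹
  have hgz : ∀ h ∈ MulAction.stabilizer G x, (g⁻¹ * h * g) • z = z := fun h hh => by
    rw [mul_smul, mul_smul, hg h trivial hh, inv_smul_smul]
  -- With `H = G_x`, one has `g⁻¹ H g ⊆ K_z` and `k⁻¹ K_z k ⊆ H`, so `g * k` conjugates `H` into
  -- itself. Compactness makes both inclusions equalities, and minimality passes from `z` to `x`.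
  have hconj : ∀ h ∈ MulAction.stabilizer G x,
      (g * k)⁻¹ * h * ((g * k)⁻¹)⁻¹ ∈ MulAction.stabilizer G x := by
    intro h hh
    have h1 := hkx _ (hgK h hh) (hgz h hh)
    rw [MulAction.mem_stabilizer_iff]
    rw [show (g * k)⁻¹ * h * ((g * k)⁻¹)⁻¹ = k⁻¹ * (g⁻¹ * h * g) * k by group, mul_smul, mul_smul,
      h1, inv_smul_smul]
  have hcl : IsClosed (MulAction.stabilizer G x : Set G) := by
    have := isClosed_inf_stabilizer (Γ := (⊤ : Subgroup G)) isClosed_univ x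
    rwa [top_inf_eq] at this
  have hconj' := inv_mul_mul_mem_of_forall_mul_mul_inv_mem hcl hconj
  intro y _
  obtain ⟨l, hl, hly⟩ := hz y trivial
  refine ⟨k⁻¹ * l, K.mul_mem (K.inv_mem hk) hl, fun h hh hhx => ?_⟩
  have h1 := hconj' h hhx
  have h2 : g⁻¹ * ((g * k)⁻¹⁻¹ * h * (g * k)⁻¹) * g = k * h * k⁻¹ := by group
  have h3 := hly (k * h * k⁻¹) (K.mul_mem (K.mul_mem hk hh) (K.inv_mem hk))
    (by rw [← h2]; exact hgz _ h1)
  rw [mul_smul, mul_smul, ← eq_inv_smul_iff] at h3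
  rw [mul_smul, h3]

theorem preimage_quotientMapOfLE_singleton {G : Type*} [Group G] {H K : Subgroup G} (hHK : H ≤ K)
    (g : G) : Subgroup.quotientMapOfLE hHK ⁻¹' {(g : G ⧸ K)} =
      (fun k : G => ((g * k : G) : G ⧸ H)) '' (K : Set G) := by
  ext c
  induction c using QuotientGroup.induction_on with | H a
  simp only [mem_preimage, mem_singleton_iff, Subgroup.quotientMapOfLE_apply_mk, mem_image]
  constructor
  · intro h
    exact ⟨g⁻¹ * a, QuotientGroup.eq.1 h.symm, by rw [mul_inv_cancel_left]⟩
  · rintro ⟨k, hk, hka⟩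
    have h1 : (g * k)⁻¹ * a ∈ K := hHK (QuotientGroup.eq.1 hka)
    have h2 : g⁻¹ * a = k * ((g * k)⁻¹ * a) := by group
    exact (QuotientGroup.eq.2 (h2 ▸ K.mul_mem hk h1)).symm

/-- By normality `gK = Kg`, so the fiber over `gK` is carried onto the `K`-orbit of `g • x`. -/
theorem image_preimage_quotientMapOfLE {G M : Type*} [Group G] [MulAction G M] {K : Subgroup G}
    (hK : K.Normal) {x : M} (hHK : MulAction.stabilizer G x ≤ K) (g : G) :
    MulAction.ofQuotientStabilizer G x '' (Subgroup.quotientMapOfLE hHK ⁻¹' {(g : G ⧸ K)}) =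
      MulAction.orbit K (g • x) := by
  rw [preimage_quotientMapOfLE_singleton, image_image]
  ext z
  constructor
  · rintro ⟨k, hk, rfl⟩
    refine ⟨⟨g * k * g⁻¹, hK.conj_mem k hk g⟩, ?_⟩
    change (g * k * g⁻¹) • g • x = (g * k) • x
    rw [mul_smul _ g⁻¹, inv_smul_smul]
  · rintro ⟨k, rfl⟩
    refine ⟨g⁻¹ * k * g, by simpa using hK.conj_mem k k.2 g⁻¹, ?_⟩
    change (g * (g⁻¹ * k * g)) • x = (k : G) • g • x
    rw [← mul_smul]
    congr 1
    group

theorem setOf_isPrincipalOrbit_eq_range {G M : Type*} [Group G] [MulAction G M] {K : Subgroup G}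
    (hK : K.Normal) {x : M} (hHK : MulAction.stabilizer G x ≤ K)
    (hx : ∀ g : G, IsPrincipalPoint K (g • x)) :
    {O : Set M | IsPrincipalOrbit K O ∧ O ⊆ MulAction.orbit G x} =
      range (fun c : G ⧸ K =>
        MulAction.ofQuotientStabilizer G x '' (Subgroup.quotientMapOfLE hHK ⁻¹' {c})) := by
  ext O
  constructor
  · rintro ⟨⟨z, -, rfl⟩, hO⟩
    obtain ⟨g, rfl⟩ := hO (MulAction.mem_orbit_self z)
    exact ⟨(g : G ⧸ K), image_preimage_quotientMapOfLE hK hHK g⟩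
  · rintro ⟨c, rfl⟩
    induction c using QuotientGroup.induction_on with | H g
    simp only [image_preimage_quotientMapOfLE hK hHK]
    refine ⟨⟨_, hx g, rfl⟩, ?_⟩
    rintro _ ⟨k, rfl⟩
    exact ⟨(k : G) * g, mul_smul _ _ _⟩

variable {m n : ℕ} {G M : Type*} [Group G]
  [TopologicalSpace G] [ChartedSpace (EuclideanSpace ℝ (Fin m)) G] [IsTopologicalGroup G]
  [CompactSpace G] [TopologicalSpace M] [T2Space M] [ChartedSpace (EuclideanSpace ℝ (Fin n)) M]
  [IsManifold (𝓡 n) ∞ M] [MulAction G M] [ContinuousSMul G M] [ContMDiffSMul (𝓡 m) (𝓡 n) ∞ G M]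
  {E : Type*} [NormedAddCommGroup E] [InnerProductSpace ℝ E] [FiniteDimensional ℝ E] {φ : E → G}
  {Γ : Subgroup G}

theorem IsMinimalIsotropy.orbitRank_le {z : M} (hz : IsMinimalIsotropy Γ z univ)
    (hφ : IsLocalParam m Γ φ) (hΓ : IsClosed (Γ : Set G)) (y : M) :
    orbitRank n φ y ≤ orbitRank n φ z := by
  obtain ⟨g, hg, hgy⟩ := hz y trivial
  rw [← hφ.orbitRank_smul hΓ hg y]
  exact hφ.orbitRank_mono hgy

theorem IsMinimalIsotropy.hasOrbitSpaceDim {z : M} (hz : IsMinimalIsotropy Γ z univ)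
    (hφ : IsLocalParam m Γ φ) (hΓ : IsClosed (Γ : Set G)) {c : ℕ}
    (hc : orbitRank n φ z + c = n) : HasOrbitSpaceDim n Γ M c :=
  ⟨_, hc, ⟨z, hφ.hasDim_orbit hΓ z⟩, fun y => ⟨_, hz.orbitRank_le hφ hΓ y, hφ.hasDim_orbit hΓ y⟩⟩

end Normal

end CohomogeneityOne

/-! ### Assembly of the two assertions. -/

theorem lemma2p1 {m n : ℕ} {G M : Type*}
    -- a compact Lie group
    [Group G] [TopologicalSpace G] [T2Space G] [CompactSpace G]
    [ChartedSpace (EuclideanSpace ℝ (Fin m)) G] [LieGroup (𝓡 m) ∞ G]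
    -- a compact connected Riemannian manifold
    [TopologicalSpace M] [T2Space M] [CompactSpace M] [ConnectedSpace M]
    [ChartedSpace (EuclideanSpace ℝ (Fin n)) M] [IsManifold (𝓡 n) ∞ M]
    [Bundle.RiemannianBundle (fun x : M => TangentSpace (𝓡 n) x)]
    [IsContMDiffRiemannianBundle (𝓡 n) ∞ (EuclideanSpace ℝ (Fin n))
      (fun x : M => TangentSpace (𝓡 n) x)]
    -- a smooth isometric action of cohomogeneity one
    [MulAction G M]
    (hsmooth : ContMDiff ((𝓡 m).prod (𝓡 n)) (𝓡 n) ∞ (fun z : G × M => z.1 • z.2))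
    (hisom : IsIsometricAction n G M)
    (hcoh : IsCohomogeneityOne n G M)
    -- a normal singular isotropy group
    (K : Subgroup G) (hnormal : K.Normal) (hsing : IsSingularIsotropy n M K) :
    IsFixedPointHomogeneous n K M ∧
      -- for every principal orbit `G/H ≅ G • x`, where `H` is the isotropy group of `x`
      ∀ x : M, IsPrincipalPoint G x →
        ∃ hHK : MulAction.stabilizer G x ≤ K,
          (∀ g : G, Subgroup.quotientMapOfLE hHK ⁻¹' {(g : G ⧸ K)} =
            (fun k : G => ((g * k : G) : G ⧸ MulAction.stabilizer G x)) '' (K : Set G)) ∧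
          {O : Set M | IsPrincipalOrbit K O ∧ O ⊆ MulAction.orbit G x} =
            Set.range (fun c : G ⧸ K =>
              MulAction.ofQuotientStabilizer G x '' (Subgroup.quotientMapOfLE hHK ⁻¹' {c})) := by
  have : IsTopologicalGroup G := topologicalGroup_of_lieGroup (𝓡 m) ∞
  have : ContMDiffSMul (𝓡 m) (𝓡 n) ∞ G M := ⟨hsmooth⟩
  have : ContinuousSMul G M := ContMDiffSMul.continuousSMul (I := 𝓡 m) (I' := 𝓡 n) ∞
  have hΓ : IsClosed ((⊤ : Subgroup G) : Set G) := isClosed_univ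
  obtain ⟨φ, hφ⟩ := exists_isLocalParam_top (m := m) (G := G)
  obtain ⟨p, rfl, d, hd, hdn⟩ := hsing
  obtain ⟨x₀, d₀, hd₀, hd₀n⟩ := hcoh
  rw [← orbit_top] at hd hd₀
  have hp : orbitRank n φ p = d := hφ.orbitRank_eq hΓ hd
  have hx₀ : orbitRank n φ x₀ = d₀ := hφ.orbitRank_eq hΓ hd₀
  -- Minimal isotropy gives the largest orbit dimension, at least `n - 1` by cohomogeneity one. It
  -- is not `n`, since one orbit has dimension below `n`.
  have hmin : ∀ z : M, IsMinimalIsotropy (⊤ : Subgroup G) z Set.univ →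
      orbitRank n φ z + 1 = n := by
    intro z hz
    have h1 := hz.orbitRank_le (n := n) hφ hΓ x₀
    have h2 := hφ.orbitRank_lt hΓ (x := x₀) (by omega : orbitRank n φ x₀ < n) z
    omega
  obtain ⟨N, ψ, hψ, hrank⟩ := hφ.exists_stabilizer (n := n) p
  have hKc := isClosed_inf_stabilizer hΓ p
  rw [top_inf_eq] at hψ hKc
  obtain ⟨w, -, hw⟩ := exists_mem_isMinimalIsotropy hisom hKc hψ isOpen_univ ⟨p, trivial⟩
  obtain ⟨z, -, hz⟩ := exists_mem_isMinimalIsotropy hisom hΓ hφ isOpen_univ ⟨p, trivial⟩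
  -- With `d = dim G(p)`, principal `K`-orbits have dimension `n - 1 - d`, so the orbit space has
  -- dimension `d + 1`. The component of `M^K` through `p` has the largest dimension `d`.
  refine ⟨⟨d + 1, d, ?_, ⟨⟨p, fun k => k.2, ?_⟩, fun x hx => ⟨orbitRank n φ x, ?_, ?_⟩⟩, rfl⟩, ?_⟩
  · refine (hz.restrict hnormal (hz.stabilizer_le hnormal) hw).hasOrbitSpaceDim hψ hKc ?_
    have h1 := hrank z fun g _ hg => hz.stabilizer_le hnormal hg
    have h2 := hmin z hz
    omega
  · have h1 := hφ.hasLocalDim_fixedPoints hisom hnormal (by omega) hmin (x := p) fun k => k.2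
    rwa [hp] at h1
  · rw [← hp]
    exact hφ.orbitRank_mono fun g _ hg => hx ⟨g, hg⟩
  · exact hφ.hasLocalDim_fixedPoints hisom hnormal (by omega) hmin hx
  · intro x hx
    have hx' := isPrincipalPoint_iff_isMinimalIsotropy_top.1 hx
    refine ⟨hx'.stabilizer_le hnormal, preimage_quotientMapOfLE_singleton _,
      setOf_isPrincipalOrbit_eq_range hnormal _ fun g => ?_⟩
    have hgx := hx'.smul (a := g) trivial
    exact isPrincipalPoint_iff_isMinimalIsotropy.2
      (hgx.restrict hnormal (hgx.stabilizer_le hnormal) hw)
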